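/- Let $\mathbb K$ be $\mathbb R$ or $\mathbb C$, let $M$ be a smooth (Hausdorff) manifold of dimension $d$, and let $\mathrm{UConf}(M)=\bigsqcup_{k\ge 0}\mathrm{OConf}_k(M)/S_k$ be the manifold of finite subsets (configurations) of $M$. Vector bundles are smooth $\mathbb K$-vector bundles, of finite rank or with infinite local frames in which smooth sections have locally finitely many nonzero coefficients. Bundle maps are fibrewise linear, smooth, and cover the identity. For bundles $\mathbf A,\mathbf B$ on $\mathrm{UConf}(M)$, the Hadamard tensor product has the fibres $(\mathbf A\otimes\mathbf B)_{\underline x}=\mathbf A_{\underline x}\otimes\mathbf B_{\underline x}$, and the Cauchy tensor product has the fibres $(\mathbf A\boxtimes\mathbf B)_{\underline x}=\bigoplus_{\underline x=\underline x'\sqcup\underline x''}\mathbf A_{\underline x'}\otimes\mathbf B_{\underline x''}$ (sum over ordered splits), each with the induced smooth structure. The unit of $\boxtimes$ is $\mathbb K$ over $\emptyset$ and zero elsewhere. A bundle $V\to M$ is extended by zero to a bundle $i_*V$ on $\mathrm{UConf}(M)$, and $V\boxtimes V$ stands for $i_*V\boxtimes i_*V$. $S^\otimes(V)$ is the usual symmetric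 algebra bundle, with product $\odot$. $\mathbf S^\boxtimes(V)$ is the Cauchy symmetric bundle: its fibre over $\{x_1,\dots,x_k\}$ is $\bigoplus_{\sigma\in S_k}V_{x_{\sigma(1)}}\otimes\cdots\otimes V_{x_{\sigma(k)}}$ modulo permutation of the factors; $v_1\boxdot\cdots\boxdot v_k$ is the class of $v_1\otimes\cdots\otimes v_k$, and $\boxdot$ is also the product $\mathbf S^\boxtimes(V)_{\underline x}\otimes\mathbf S^\boxtimes(V)_{\underline y}\to\mathbf S^\boxtimes(V)_{\underline x\sqcup\underline y}$ induced by concatenation. On $\mathbf S^\boxtimes S^\otimes(V)$ let $\odot$ be the pointwise product $(a_1\boxdot\cdots\boxdot a_k)\odot(b_1\boxdot\cdots\boxdot b_k)=(a_1\odot b_1)\boxdot\cdots\boxdot(a_k\odot b_k)$ and let $1_{\underline x}=1_{x_1}\boxdot\cdots\boxdot1_{x_k}$. A Poisson $\boxtimes$-algebra bundle is a vector bundle $\mathbf P$ on $\mathrm{UConf}(M)$ with bundle maps making it a commutative monoid for $\boxtimes$, with multiplication $\bullet:\mathbf P\boxtimes\mathbf P\to\mathbf P$, and with a bundle map $\{\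 ,\ \}:\mathbf P\boxtimes\mathbf P\to\mathbf P$ that is antisymmetric and satisfies the Jacobi identity and the Leibniz rule $\{a,b\bullet c\}=\{a,b\}\bullet c+b\bullet\{a,c\}$ over pairwise disjoint configurations. Let $V$ and $W$ be vector bundles on $M$ and let $k:V\boxtimes V\to\mathrm{UConf}_2(M)\times\mathbb K$ be an antisymmetric bundle map. Then: 1. There is exactly one bundle map $\{\ ,\ \}_k:\mathbf S^\boxtimes S^\otimes(V)\boxtimes\mathbf S^\boxtimes S^\otimes(V)\to\mathbf S^\boxtimes S^\otimes(V)$ such that, for disjoint configurations, $\{a_{\underline x},1_{\underline y}\}_k=\{1_{\underline x},b_{\underline y}\}_k=0$; $\{u_x,v_y\}_k=k(u_x,v_y)\,1_x\boxdot1_y$ for $u_x\in V_x$, $v_y\in V_y$; and $\{\ ,\ \}_k$ satisfies in both arguments the Leibniz rules $\{a_{\underline x}\odot b_{\underline x},c_{\underline y}\}_k=\{a_{\underline x},c_{\underline y}\}_k\odot(b_{\underline x}\boxdot1_{\underline y})+(a_{\underline x}\boxdot1_{\underline y})\odot\{b_{\underline x},c_{\underline y}\}_k$ and $\{a_{\underline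 x}\boxdot b_{\underline y},c_{\underline z}\}_k=\{a_{\underline x},c_{\underline z}\}_k\boxdot b_{\underline y}+a_{\underline x}\boxdot\{b_{\underline y},c_{\underline z}\}_k$. With $\boxdot$ and $\{\ ,\ \}_k$, $\mathbf S^\boxtimes S^\otimes(V)$ is a Poisson $\boxtimes$-algebra bundle. 2. There is an isomorphism of vector bundles $$\mathbf S^\boxtimes\big(S^\otimes(V)\otimes W\big)\cong\mathbf S^\boxtimes S^\otimes(V)\otimes\mathbf S^\boxtimes(W),$$ sending $(a_1\otimes\alpha_1)\boxdot\cdots\boxdot(a_k\otimes\alpha_k)$ to $(a_1\boxdot\cdots\boxdot a_k)\otimes(\alpha_1\boxdot\cdots\boxdot\alpha_k)$. The right-hand side is a Poisson $\boxtimes$-algebra bundle with multiplication $(a_{\underline x}\otimes\alpha_{\underline x})\boxdot(b_{\underline y}\otimes\beta_{\underline y})=(a_{\underline x}\boxdot b_{\underline y})\otimes(\alpha_{\underline x}\boxdot\beta_{\underline y})$ and bracket $\{a_{\underline x}\otimes\alpha_{\underline x},b_{\underline y}\otimes\beta_{\underline y}\}=\{a_{\underline x},b_{\underline y}\}_k\otimes(\alpha_{\underline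 x}\boxdot\beta_{\underline y})$ for disjoint $\underline x,\underline y$. The left-hand side is a Poisson $\boxtimes$-algebra bundle with multiplication $\boxdot$, and the isomorphism is one of Poisson $\boxtimes$-algebra bundles. 3. In particular, the density bundle $\mathrm{Dens}_M$ (with $\mathbb K$-valued densities) is a vector bundle, and 2. holds for $W=\mathrm{Dens}_M$; the resulting Poisson $\boxtimes$-algebra bundle $\mathbf S^\boxtimes(S^\otimes(V)\otimes\mathrm{Dens}_M)$ is called the Poisson-Cauchy algebra bundle on $V$. -/

import Mathlib

open scoped TensorProduct Manifold ContDiff Topology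

universe u v w

namespace ConfBundle

noncomputable section

/-! ## Smooth spaces, vector bundles and bundle maps -/

/-- A topological space with the germs of its smooth `K`-valued functions:
`SmoothAt f x` says that `f` is smooth in a neighbourhood of `x`. It is used for a smooth manifold
and for its configuration space, so that the same words describe bundles over either of them. -/
structure SmoothSpace (K : Type) where
  carrier : Type u
  [top : TopologicalSpace carrier]
  SmoothAt : (carrier → K) → carrier → Prop

attribute [instance] SmoothSpace.top

/-- A smooth manifold of dimension `d` as a smooth space. -/
abbrev manifold (K : Type) [RCLike K] (d : ℕ) (M : Type u) [TopologicalSpace M]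
    [ChartedSpace (EuclideanSpace ℝ (Fin d)) M] : SmoothSpace.{u} K where
  carrier := M
  SmoothAt f x := ∀ᶠ y in 𝓝 x, ContMDiffAt (𝓡 d) 𝓘(ℝ, K) ∞ f y

variable {K : Type} [RCLike K]

/-- A family of `K`-vector spaces over `X` with a notion of smooth local section. Sections are
total functions; `SmoothAt s x` says that `s` is smooth in a neighbourhood of `x`. -/
structure BundleData (X : SmoothSpace.{u} K) where
  fiber : X.carrier → Type v
  [acg : ∀ x, AddCommGroup (fiber x)]
  [mod : ∀ x, Module K (fiber x)]
  SmoothAt : (∀ x, fiber x) → X.carrier → Prop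

attribute [instance] BundleData.acg BundleData.mod

/-- `E` is a smooth `K`-vector bundle: near each point there is a local trivialization, written as
a local frame `e`. It is a basis of each fibre, and a section is smooth at `y` exactly when it is
near `y` a finite combination of the frame with smooth coefficients. In finite rank these are the
usual smooth vector bundles; ind-finite bundles, such as symmetric algebra bundles, are covered by
infinite index sets. The rank may vary from one connected component to another. -/
def BundleData.IsVectorBundle {X : SmoothSpace.{u} K} (E : BundleData.{u, v} X) : Prop :=
  ∀ x₀ : X.carrier, ∃ (ι : Type v) (e : ι → ∀ x, E.fiber x), ∀ᶠ y in 𝓝 x₀,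
    LinearIndependent K (fun i => e i y) ∧
    Submodule.span K (Set.range fun i => e i y) = ⊤ ∧
    ∀ s : ∀ x, E.fiber x, E.SmoothAt s y ↔
      ∃ (J : Finset ι) (c : ι → X.carrier → K), (∀ i ∈ J, X.SmoothAt (c i) y) ∧
        ∀ᶠ z in 𝓝 y, s z = ∑ i ∈ J, c i z • e i z

/-- The smooth structure generated by a family of sections: `s` is smooth at `x` if near `x` it is
a finite combination, with smooth coefficients, of generating sections. `G g x` says that `g` is a
generating section near `x`. -/
def GeneratedSmoothAt {X : SmoothSpace.{u} K} {F : X.carrier → Type v}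
    [∀ x, AddCommGroup (F x)] [∀ x, Module K (F x)]
    (G : (∀ x, F x) → X.carrier → Prop) (s : ∀ x, F x) (x : X.carrier) : Prop :=
  ∃ (n : ℕ) (c : Fin n → X.carrier → K) (g : Fin n → ∀ x, F x),
    (∀ i, X.SmoothAt (c i) x ∧ G (g i) x) ∧ ∀ᶠ y in 𝓝 x, s y = ∑ i, c i y • g i y

/-- Bundle maps over the identity: fibrewise linear and smooth. -/
@[ext]
structure Hom {X : SmoothSpace.{u} K} (E : BundleData.{u, v} X) (F : BundleData.{u, w} X) where
  app : ∀ x, E.fiber x →ₗ[K] F.fiber x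
  smooth : ∀ (s : ∀ x, E.fiber x) (x : X.carrier),
    E.SmoothAt s x → F.SmoothAt (fun y => app y (s y)) x

/-- Isomorphisms of bundles over the identity. -/
structure Iso {X : SmoothSpace.{u} K} (E : BundleData.{u, v} X) (F : BundleData.{u, w} X) where
  hom : Hom E F
  inv : Hom F E
  hom_inv : ∀ x a, inv.app x (hom.app x a) = a
  inv_hom : ∀ x b, hom.app x (inv.app x b) = b

/-- The usual (Hadamard) tensor product of bundles, with smooth structure generated by
`s ⊗ t` for smooth sections `s` and `t`. -/
abbrev BundleData.hadamard {X : SmoothSpace.{u} K} (E : BundleData.{u, v} X)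
    (F : BundleData.{u, w} X) : BundleData.{u, max v w} X where
  fiber x := E.fiber x ⊗[K] F.fiber x
  SmoothAt := GeneratedSmoothAt fun g x =>
    ∃ (s : ∀ y, E.fiber y) (t : ∀ y, F.fiber y), E.SmoothAt s x ∧ F.SmoothAt t x ∧
      g = fun y => s y ⊗ₜ[K] t y

/-- The (Hadamard) symmetric algebra bundle, with smooth structure generated by the products
`s₁ ⊙ ⋯ ⊙ sₘ` of smooth sections. -/
abbrev BundleData.sym {X : SmoothSpace.{u} K} (E : BundleData.{u, v} X) : BundleData.{u, v} X where
  fiber x := SymmetricAlgebra K (E.fiber x)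
  SmoothAt := GeneratedSmoothAt fun g x =>
    ∃ (m : ℕ) (t : Fin m → ∀ y, E.fiber y), (∀ j, E.SmoothAt (t j) x) ∧
      g = fun y => ∏ j, SymmetricAlgebra.ι K (E.fiber y) (t j y)

/-- The trivial line bundle, which is the unit of the Hadamard tensor product. -/
abbrev trivialLine (X : SmoothSpace.{u} K) : BundleData.{u, 0} X where
  fiber _ := K
  SmoothAt := X.SmoothAt

/-! ## The configuration space -/

section Config

variable {M : Type u}

/-- The configuration underlying a `k`-tuple of points. -/
def underlying {k : ℕ} (p : Fin k → M) : Finset M := by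
  classical exact Finset.univ.image p

/-- Unordered configurations (finite subsets) of `M`, topologized as the disjoint union of the
quotients of the ordered configuration spaces by the symmetric groups. A function is smooth if its
pullback to each ordered configuration space, which is open in `M ^ k`, is smooth. -/
abbrev UConf (K : Type) [RCLike K] (d : ℕ) (M : Type u) [TopologicalSpace M]
    [ChartedSpace (EuclideanSpace ℝ (Fin d)) M] : SmoothSpace.{u} K where
  carrier := Finset M
  top := ⨆ k : ℕ, TopologicalSpace.coinduced
    (fun p : {p : Fin k → M // Function.Injective p} => underlying p.1) inferInstance
  SmoothAt f x :=
    letI : TopologicalSpace (Finset M) := ⨆ k : ℕ, TopologicalSpace.coinduced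
      (fun p : {p : Fin k → M // Function.Injective p} => underlying p.1) inferInstance
    ∀ᶠ y in 𝓝 x, ∀ (k : ℕ) (p : Fin k → M), Function.Injective p → underlying p = y →
      ContMDiffAt (ModelWithCorners.pi fun _ : Fin k => 𝓡 d) 𝓘(ℝ, K) ∞
        (fun p' : Fin k → M => f (underlying p')) p

/-- `z` is the disjoint union of `x` and `y`; the order of `x` and `y` matters. -/
structure IsSplit (x y z : Finset M) : Prop where
  disj : Disjoint x y
  mem_iff : ∀ p, p ∈ z ↔ p ∈ x ∨ p ∈ y

theorem IsSplit.symm {x y z : Finset M} (h : IsSplit x y z) : IsSplit y x z :=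
  ⟨h.disj.symm, fun p => (h.mem_iff p).trans or_comm⟩

theorem IsSplit.empty_left (x : Finset M) : IsSplit ∅ x x :=
  ⟨by simp, by simp⟩

theorem IsSplit.empty_right (x : Finset M) : IsSplit x ∅ x :=
  ⟨by simp, by simp⟩

/-- The points of a configuration that lie in `U`. -/
def restrict (x : Finset M) (U : Set M) : Finset M := by
  classical exact x.filter (· ∈ U)

/-- The disjoint union of `x` and `y`, as an equivalence of index types. -/
def IsSplit.sumEquiv {x y z : Finset M} (h : IsSplit x y z) : (x ⊕ y) ≃ z :=
  Equiv.ofBijective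
    (Sum.elim (fun p => ⟨p.1, (h.mem_iff p.1).2 (Or.inl p.2)⟩)
      (fun p => ⟨p.1, (h.mem_iff p.1).2 (Or.inr p.2)⟩))
    (by
      constructor
      · rintro (p | p) (q | q) hpq
        · exact congrArg Sum.inl (Subtype.ext (congrArg (fun r : z => r.1) hpq))
        · exact absurd (congrArg Subtype.val hpq)
            (fun e => Finset.disjoint_left.1 h.disj p.2 (by
              have e' : p.1 = q.1 := e
              rw [e']; exact q.2))
        · exact absurd (congrArg Subtype.val hpq)
            (fun e => Finset.disjoint_left.1 h.disj q.2 (by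
              have e' : p.1 = q.1 := e
              rw [← e']; exact p.2))
        · exact congrArg Sum.inr (Subtype.ext (congrArg (fun r : z => r.1) hpq))
      · rintro ⟨p, hp⟩
        rcases (h.mem_iff p).1 hp with hx | hy
        · exact ⟨Sum.inl ⟨p, hx⟩, rfl⟩
        · exact ⟨Sum.inr ⟨p, hy⟩, rfl⟩)

end Config

/-! ## Bundles over the configuration space -/

variable {d : ℕ} {M : Type u} [TopologicalSpace M] [ChartedSpace (EuclideanSpace ℝ (Fin d)) M]

/-- The unit of the Cauchy tensor product: `K` over the empty configuration, zero elsewhere.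
The empty configuration is an isolated point, so smoothness is no condition. -/
abbrev cauchyUnit (K : Type) [RCLike K] (d : ℕ) (M : Type u) [TopologicalSpace M]
    [ChartedSpace (EuclideanSpace ℝ (Fin d)) M] : BundleData.{u, 0} (UConf K d M) where
  fiber x := {_a : Unit // x = ∅} → K
  SmoothAt _ _ := True

/-- The extension `i_* V` of a bundle on `M` by zero: the fibre over `{p}` is `V p`, and the fibre
over a configuration that is not a single point is zero. -/
abbrev BundleData.push (V : BundleData.{u, v} (manifold K d M)) :
    BundleData.{u, max u v} (UConf K d M) where
  fiber x := ∀ p : {p : M // x = {p}}, V.fiber p.1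
  SmoothAt s x := ∀ p : M, x = {p} → V.SmoothAt (fun q => s {q} ⟨q, rfl⟩) p

/-- The vector `s p` in the fibre of `i_* V` over `{p}`. -/
def BundleData.pushVec (V : BundleData.{u, v} (manifold K d M)) (s : ∀ p : M, V.fiber p) (p : M) :
    V.push.fiber ({p} : Finset M) := fun q => s q.1

/-- The fibre `⨁ A_{x'} ⊗ B_{x''}` of the Cauchy tensor product, over all ordered splits
`x = x' ⊔ x''`. -/
abbrev CauchyFiber (A : BundleData.{u, v} (UConf K d M)) (B : BundleData.{u, w} (UConf K d M))
    (x : Finset M) : Type (max u v w) :=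
  DirectSum {q : Finset M × Finset M // IsSplit q.1 q.2 x}
    fun q => A.fiber q.1.1 ⊗[K] B.fiber q.1.2

/-- The element `a ⊗ b` in the summand of a split. -/
def cauchyMk {A : BundleData.{u, v} (UConf K d M)} {B : BundleData.{u, w} (UConf K d M)}
    {x y z : Finset M} (h : IsSplit x y z) (a : A.fiber x) (b : B.fiber y) :
    CauchyFiber A B z := by
  classical
  exact DirectSum.of
    (fun q : {q : Finset M × Finset M // IsSplit q.1 q.2 z} =>
      A.fiber q.1.1 ⊗[K] B.fiber q.1.2) ⟨(x, y), h⟩ (a ⊗ₜ[K] b)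

/-- The Cauchy tensor product `A ⊠ B`. If `U` and `U'` are disjoint open sets of `M`, then each
configuration in `U ∪ U'` has a distinguished split into its parts in `U` and in `U'`; the smooth
structure is generated by the sections `x ↦ s (x ∩ U) ⊗ t (x ∩ U')` in that summand. -/
abbrev BundleData.cauchy (A : BundleData.{u, v} (UConf K d M))
    (B : BundleData.{u, w} (UConf K d M)) : BundleData.{u, max u v w} (UConf K d M) where
  fiber := CauchyFiber A B
  SmoothAt := GeneratedSmoothAt (X := UConf K d M) fun g x =>
    ∃ (U U' : Set M) (s : ∀ y, A.fiber y) (t : ∀ y, B.fiber y),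
      IsOpen U ∧ IsOpen U' ∧ Disjoint U U' ∧ (∀ p ∈ x, p ∈ U ∪ U') ∧
      A.SmoothAt s (restrict x U) ∧ B.SmoothAt t (restrict x U') ∧
      ∀ (y : Finset M) (h : IsSplit (restrict y U) (restrict y U') y),
        g y = cauchyMk h (s (restrict y U)) (t (restrict y U'))

/-- The component on the fibres over `x` and `y` of a bundle map out of a Cauchy tensor product. -/
def Hom.on {A : BundleData.{u, v} (UConf K d M)} {B : BundleData.{u, w} (UConf K d M)}
    {C : BundleData (UConf K d M)} (m : Hom (A.cauchy B) C) {x y z : Finset M}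
    (h : IsSplit x y z) (a : A.fiber x) (b : B.fiber y) : C.fiber z :=
  m.app z (cauchyMk h a b)

/-! ## The Cauchy symmetric bundle -/

section CauchySymmetric

variable (V : BundleData.{u, v} (manifold K d M))

/-- The fibre `⨁ V_{x_1} ⊗ ⋯ ⊗ V_{x_k}` of the Cauchy tensor bundle over a `k`-point configuration,
over all orderings `o = (x_1, …, x_k)` of its points. -/
abbrev TFiber (x : Finset M) : Type (max u v) :=
  DirectSum (Fin x.card ≃ x) fun o => ⨂[K] i : Fin x.card, V.fiber (o i).1

/-- The decomposable tensor `a₁ ⊗ ⋯ ⊗ aₖ` with `aᵢ` over the point `o i`. -/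
def tens {x : Finset M} (o : Fin x.card ≃ x) (a : ∀ i, V.fiber (o i).1) : TFiber V x := by
  classical
  exact DirectSum.lof K (Fin x.card ≃ x)
    (fun o => ⨂[K] i : Fin x.card, V.fiber (o i).1) o (PiTensorProduct.tprod K a)

/-- The span of the differences of a Cauchy tensor and its images under the permutations
`a₁ ⊗ ⋯ ⊗ aₖ ↦ a_{σ(1)} ⊗ ⋯ ⊗ a_{σ(k)}`. -/
def symRel (x : Finset M) : Submodule K (TFiber V x) :=
  Submodule.span K {t | ∃ (o : Fin x.card ≃ x) (a : ∀ i, V.fiber (o i).1)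
    (σ : Equiv.Perm (Fin x.card)),
      t = tens V (σ.trans o) (fun i => a (σ i)) - tens V o a}

/-- The fibre of the Cauchy symmetric bundle: Cauchy tensors modulo permutations. -/
abbrev SFiber (x : Finset M) : Type (max u v) := TFiber V x ⧸ symRel V x

/-- The class `s x_1 ⊡ ⋯ ⊡ s x_k` over `x = {x_1, …, x_k}` (for any ordering of the points). Only
the values of `s` at the points of `x` matter. -/
def boxProd (x : Finset M) (s : ∀ p : M, V.fiber p) : SFiber V x :=
  Submodule.Quotient.mk (tens V x.equivFin.symm fun i => s (x.equivFin.symm i).1)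

/-- The Cauchy symmetric bundle. Its smooth structure is generated by the sections
`x ↦ s x_1 ⊡ ⋯ ⊡ s x_k`. Here `s` need only be smooth near the points of a given configuration
`{p_1, …, p_k}`; so it may consist of `k` unrelated sections near the different points `p_i`. -/
abbrev BundleData.cauchySym : BundleData.{u, max u v} (UConf K d M) where
  fiber := SFiber V
  SmoothAt := GeneratedSmoothAt (X := UConf K d M) fun g x =>
    ∃ s : ∀ p : M, V.fiber p, (∀ p ∈ x, V.SmoothAt s p) ∧ g = fun y => boxProd V y s


/-- The multilinear map `a ↦ ⨂ a_p` written with the factors in the order `o`. -/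
def orderedTprod {x : Finset M} (o : Fin x.card ≃ x) :
    MultilinearMap K (fun i : Fin x.card => V.fiber (o i).1) (⨂[K] p : x, V.fiber p.1) :=
  MultilinearMap.domDomCongrLinearEquiv' K K (fun p : x => V.fiber p.1)
    (⨂[K] p : x, V.fiber p.1) o.symm (PiTensorProduct.tprod K)

theorem orderedTprod_apply {x : Finset M} (o : Fin x.card ≃ x) (s : ∀ p : x, V.fiber p.1) :
    orderedTprod V o (fun i => s (o i)) = PiTensorProduct.tprod K s := by
  unfold orderedTprod
  show PiTensorProduct.tprod K _ = _
  congr 1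
  funext p
  obtain ⟨i, rfl⟩ := o.surjective p
  exact (Equiv.piCongrLeft'_symm_apply_apply (fun p : x => V.fiber p.1) o.symm _ i)

/-- Forgetting the order of the factors. -/
def forgetOrder (x : Finset M) : TFiber V x →ₗ[K] ⨂[K] p : x, V.fiber p.1 := by
  classical
  exact DirectSum.toModule K _ _ fun o => PiTensorProduct.lift (orderedTprod V o)

theorem forgetOrder_tens {x : Finset M} (o : Fin x.card ≃ x) (s : ∀ p : x, V.fiber p.1) :
    forgetOrder V x (tens V o fun i => s (o i)) = PiTensorProduct.tprod K s := by
  classical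
  unfold forgetOrder tens
  rw [DirectSum.toModule_lof, PiTensorProduct.lift.tprod]
  exact orderedTprod_apply V o s

/-- Each decomposable tensor comes from a family indexed by the points. -/
theorem exists_family {x : Finset M} (o : Fin x.card ≃ x) (a : ∀ i, V.fiber (o i).1) :
    ∃ s : ∀ p : x, V.fiber p.1, a = fun i => s (o i) :=
  ⟨Equiv.piCongrLeft (fun p : x => V.fiber p.1) o a, by
    funext i
    exact (Equiv.piCongrLeft_apply_apply (fun p : x => V.fiber p.1) o a i).symm⟩

theorem mk_tens_eq {x : Finset M} (o o' : Fin x.card ≃ x) (s : ∀ p : x, V.fiber p.1) :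
    (Submodule.Quotient.mk (tens V o' fun i => s (o' i)) : SFiber V x) =
      Submodule.Quotient.mk (tens V o fun i => s (o i)) := by
  refine (Submodule.Quotient.eq _).2 (Submodule.subset_span ⟨o, fun i => s (o i), o'.trans o.symm, ?_⟩)
  have : o' = (o'.trans o.symm).trans o := by ext; simp
  congr 1
  have key : ∀ o'' : Fin x.card ≃ x, o' = o'' →
      (tens V o' fun i => s (o' i)) = tens V o'' fun i => s (o'' i) := by
    rintro _ rfl; rfl
  exact key _ this

theorem symRel_le (x : Finset M) : symRel V x ≤ LinearMap.ker (forgetOrder V x) := by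
  refine Submodule.span_le.2 ?_
  rintro _ ⟨o, a, σ, rfl⟩
  obtain ⟨s, rfl⟩ := exists_family V o a
  have h1 := forgetOrder_tens V o s
  have h2 := forgetOrder_tens V (σ.trans o) s
  simp only [SetLike.mem_coe, LinearMap.mem_ker, map_sub, sub_eq_zero]
  exact h2.trans h1.symm

/-- Choosing an order of the factors. -/
def chooseOrder (x : Finset M) : (⨂[K] p : x, V.fiber p.1) →ₗ[K] SFiber V x := by
  classical
  exact (symRel V x).mkQ ∘ₗ DirectSum.lof K (Fin x.card ≃ x)
      (fun o => ⨂[K] i : Fin x.card, V.fiber (o i).1) x.equivFin.symm ∘ₗ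
      (PiTensorProduct.reindex K (fun p : x => V.fiber p.1) x.equivFin).toLinearMap

theorem chooseOrder_tprod (x : Finset M) (s : ∀ p : x, V.fiber p.1) :
    chooseOrder V x (PiTensorProduct.tprod K s) =
      Submodule.Quotient.mk (tens V x.equivFin.symm fun i => s (x.equivFin.symm i)) := by
  classical
  unfold chooseOrder
  simp only [LinearMap.comp_apply, LinearEquiv.coe_coe, PiTensorProduct.reindex_tprod]
  rfl

/-- The fibre over `{x_1, …, x_k}` is isomorphic to the (unordered) tensor product of the spaces
`V x_i`. -/
def sEquiv (x : Finset M) : SFiber V x ≃ₗ[K] ⨂[K] p : x, V.fiber p.1 := by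
  classical
  refine LinearEquiv.ofLinearMap ((symRel V x).liftQ (forgetOrder V x) (symRel_le V x))
    (chooseOrder V x) ?_ ?_
  · ext s
    exact (congrArg ((symRel V x).liftQ (forgetOrder V x) (symRel_le V x))
      (chooseOrder_tprod V x s)).trans (forgetOrder_tens V x.equivFin.symm s)
  · ext o a
    obtain ⟨s, rfl⟩ := exists_family V o a
    exact ((congrArg (chooseOrder V x) (forgetOrder_tens V o s)).trans
      (chooseOrder_tprod V x s)).trans (mk_tens_eq V o x.equivFin.symm s)

theorem sEquiv_boxProd (x : Finset M) (s : ∀ p : M, V.fiber p) :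
    sEquiv V x (boxProd V x s) = PiTensorProduct.tprod K fun p : x => s p.1 :=
  forgetOrder_tens V x.equivFin.symm fun p : x => s p.1

/-- The product `⊡` of the Cauchy symmetric bundle on the fibres over the disjoint configurations
`x` and `y`, induced by the concatenation of tensors. -/
def boxdot {x y z : Finset M} (h : IsSplit x y z) (a : SFiber V x) (b : SFiber V y) :
    SFiber V z :=
  (sEquiv V z).symm
    ((PiTensorProduct.reindex K (fun p : z => V.fiber p.1) h.sumEquiv.symm).symm
      (PiTensorProduct.tmulEquivDep K (fun i : x ⊕ y => V.fiber (h.sumEquiv i).1)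
        (sEquiv V x a ⊗ₜ[K] sEquiv V y b)))

theorem boxdot_boxProd {x y z : Finset M} (h : IsSplit x y z) (s t r : ∀ p : M, V.fiber p)
    (hs : ∀ p ∈ x, r p = s p) (ht : ∀ p ∈ y, r p = t p) :
    boxdot V h (boxProd V x s) (boxProd V y t) = boxProd V z r := by
  apply (sEquiv V z).injective
  have key : PiTensorProduct.tmulEquivDep K (fun i : x ⊕ y => V.fiber (h.sumEquiv i).1)
      ((PiTensorProduct.tprod K fun p : x => s p.1) ⊗ₜ[K]
        (PiTensorProduct.tprod K fun p : y => t p.1)) =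
      PiTensorProduct.reindex K (fun p : z => V.fiber p.1) h.sumEquiv.symm
        (PiTensorProduct.tprod K fun p : z => r p.1) := by
    rw [PiTensorProduct.reindex_tprod]
    have hs' : (fun p : x => s p.1) = fun p : x => r p.1 := by
      funext p; exact (hs p.1 p.2).symm
    have ht' : (fun p : y => t p.1) = fun p : y => r p.1 := by
      funext p; exact (ht p.1 p.2).symm
    rw [hs', ht']
    refine (PiTensorProduct.tmulEquivDep_apply K (fun i : x ⊕ y => V.fiber (h.sumEquiv i).1)
      (fun p => r p.1) (fun p => r p.1)).trans (congrArg (PiTensorProduct.tprod K) ?_)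
    funext i
    cases i <;> rfl
  have h1 := sEquiv_boxProd V x s
  have h2 := sEquiv_boxProd V y t
  have h3 := sEquiv_boxProd V z r
  unfold boxdot
  rw [LinearEquiv.apply_symm_apply, h1, h2, h3]
  exact (congrArg _ key).trans (LinearEquiv.symm_apply_apply _ _)

/-- The Hadamard product `⊙` of `S^⊠ S^⊗ V` on the fibre over `x`, induced by the products of the
symmetric algebras at the points of `x`. -/
def odot {x : Finset M} (a b : SFiber V.sym x) : SFiber V.sym x :=
  (sEquiv V.sym x).symm
    (PiTensorProduct.map₂ (fun p : x => LinearMap.mul K (SymmetricAlgebra K (V.fiber p.1)))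
      (sEquiv V.sym x a) (sEquiv V.sym x b))

theorem odot_boxProd (x : Finset M) (s t : ∀ p : M, SymmetricAlgebra K (V.fiber p)) :
    odot V (boxProd V.sym x s) (boxProd V.sym x t) = boxProd V.sym x fun p => s p * t p := by
  apply (sEquiv V.sym x).injective
  have h1 := sEquiv_boxProd V.sym x s
  have h2 := sEquiv_boxProd V.sym x t
  have h3 := sEquiv_boxProd V.sym x fun p => s p * t p
  unfold odot
  refine (LinearEquiv.apply_symm_apply _ _).trans (Eq.trans ?_ h3.symm)
  rw [h1, h2]
  exact PiTensorProduct.map₂_tprod_tprod _ _ _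

/-- The Hadamard unit `1_x = 1_{x_1} ⊡ ⋯ ⊡ 1_{x_k}`. -/
def oneAt (x : Finset M) : SFiber V.sym x :=
  boxProd V.sym x fun p => (1 : SymmetricAlgebra K (V.fiber p))

/-- The generator `u p ∈ V p`, seen in the fibre of `S^⊠ S^⊗ V` over `{p}`. -/
def genAt (u : ∀ p : M, V.fiber p) (p : M) : SFiber V.sym {p} :=
  boxProd V.sym {p} fun q => SymmetricAlgebra.ι K (V.fiber q) (u q)

end CauchySymmetric

/-! ## Poisson algebra bundles -/

/-- Commutative `⊠`-algebra bundles: vector bundles with the structure of a commutative monoid for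
the Cauchy tensor product. The identities are written on the summands of the iterated Cauchy tensor products. -/
structure CommCauchyAlgebra (A : BundleData.{u, v} (UConf K d M)) where
  isVectorBundle : A.IsVectorBundle
  mul : Hom (A.cauchy A) A
  unit : Hom (cauchyUnit K d M) A
  mul_assoc : ∀ {x y z xy yz w : Finset M} (h₁ : IsSplit x y xy) (h₂ : IsSplit xy z w)
    (h₃ : IsSplit y z yz) (h₄ : IsSplit x yz w) (a : A.fiber x) (b : A.fiber y) (c : A.fiber z),
    mul.on h₂ (mul.on h₁ a b) c = mul.on h₄ a (mul.on h₃ b c)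
  one_mul : ∀ (x : Finset M) (a : A.fiber x),
    mul.on (IsSplit.empty_left x) (unit.app (∅ : Finset M) fun _ => 1) a = a
  mul_one : ∀ (x : Finset M) (a : A.fiber x),
    mul.on (IsSplit.empty_right x) a (unit.app (∅ : Finset M) fun _ => 1) = a
  mul_comm : ∀ {x y z : Finset M} (h : IsSplit x y z) (a : A.fiber x) (b : A.fiber y),
    mul.on h a b = mul.on h.symm b a

/-- Poisson `⊠`-algebra bundles. -/
structure PoissonCauchyAlgebra (A : BundleData.{u, v} (UConf K d M)) extends
    CommCauchyAlgebra A where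
  bracket : Hom (A.cauchy A) A
  antisymm : ∀ {x y z : Finset M} (h : IsSplit x y z) (a : A.fiber x) (b : A.fiber y),
    bracket.on h a b = -bracket.on h.symm b a
  jacobi : ∀ {x y z xy yz zx w : Finset M} (hxy : IsSplit x y xy) (hyz : IsSplit y z yz)
    (hzx : IsSplit z x zx) (h₁ : IsSplit xy z w) (h₂ : IsSplit yz x w) (h₃ : IsSplit zx y w)
    (a : A.fiber x) (b : A.fiber y) (c : A.fiber z),
    bracket.on h₁ (bracket.on hxy a b) c + bracket.on h₂ (bracket.on hyz b c) a +
      bracket.on h₃ (bracket.on hzx c a) b = 0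
  leibniz : ∀ {x y z xy yz xz w : Finset M} (hxy : IsSplit x y xy) (hyz : IsSplit y z yz)
    (hxz : IsSplit x z xz) (h₁ : IsSplit x yz w) (h₂ : IsSplit xy z w) (h₃ : IsSplit y xz w)
    (a : A.fiber x) (b : A.fiber y) (c : A.fiber z),
    bracket.on h₁ a (mul.on hyz b c) =
      mul.on h₂ (bracket.on hxy a b) c + mul.on h₃ b (bracket.on hxz a c)

/-- `Φ` is an isomorphism of Poisson `⊠`-algebra bundles. -/
def IsPoissonIso {A : BundleData.{u, v} (UConf K d M)} {B : BundleData.{u, w} (UConf K d M)}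
    (Φ : Iso A B) (P : PoissonCauchyAlgebra A) (Q : PoissonCauchyAlgebra B) : Prop :=
  (∀ c, Φ.hom.app (∅ : Finset M) (P.unit.app (∅ : Finset M) c) = Q.unit.app (∅ : Finset M) c) ∧
  ∀ {x y z : Finset M} (h : IsSplit x y z) (a : A.fiber x) (b : A.fiber y),
    Φ.hom.app z (P.mul.on h a b) = Q.mul.on h (Φ.hom.app x a) (Φ.hom.app y b) ∧
    Φ.hom.app z (P.bracket.on h a b) = Q.bracket.on h (Φ.hom.app x a) (Φ.hom.app y b)

/-- Kernels on `V`: bundle maps from `V ⊠ V` to the trivial line bundle. Here `V ⊠ V` is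
`i_* V ⊠ i_* V`, which is zero except over the two-point configurations. -/
abbrev Kernel (V : BundleData.{u, v} (manifold K d M)) :=
  Hom (V.push.cauchy V.push) (trivialLine (UConf K d M))

/-- Antisymmetry with respect to the braiding of the Cauchy tensor product. -/
def Kernel.IsAntisymm {V : BundleData.{u, v} (manifold K d M)} (k : Kernel V) : Prop :=
  ∀ {x y z : Finset M} (h : IsSplit x y z) (a : V.push.fiber x) (b : V.push.fiber y),
    k.on h a b = -k.on h.symm b a

/-- The recursive rules for the bracket on `S^⊠ S^⊗ V` with kernel `k`: it vanishes on units, it is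
given by `k` on the generators, and it satisfies the Leibniz rules for `⊙` and for `⊡` in both
arguments. -/
structure IsKernelBracket {V : BundleData.{u, v} (manifold K d M)} (k : Kernel V)
    (B : Hom (V.sym.cauchySym.cauchy V.sym.cauchySym) V.sym.cauchySym) : Prop where
  unit_right : ∀ {x y z : Finset M} (h : IsSplit x y z) (a : SFiber V.sym x),
    B.on h a (oneAt V y) = 0
  unit_left : ∀ {x y z : Finset M} (h : IsSplit x y z) (b : SFiber V.sym y),
    B.on h (oneAt V x) b = 0
  gen : ∀ {p q : M} {z : Finset M} (h : IsSplit {p} {q} z) (u v : ∀ p : M, V.fiber p),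
    B.on h (genAt V u p) (genAt V v q) =
      (k.on h (V.pushVec u p) (V.pushVec v q) : K) • boxdot V.sym h (oneAt V {p}) (oneAt V {q})
  odot_left : ∀ {x y z : Finset M} (h : IsSplit x y z) (a b : SFiber V.sym x) (c : SFiber V.sym y),
    B.on h (odot V a b) c =
      odot V (B.on h a c) (boxdot V.sym h b (oneAt V y)) +
      odot V (boxdot V.sym h a (oneAt V y)) (B.on h b c)
  odot_right : ∀ {x y z : Finset M} (h : IsSplit x y z) (a : SFiber V.sym x)
    (b c : SFiber V.sym y),
    B.on h a (odot V b c) =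
      odot V (B.on h a b) (boxdot V.sym h (oneAt V x) c) +
      odot V (boxdot V.sym h (oneAt V x) b) (B.on h a c)
  boxdot_left : ∀ {x y z xy yz xz w : Finset M} (hxy : IsSplit x y xy) (hyz : IsSplit y z yz)
    (hxz : IsSplit x z xz) (h₁ : IsSplit xy z w) (h₂ : IsSplit xz y w) (h₃ : IsSplit x yz w)
    (a : SFiber V.sym x) (b : SFiber V.sym y) (c : SFiber V.sym z),
    B.on h₁ (boxdot V.sym hxy a b) c =
      boxdot V.sym h₂ (B.on hxz a c) b + boxdot V.sym h₃ a (B.on hyz b c)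
  boxdot_right : ∀ {x y z xy yz xz w : Finset M} (hxy : IsSplit x y xy) (hyz : IsSplit y z yz)
    (hxz : IsSplit x z xz) (h₁ : IsSplit x yz w) (h₂ : IsSplit xy z w) (h₃ : IsSplit y xz w)
    (a : SFiber V.sym x) (b : SFiber V.sym y) (c : SFiber V.sym z),
    B.on h₁ a (boxdot V.sym hyz b c) =
      boxdot V.sym h₂ (B.on hxy a b) c + boxdot V.sym h₃ b (B.on hxz a c)

/-! ## Densities -/

/-- The `K`-valued densities on the tangent space at `x`: functions `ν` of `d` tangent vectors with
`ν (A v₁, …, A v_d) = |det A| ν (v₁, …, v_d)`. -/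
def densitySpace (K : Type) [RCLike K] (d : ℕ) (M : Type u) [TopologicalSpace M]
    [ChartedSpace (EuclideanSpace ℝ (Fin d)) M] (x : M) :
    Submodule K ((Fin d → TangentSpace (𝓡 d) x) → K) where
  carrier := {ν | ∀ (A : TangentSpace (𝓡 d) x →ₗ[ℝ] TangentSpace (𝓡 d) x)
    (v : Fin d → TangentSpace (𝓡 d) x), ν (fun i => A (v i)) = (|LinearMap.det A| : ℝ) * ν v}
  add_mem' := by
    intro a b ha hb A v
    simp only [Pi.add_apply, ha A v, hb A v, mul_add]
  zero_mem' := by intro A v; simp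
  smul_mem' := by
    intro c a ha A v
    simp only [Pi.smul_apply, ha A v, smul_eq_mul, mul_left_comm]

/-- The density bundle of `M` (tensored with `ℂ` if `K = ℂ`). A density is smooth at `x` if its
values on each smooth local frame of the tangent bundle near `x` are smooth. -/
abbrev densities (K : Type) [RCLike K] (d : ℕ) (M : Type u) [TopologicalSpace M]
    [ChartedSpace (EuclideanSpace ℝ (Fin d)) M] [IsManifold (𝓡 d) ∞ M] :
    BundleData.{u, 0} (manifold K d M) where
  fiber x := densitySpace K d M x
  SmoothAt ν x := ∀ X : Fin d → ∀ y : M, TangentSpace (𝓡 d) y,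
    (∀ i, ∀ᶠ y in 𝓝 x, ContMDiffAt (𝓡 d) ((𝓡 d).prod 𝓘(ℝ, EuclideanSpace ℝ (Fin d))) ∞
      (fun z => (⟨z, X i z⟩ : TangentBundle (𝓡 d) M)) y) →
    LinearIndependent ℝ (fun i => X i x) →
    (manifold K d M).SmoothAt (fun y => (ν y).1 fun i => X i y) x

/-! ## The tensor product with `S^⊠ W` -/

/-- `Φ : S^⊠ (S^⊗ V ⊗ W) ≅ S^⊠ S^⊗ V ⊗ S^⊠ W` is the canonical isomorphism, the product of
`S^⊠ (S^⊗ V ⊗ W)` is `⊡`, the product of the right-hand side is componentwise `⊡`, the bracket of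
the right-hand side is `{a ⊗ α, b ⊗ β} = B (a, b) ⊗ (α ⊡ β)`, and `Φ` is an isomorphism of Poisson
`⊠`-algebra bundles. -/
structure IsPoissonTensor (V : BundleData.{u, v} (manifold K d M))
    (W : BundleData.{u, w} (manifold K d M))
    (B : Hom (V.sym.cauchySym.cauchy V.sym.cauchySym) V.sym.cauchySym)
    (Φ : Iso (V.sym.hadamard W).cauchySym (V.sym.cauchySym.hadamard W.cauchySym))
    (P : PoissonCauchyAlgebra (V.sym.hadamard W).cauchySym)
    (Q : PoissonCauchyAlgebra (V.sym.cauchySym.hadamard W.cauchySym)) : Prop where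
  canonical : ∀ (x : Finset M) (a : ∀ p : M, SymmetricAlgebra K (V.fiber p))
    (α : ∀ p : M, W.fiber p),
    Φ.hom.app x (boxProd (V.sym.hadamard W) x fun p => a p ⊗ₜ[K] α p) =
      boxProd V.sym x a ⊗ₜ[K] boxProd W x α
  mul_left : ∀ {x y z : Finset M} (h : IsSplit x y z) (a : SFiber (V.sym.hadamard W) x)
    (b : SFiber (V.sym.hadamard W) y), P.mul.on h a b = boxdot (V.sym.hadamard W) h a b
  mul_right : ∀ {x y z : Finset M} (h : IsSplit x y z) (a : SFiber V.sym x) (b : SFiber V.sym y)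
    (α : SFiber W x) (β : SFiber W y),
    Q.mul.on h (a ⊗ₜ[K] α) (b ⊗ₜ[K] β) = boxdot V.sym h a b ⊗ₜ[K] boxdot W h α β
  bracket_right : ∀ {x y z : Finset M} (h : IsSplit x y z) (a : SFiber V.sym x)
    (b : SFiber V.sym y) (α : SFiber W x) (β : SFiber W y),
    Q.bracket.on h (a ⊗ₜ[K] α) (b ⊗ₜ[K] β) = B.on h a b ⊗ₜ[K] boxdot W h α β
  isPoissonIso : IsPoissonIso Φ P Q

end

end ConfBundle

/-! Forgetting the order of the factors identifies the fibre of `S^⊠ S^⊗ V` over a configuration `x`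
with the tensor product of the symmetric algebras `S(V_p)`, `p ∈ x`. This is again a symmetric
algebra, on the space `⨁ V_p` of all generators over `x` (`isSymmetricAlgebra_symGen`). The kernel
`k` defines a bilinear form on this space, with value zero on two vectors over the same point. A
bilinear form on generators extends to a biderivation of the symmetric algebra (`exists_poisson`),
which is a Poisson bracket when the form is antisymmetric (`symPoisson_jacobi`).

An inclusion `x ⊆ z` induces an algebra map between fibres that preserves these brackets
(`Kernel.incl_poisson`). If `z = x ⊔ y`, then `a ⊡ b` is the product of the images of `a` and `b` in
the algebra over `z` (`toAlg_boxdot`), and `{a, b}_k` is defined as the Poisson bracket of these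
images. Antisymmetry, the Jacobi identity and the Leibniz rules for `⊙` and `⊡` over disjoint
configurations thus become identities in one Poisson algebra, the fibre over the union. Conversely,
the Leibniz rules and the vanishing on units reduce any bracket to two generators over two points,
where `k` prescribes it (`IsKernelBracket.ext`).

The analytic content is smoothness. Near a configuration, `UConf(M)` looks like an open set of
tuples (`nhds_underlying`), and a section `s x_1 ⊡ ⋯ ⊡ s x_k` can be expanded multilinearly over
disjoint neighbourhoods of the points (`boxProd_expand`). This gives local frames
(`cauchySym_isVectorBundle`). For the bracket, every smooth section is locally a combination of
`⊙`-products of elementary sections, which have degree one near one point and are `1` near the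
others (`generated_by_elementary`). The bracket of two elementary sections is a value of `k` times
`1`, hence smooth because `k` is (`Kernel.smoothBracket_elementary`), and the Leibniz rule handles
products.

For the second part, the Hadamard product of a Poisson `⊠`-algebra bundle with a commutative one is
Poisson (`hadamardPoisson`): the factors from the commutative side agree in all terms of each
identity. The canonical isomorphism matches tensor bases (`zip_bijective`) and respects `⊡`, so the
bracket can be pulled back along it. For the third part, a local tangent frame yields a nowhere
vanishing density, which is a frame of the density bundle (`densities_isVectorBundle`). -/

namespace ConfBundle

noncomputable section

open Filter Function

/-! ## Reindexing of tuples -/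

section Tuples

variable {K : Type} [RCLike K] {d : ℕ} {M : Type u} [TopologicalSpace M]
  [ChartedSpace (EuclideanSpace ℝ (Fin d)) M]

/-- In product charts the map is the linear map `y ↦ y ∘ g`: a chart and its inverse cancel wherever
all coordinates lie in the targets of their charts. -/
theorem contMDiffAt_reindex {m k : ℕ} (g : Fin m → Fin k) (p : Fin k → M) :
    ContMDiffAt (ModelWithCorners.pi fun _ : Fin k => 𝓡 d)
      (ModelWithCorners.pi fun _ : Fin m => 𝓡 d) ∞ (fun q : Fin k → M => q ∘ g) p := by
  refine contMDiffAt_iff.2 ⟨(continuous_pi fun i => continuous_apply (g i)).continuousAt, ?_⟩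
  have h : ContDiff ℝ ∞ (fun y : Fin k → EuclideanSpace ℝ (Fin d) => fun i => y (g i)) := by
    fun_prop
  refine h.contDiffWithinAt.congr_of_eventuallyEq ?_ ?_
  · have hev : ∀ᶠ y in 𝓝 (fun i => extChartAt (𝓡 d) (p i) (p i)),
        ∀ i, y i ∈ (extChartAt (𝓡 d) (p i)).target := by
      refine eventually_all.2 fun i => ?_
      exact (continuous_apply i).continuousAt (extChartAt_target_mem_nhds (I := 𝓡 d) (p i))
    refine Filter.Eventually.filter_mono nhdsWithin_le_nhds (hev.mono fun y hy => ?_)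
    funext i
    exact (extChartAt (𝓡 d) (p (g i))).right_inv (hy (g i))
  · funext i
    exact (extChartAt (𝓡 d) (p (g i))).right_inv
      ((extChartAt (𝓡 d) (p (g i))).map_source (mem_extChartAt_source _))

theorem contMDiffAt_eval {k : ℕ} (i : Fin k) (p : Fin k → M) :
    ContMDiffAt (ModelWithCorners.pi fun _ : Fin k => 𝓡 d) (𝓡 d) ∞
      (fun q : Fin k → M => q i) p := by
  refine contMDiffAt_iff.2 ⟨(continuous_apply i).continuousAt, ?_⟩
  have h : ContDiff ℝ ∞ (fun y : Fin k → EuclideanSpace ℝ (Fin d) => y i) := by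
    fun_prop
  refine h.contDiffWithinAt.congr_of_eventuallyEq ?_ ?_
  · have hev : ∀ᶠ y in 𝓝 (fun i => extChartAt (𝓡 d) (p i) (p i)),
        ∀ i, y i ∈ (extChartAt (𝓡 d) (p i)).target := by
      refine eventually_all.2 fun i => ?_
      exact (continuous_apply i).continuousAt (extChartAt_target_mem_nhds (I := 𝓡 d) (p i))
    refine Filter.Eventually.filter_mono nhdsWithin_le_nhds (hev.mono fun y hy => ?_)
    exact (extChartAt (𝓡 d) (p i)).right_inv (hy i)
  · exact (extChartAt (𝓡 d) (p i)).right_inv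
      ((extChartAt (𝓡 d) (p i)).map_source (mem_extChartAt_source _))

end Tuples

/-! ## The topology of the configuration space -/

section Topology

variable {M : Type u}

theorem mem_underlying {k : ℕ} {p : Fin k → M} {q : M} : q ∈ underlying p ↔ ∃ i, p i = q := by
  classical
  simp [underlying]

theorem card_underlying {k : ℕ} {p : Fin k → M} (hp : Injective p) : (underlying p).card = k := by
  classical
  unfold underlying
  rw [Finset.card_image_of_injective _ hp, Finset.card_univ, Fintype.card_fin]

/-- A tuple listing the points of a configuration. -/
def listing (x : Finset M) : Fin x.card → M := fun i => (x.equivFin.symm i).1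

theorem listing_injective (x : Finset M) : Injective (listing x) :=
  Subtype.val_injective.comp x.equivFin.symm.injective

theorem listing_mem (x : Finset M) (i : Fin x.card) : listing x i ∈ x := (x.equivFin.symm i).2

theorem underlying_listing (x : Finset M) : underlying (listing x) = x := by
  ext q
  rw [mem_underlying]
  constructor
  · rintro ⟨i, rfl⟩
    exact (x.equivFin.symm i).2
  · intro hq
    exact ⟨x.equivFin ⟨q, hq⟩, by simp [listing]⟩

theorem underlying_comp_equiv {k : ℕ} (p : Fin k → M) (σ : Equiv.Perm (Fin k)) :
    underlying (p ∘ σ) = underlying p := by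
  ext q
  simp only [mem_underlying, comp_apply]
  exact σ.exists_congr_left.trans (by simp)

theorem exists_perm_of_underlying_eq {k : ℕ} {p q : Fin k → M} (hp : Injective p)
    (h : underlying p = underlying q) : ∃ σ : Equiv.Perm (Fin k), p = q ∘ σ := by
  have hmem : ∀ i, ∃ j, q j = p i := fun i =>
    mem_underlying.1 (h ▸ mem_underlying.2 ⟨i, rfl⟩)
  choose f hf using hmem
  have hinj : Injective f := fun i j hij => hp (by rw [← hf i, ← hf j, hij])
  exact ⟨Equiv.ofBijective f (Finite.injective_iff_bijective.1 hinj), funext fun i => (hf i).symm⟩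

variable [TopologicalSpace M]

/-- The topology of the configuration space. -/
instance confTopology : TopologicalSpace (Finset M) :=
  ⨆ k : ℕ, TopologicalSpace.coinduced
    (fun p : {p : Fin k → M // Injective p} => underlying p.1) inferInstance

theorem continuous_underlying (k : ℕ) :
    Continuous (fun p : {p : Fin k → M // Injective p} => underlying p.1) :=
  continuous_iSup_rng (i := k) continuous_coinduced_rng

/-- The saturation of an open set of `k`-tuples is the union of its images under permutations. For
tuples of another length the preimage is empty, by cardinality. -/
theorem isOpenMap_underlying (k : ℕ) :
    IsOpenMap (fun p : {p : Fin k → M // Injective p} => underlying p.1) := by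
  intro O hO
  refine isOpen_iSup_iff.2 fun j => isOpen_coinduced.2 ?_
  by_cases hjk : j = k
  · subst hjk
    have : (fun p : {p : Fin j → M // Injective p} => underlying p.1) ⁻¹'
        ((fun p : {p : Fin j → M // Injective p} => underlying p.1) '' O) =
        ⋃ σ : Equiv.Perm (Fin j),
          (fun p : {p : Fin j → M // Injective p} =>
            (⟨p.1 ∘ σ, p.2.comp σ.injective⟩ : {p : Fin j → M // Injective p})) ⁻¹' O := by
      ext p
      simp only [Set.mem_preimage, Set.mem_image, Set.mem_iUnion]
      constructor
      · rintro ⟨q, hq, hqp⟩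
        obtain ⟨σ, hσ⟩ := exists_perm_of_underlying_eq q.2 hqp
        refine ⟨σ, ?_⟩
        convert hq
        exact hσ.symm
      · rintro ⟨σ, hσ⟩
        exact ⟨_, hσ, underlying_comp_equiv p.1 σ⟩
    rw [this]
    refine isOpen_iUnion fun σ => ?_
    have hc : Continuous fun p : {p : Fin j → M // Injective p} =>
        (⟨p.1 ∘ σ, p.2.comp σ.injective⟩ : {p : Fin j → M // Injective p}) :=
      ((Pi.continuous_precomp σ).comp continuous_subtype_val).subtype_mk _
    exact hO.preimage hc
  · convert isOpen_empty
    refine Set.eq_empty_of_forall_notMem ?_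
    rintro p ⟨q, -, hq⟩
    have h1 := card_underlying q.2
    have h2 := card_underlying p.2
    exact hjk (by rw [← h2, ← h1]; exact congrArg Finset.card hq.symm)

theorem isOpen_injective [T2Space M] (k : ℕ) : IsOpen {p : Fin k → M | Injective p} := by
  have : {p : Fin k → M | Injective p} = ⋂ (i) (j) (_ : i ≠ j), {p | p i ≠ p j} := by
    ext p
    simp only [Set.mem_ofPred_eq, Set.mem_iInter]
    exact ⟨fun h i j hij e => hij (h e), fun h i j e => by_contra fun hij => h i j hij e⟩
  rw [this]
  refine isOpen_iInter_of_finite fun i => isOpen_iInter_of_finite fun j =>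
    isOpen_iInter_of_finite fun _ => ?_
  exact isOpen_ne_fun (continuous_apply i) (continuous_apply j)

/-- In a Hausdorff space injective tuples form an open subset of `M ^ k`, and the quotient map is
continuous and open. Local statements about configurations thereby become local statements about
tuples in `M ^ k`. -/
theorem nhds_underlying [T2Space M] {k : ℕ} {p : Fin k → M} (hp : Injective p) :
    𝓝 (underlying p) = map underlying (𝓝 p) := by
  have h1 : 𝓝 p = map Subtype.val (𝓝 (⟨p, hp⟩ : {p : Fin k → M // Injective p})) :=
    ((isOpen_injective k).isOpenEmbedding_subtypeVal.map_nhds_eq ⟨p, hp⟩).symm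
  rw [h1, map_map]
  exact le_antisymm ((isOpenMap_underlying k).nhds_le ⟨p, hp⟩)
    (continuous_underlying k).continuousAt

theorem eventually_nhds_iff [T2Space M] {x : Finset M} {P : Finset M → Prop} :
    (∀ᶠ y in 𝓝 x, P y) ↔ ∀ᶠ p in 𝓝 (listing x), P (underlying p) := by
  conv_lhs => rw [← underlying_listing x, nhds_underlying (listing_injective x)]
  rfl

/-- Configurations near `x` consist of one point near each point of `x`. -/
theorem eventually_exists_equiv [T2Space M] (x : Finset M) (A : M → Set M)
    (hA : ∀ p ∈ x, A p ∈ 𝓝 p) :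
    ∀ᶠ y : Finset M in 𝓝 x, ∃ τ : x ≃ y, ∀ p, (τ p).1 ∈ A p.1 := by
  rw [eventually_nhds_iff]
  have h1 : ∀ᶠ p in 𝓝 (listing x), ∀ i, p i ∈ A (listing x i) := by
    refine eventually_all.2 fun i => ?_
    exact (continuous_apply i).continuousAt (hA _ (x.equivFin.symm i).2)
  filter_upwards [h1, (isOpen_injective x.card).mem_nhds (listing_injective x)] with p hp hinj
  refine ⟨x.equivFin.trans (Equiv.ofBijective
    (fun i => (⟨p i, mem_underlying.2 ⟨i, rfl⟩⟩ : underlying p)) ⟨?_, ?_⟩), ?_⟩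
  · intro i j hij
    exact hinj (congrArg Subtype.val hij)
  · rintro ⟨q, hq⟩
    obtain ⟨i, rfl⟩ := mem_underlying.1 hq
    exact ⟨i, rfl⟩
  · intro q
    have h := hp (x.equivFin q)
    simp only [listing, Equiv.symm_apply_apply] at h
    exact h

theorem eventually_forall_mem [T2Space M] (x : Finset M) (P : M → Prop)
    (hP : ∀ p ∈ x, ∀ᶠ q in 𝓝 p, P q) : ∀ᶠ y in 𝓝 x, ∀ q ∈ y, P q := by
  filter_upwards [eventually_exists_equiv x (fun _ => {q | P q}) hP] with y ⟨τ, hτ⟩ q hq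
  simpa using hτ (τ.symm ⟨q, hq⟩)

theorem eventually_card_eq [T2Space M] (x : Finset M) : ∀ᶠ y in 𝓝 x, y.card = x.card := by
  filter_upwards [eventually_exists_equiv x (fun _ => Set.univ) fun _ _ => univ_mem] with y ⟨τ, _⟩
  simpa using (Fintype.card_congr τ).symm

omit [TopologicalSpace M] in
theorem mem_restrict {x : Finset M} {U : Set M} {p : M} : p ∈ restrict x U ↔ p ∈ x ∧ p ∈ U := by
  classical
  simp [restrict]

omit [TopologicalSpace M] in
theorem isSplit_restrict {x : Finset M} {U U' : Set M} (h : Disjoint U U')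
    (hx : ∀ p ∈ x, p ∈ U ∪ U') : IsSplit (restrict x U) (restrict x U') x := by
  refine ⟨Finset.disjoint_left.2 fun p hp hp' => ?_, fun p => ?_⟩
  · exact Set.disjoint_left.1 h (mem_restrict.1 hp).2 (mem_restrict.1 hp').2
  · rw [mem_restrict, mem_restrict]
    exact ⟨fun hp => (hx p hp).imp (⟨hp, ·⟩) (⟨hp, ·⟩), fun hp => hp.elim And.left And.left⟩

theorem eventually_subset_union [T2Space M] {x : Finset M} {U : Set M} (hU : IsOpen U)
    (hx : ∀ p ∈ x, p ∈ U) : ∀ᶠ y in 𝓝 x, ∀ p ∈ y, p ∈ U :=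
  eventually_forall_mem x _ fun p hp => hU.mem_nhds (hx p hp)

theorem eventually_isSplit_restrict [T2Space M] {x : Finset M} {U U' : Set M} (hU : IsOpen U)
    (hU' : IsOpen U') (h : Disjoint U U') (hx : ∀ p ∈ x, p ∈ U ∪ U') :
    ∀ᶠ y in 𝓝 x, IsSplit (restrict y U) (restrict y U') y :=
  (eventually_subset_union (hU.union hU') hx).mono fun _ hy => isSplit_restrict h hy

/-- The set of indices `i` with `q i ∈ U` is locally constant: `U` is open, and the remaining points
are kept out of `U` by the open set `U'`. So `y ↦ y ∩ U` is locally a selection of coordinates. -/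
theorem exists_restrict_reindex {U U' : Set M} (hU : IsOpen U) (hU' : IsOpen U')
    (hd : Disjoint U U') {k : ℕ} {p : Fin k → M} (hp : Injective p)
    (hpU : ∀ i, p i ∈ U ∪ U') :
    ∃ (m : ℕ) (g : Fin m → Fin k), Injective (p ∘ g) ∧
      ∀ᶠ q in 𝓝 p, restrict (underlying q) U = underlying (q ∘ g) := by
  classical
  let I : Finset (Fin k) := Finset.univ.filter fun i => p i ∈ U
  have hI : ∀ i, i ∈ I ↔ p i ∈ U := by simp [I]
  refine ⟨I.card, listing I, hp.comp (listing_injective I), ?_⟩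
  have h1 : ∀ᶠ q in 𝓝 p, ∀ i, (p i ∈ U → q i ∈ U) ∧ (p i ∉ U → q i ∉ U) := by
    refine eventually_all.2 fun i => ?_
    rcases hpU i with h | h
    · filter_upwards [(continuous_apply i).continuousAt (hU.mem_nhds h)] with q hq
      exact ⟨fun _ => hq, fun h' => absurd h h'⟩
    · filter_upwards [(continuous_apply i).continuousAt (hU'.mem_nhds h)] with q hq
      have hq' : q i ∉ U := fun h' => Set.disjoint_left.1 hd h' hq
      exact ⟨fun h' => absurd h (Set.disjoint_left.1 hd h'), fun _ => hq'⟩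
  filter_upwards [h1] with q hq
  ext r
  rw [mem_restrict, mem_underlying, mem_underlying]
  constructor
  · rintro ⟨⟨i, rfl⟩, hi⟩
    have hiI : i ∈ underlying (listing I) := by
      rw [underlying_listing, hI]
      exact by_contra fun h => (hq i).2 h hi
    obtain ⟨j, hj⟩ := mem_underlying.1 hiI
    exact ⟨j, by simp [hj]⟩
  · rintro ⟨j, rfl⟩
    refine ⟨⟨_, rfl⟩, (hq _).1 ((hI _).1 ?_)⟩
    exact listing_mem I j

theorem tendsto_restrict [T2Space M] {x : Finset M} {U U' : Set M} (hU : IsOpen U)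
    (hU' : IsOpen U') (hd : Disjoint U U') (hx : ∀ p ∈ x, p ∈ U ∪ U') :
    Tendsto (fun y => restrict y U) (𝓝 x) (𝓝 (restrict x U)) := by
  obtain ⟨m, g, hg, hev⟩ := exists_restrict_reindex hU hU' hd (listing_injective x)
    fun i => hx _ (x.equivFin.symm i).2
  have h0 : restrict x U = underlying (listing x ∘ g) := by
    simpa [underlying_listing] using hev.self_of_nhds
  have h1 : Tendsto (fun q : Fin x.card → M => underlying (q ∘ g)) (𝓝 (listing x))
      (𝓝 (restrict x U)) := by
    rw [h0, nhds_underlying hg]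
    have : Continuous fun q : Fin x.card → M => q ∘ g := by fun_prop
    exact tendsto_map.comp this.continuousAt
  rw [← underlying_listing x, nhds_underlying (listing_injective x), underlying_listing,
    tendsto_map'_iff]
  exact h1.congr' (hev.mono fun q hq => hq.symm)

end Topology

/-! ## Smooth functions -/

/-- Smooth functions form a sheaf of algebras. -/
structure SmoothSpace.Regular {K : Type} [RCLike K] (X : SmoothSpace.{u} K) : Prop where
  const : ∀ (a : K) (x : X.carrier), X.SmoothAt (fun _ => a) x
  add : ∀ {f g : X.carrier → K} {x : X.carrier}, X.SmoothAt f x → X.SmoothAt g x →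
    X.SmoothAt (fun y => f y + g y) x
  mul : ∀ {f g : X.carrier → K} {x : X.carrier}, X.SmoothAt f x → X.SmoothAt g x →
    X.SmoothAt (fun y => f y * g y) x
  congr : ∀ {f g : X.carrier → K} {x : X.carrier}, X.SmoothAt f x → (∀ᶠ y in 𝓝 x, g y = f y) →
    X.SmoothAt g x

namespace SmoothSpace.Regular

variable {K : Type} [RCLike K] {X : SmoothSpace.{u} K}

theorem sum (hX : X.Regular) {ι : Type*} (J : Finset ι) {f : ι → X.carrier → K} {x : X.carrier}
    (h : ∀ i ∈ J, X.SmoothAt (f i) x) : X.SmoothAt (fun y => ∑ i ∈ J, f i y) x := by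
  classical
  induction J using Finset.induction_on with
  | empty => simpa using hX.const 0 x
  | insert i J hi ih =>
    simp only [Finset.sum_insert hi]
    exact hX.add (h i (Finset.mem_insert_self i J))
      (ih fun j hj => h j (Finset.mem_insert_of_mem hj))

end SmoothSpace.Regular

section Smooth

variable {K : Type} [RCLike K] {d : ℕ} {M : Type u} [TopologicalSpace M]
  [ChartedSpace (EuclideanSpace ℝ (Fin d)) M]

theorem contMDiffAt_mul {E H N : Type*} [NormedAddCommGroup E] [NormedSpace ℝ E]
    [TopologicalSpace H] {I : ModelWithCorners ℝ E H} [TopologicalSpace N] [ChartedSpace H N]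
    {f g : N → K} {x : N} (hf : ContMDiffAt I 𝓘(ℝ, K) ∞ f x) (hg : ContMDiffAt I 𝓘(ℝ, K) ∞ g x) :
    ContMDiffAt I 𝓘(ℝ, K) ∞ (fun y => f y * g y) x := by
  have h : ContDiff ℝ ∞ fun a : K × K => a.1 * a.2 := contDiff_mul
  exact (h.contMDiff.contMDiffAt (x := (f x, g x))).comp x (hf.prodMk_space hg)

variable (K d M) in
theorem manifold_regular : (manifold K d M).Regular := by
  refine ⟨fun a x => ?_, fun {f g x} hf hg => ?_, fun {f g x} hf hg => ?_, fun {f g x} hf h => ?_⟩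
  · exact Eventually.of_forall fun _ => contMDiffAt_const
  · exact (Filter.Eventually.and hf hg).mono fun y h => h.1.add h.2
  · exact (Filter.Eventually.and hf hg).mono fun y h => contMDiffAt_mul h.1 h.2
  · exact (Filter.Eventually.and hf (eventually_eventually_nhds.2 h)).mono fun y h =>
      h.1.congr_of_eventuallyEq h.2

theorem eventually_tuple [T2Space M] {y : Finset M} {P : Finset M → Prop}
    (h : ∀ᶠ z in 𝓝 y, P z) {k : ℕ} {p : Fin k → M} (hp : Injective p) (hpy : underlying p = y) :
    ∀ᶠ q in 𝓝 p, P (underlying q) := by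
  subst hpy
  rw [nhds_underlying hp] at h
  exact h

variable (K d M) in
theorem uConf_regular [T2Space M] : (UConf K d M).Regular := by
  refine ⟨fun a x => ?_, fun {f g x} hf hg => ?_, fun {f g x} hf hg => ?_, fun {f g x} hf h => ?_⟩
  · exact Eventually.of_forall fun _ _ _ _ _ => contMDiffAt_const
  · exact (Filter.Eventually.and hf hg).mono fun y h k p hp hpy =>
      (h.1 k p hp hpy).add (h.2 k p hp hpy)
  · exact (Filter.Eventually.and hf hg).mono fun y h k p hp hpy =>
      contMDiffAt_mul (h.1 k p hp hpy) (h.2 k p hp hpy)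
  · exact (Filter.Eventually.and hf (eventually_eventually_nhds.2 h)).mono fun y h k p hp hpy =>
      (h.1 k p hp hpy).congr_of_eventuallyEq (eventually_tuple h.2 hp hpy)

theorem smoothAt_restrict [T2Space M] {x : Finset M} {U U' : Set M} (hU : IsOpen U)
    (hU' : IsOpen U') (hd : Disjoint U U') (hx : ∀ p ∈ x, p ∈ U ∪ U') {f : Finset M → K}
    (hf : (UConf K d M).SmoothAt f (restrict x U)) :
    (UConf K d M).SmoothAt (fun y => f (restrict y U)) x := by
  have h1 := (tendsto_restrict hU hU' hd hx).eventually hf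
  refine (Filter.Eventually.and h1 (eventually_subset_union (hU.union hU') hx)).mono ?_
  rintro y ⟨h2, h3⟩ k p hp rfl
  obtain ⟨m, g, hg, hev⟩ := exists_restrict_reindex hU hU' hd hp
    fun i => h3 _ (mem_underlying.2 ⟨i, rfl⟩)
  have h4 := h2 m (p ∘ g) hg hev.self_of_nhds.symm
  have h5 := h4.comp p (contMDiffAt_reindex (d := d) g p)
  exact h5.congr_of_eventuallyEq (hev.mono fun q hq => by simp only [comp_apply, hq])

/-- On injective tuples this is `∏ i, F (q i)`. Such functions are the coefficients that appear when
a `⊡`-product of sums is expanded. -/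
theorem smoothAt_prod_mem [T2Space M] {x : Finset M} {F : M → K}
    (hF : ∀ p ∈ x, (manifold K d M).SmoothAt F p) :
    (UConf K d M).SmoothAt (fun y => ∏ q ∈ y, F q) x := by
  have h1 := eventually_forall_mem x _ hF
  refine h1.mono ?_
  rintro y h2 k p hp rfl
  have h3 : ContMDiffAt (ModelWithCorners.pi fun _ : Fin k => 𝓡 d) 𝓘(ℝ, K) ∞
      (fun q : Fin k → M => ∏ i, F (q i)) p := by
    have h4 : ∀ J : Finset (Fin k), ContMDiffAt (ModelWithCorners.pi fun _ : Fin k => 𝓡 d)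
        𝓘(ℝ, K) ∞ (fun q : Fin k → M => ∏ i ∈ J, F (q i)) p := by
      intro J
      classical
      induction J using Finset.induction_on with
      | empty => simpa using contMDiffAt_const
      | insert i J hi ih =>
        simp only [Finset.prod_insert hi]
        exact contMDiffAt_mul ((h2 (p i) (mem_underlying.2 ⟨i, rfl⟩)).comp p
          (contMDiffAt_eval (d := d) i p)) ih
    exact h4 Finset.univ
  refine h3.congr_of_eventuallyEq ?_
  filter_upwards [(isOpen_injective k).mem_nhds hp] with q hq
  classical
  unfold underlying
  rw [Finset.prod_image fun i _ j _ h => hq h]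

end Smooth

/-! ## Poisson brackets on symmetric algebras -/

section Poisson

variable {K : Type*} [Field K] {E : Type*} [AddCommGroup E] [Module K E]
  {A : Type*} [CommRing A] [Algebra K A] {f : E →ₗ[K] A}

theorem symAlg_induction (hf : IsSymmetricAlgebra f) {P : A → Prop}
    (algebraMap : ∀ c : K, P (algebraMap K A c)) (add : ∀ a b, P a → P b → P (a + b))
    (mul : ∀ a b, P a → P b → P (a * b)) (gen : ∀ u, P (f u)) (a : A) : P a :=
  hf.induction (motive := P) algebraMap gen mul add a

/-- A derivation into `N` is the same as an algebra map into the square-zero extension `A ⊕ N` whose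
first component is the identity. The universal property provides such a map from `u ↦ (f u, g u)`.
-/
theorem exists_derivation (hf : IsSymmetricAlgebra f) {N : Type*} [AddCommGroup N] [Module A N]
    [Module Aᵐᵒᵖ N] [IsCentralScalar A N] [Module K N] [IsScalarTower K A N] (g : E →ₗ[K] N) :
    ∃ D : Derivation K A N, ∀ u, D (f u) = g u := by
  let h : E →ₗ[K] TrivSqZeroExt A N :=
    { toFun := fun u => TrivSqZeroExt.inl (f u) + TrivSqZeroExt.inr (g u)
      map_add' := fun u v => by
        apply TrivSqZeroExt.ext <;> simp
      map_smul' := fun c u => by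
        apply TrivSqZeroExt.ext <;> simp }
  let F : A →ₐ[K] TrivSqZeroExt A N := hf.lift h
  have hF : ∀ u, F (f u) = TrivSqZeroExt.inl (f u) + TrivSqZeroExt.inr (g u) :=
    fun u => hf.lift_eq h u
  have hfst : ∀ a, (F a).fst = a := by
    intro a
    induction a using symAlg_induction hf with
    | algebraMap c => rw [AlgHom.commutes]; rfl
    | add a b ha hb => rw [map_add, TrivSqZeroExt.fst_add, ha, hb]
    | mul a b ha hb => rw [map_mul, TrivSqZeroExt.fst_mul, ha, hb]
    | gen u => rw [hF]; simp
  refine ⟨Derivation.mk'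
    { toFun := fun a => (F a).snd
      map_add' := fun a b => by simp
      map_smul' := fun c a => by simp } ?_, ?_⟩
  · intro a b
    have : (F (a * b)).snd = a • (F b).snd + b • (F a).snd := by
      rw [map_mul, TrivSqZeroExt.snd_mul, hfst, hfst, op_smul_eq_smul]
    exact this
  · intro u
    have : (F (f u)).snd = g u := by rw [hF]; simp
    exact this

/-- Two applications of `exists_derivation`: the linear form `κ u` extends to a derivation `X u` of
`A`, and `u ↦ X u` extends to a derivation with values in the `A`-module of derivations. Both
Leibniz rules are thus built in. -/
theorem exists_poisson (hf : IsSymmetricAlgebra f) (κ : E →ₗ[K] E →ₗ[K] K) :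
    ∃ D : Derivation K A (Derivation K A A),
      ∀ u v, D (f u) (f v) = algebraMap K _ (κ u v) := by
  have h : ∀ u : E, ∃ D : Derivation K A A, ∀ v, D (f v) = algebraMap K _ (κ u v) := fun u =>
    exists_derivation hf ((Algebra.linearMap K A) ∘ₗ κ u)
  choose X hX using h
  -- Derivations are determined by their values on generators; this makes `X` linear in `u`.
  have hext : ∀ D D' : Derivation K A A, (∀ v, D (f v) = D' (f v)) → D = D' := by
    intro D D' hD
    ext a
    induction a using symAlg_induction hf with
    | algebraMap c => simp
    | add a b ha hb => rw [map_add, map_add, ha, hb]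
    | mul a b ha hb => rw [Derivation.leibniz, Derivation.leibniz, ha, hb]
    | gen u => exact hD u
  obtain ⟨D, hD⟩ := exists_derivation hf (N := Derivation K A A)
      { toFun := X
        map_add' := fun u u' => hext _ _ fun v => by simp [hX]
        map_smul' := fun c u => hext _ _ fun v => by simp [hX, Algebra.smul_def] }
  exact ⟨D, fun u v => by rw [hD]; exact hX u v⟩

/-- The Poisson bracket on a symmetric algebra defined by the bilinear form `κ`. -/
def symPoisson (hf : IsSymmetricAlgebra f) (κ : E →ₗ[K] E →ₗ[K] K) : A →ₗ[K] A →ₗ[K] A :=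
  LinearMap.mk₂ K (fun a b => (exists_poisson hf κ).choose a b)
    (fun a a' b => by rw [map_add, Derivation.add_apply])
    (fun c a b => by rw [Derivation.map_smul, Derivation.smul_apply])
    (fun a b b' => by rw [map_add])
    (fun c a b => by rw [Derivation.map_smul])

variable (hf : IsSymmetricAlgebra f) (κ : E →ₗ[K] E →ₗ[K] K)

theorem symPoisson_gen (u v : E) : symPoisson hf κ (f u) (f v) = algebraMap K _ (κ u v) :=
  (exists_poisson hf κ).choose_spec u v

theorem symPoisson_mul_left (a b c : A) :
    symPoisson hf κ (a * b) c = symPoisson hf κ a c * b + a * symPoisson hf κ b c := by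
  change (exists_poisson hf κ).choose (a * b) c = (exists_poisson hf κ).choose a c * b +
    a * (exists_poisson hf κ).choose b c
  rw [Derivation.leibniz]
  simp [mul_comm, add_comm]

theorem symPoisson_mul_right (a b c : A) :
    symPoisson hf κ a (b * c) = symPoisson hf κ a b * c + b * symPoisson hf κ a c := by
  change (exists_poisson hf κ).choose a (b * c) = (exists_poisson hf κ).choose a b * c +
    b * (exists_poisson hf κ).choose a c
  rw [Derivation.leibniz]
  simp [mul_comm, add_comm]

theorem symPoisson_one_left (a : A) : symPoisson hf κ 1 a = 0 := by
  change (exists_poisson hf κ).choose 1 a = 0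
  rw [Derivation.map_one_eq_zero]; rfl

theorem symPoisson_one_right (a : A) : symPoisson hf κ a 1 = 0 :=
  ((exists_poisson hf κ).choose a).map_one_eq_zero

theorem symPoisson_algebraMap_left (c : K) (a : A) :
    symPoisson hf κ (algebraMap K _ c) a = 0 := by
  rw [Algebra.algebraMap_eq_smul_one, map_smul, LinearMap.smul_apply, symPoisson_one_left, smul_zero]

theorem symPoisson_algebraMap_right (c : K) (a : A) :
    symPoisson hf κ a (algebraMap K _ c) = 0 := by
  rw [Algebra.algebraMap_eq_smul_one, map_smul, symPoisson_one_right, smul_zero]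

variable {κ}

/-- Algebra maps induced by maps of generators that preserve the bilinear form are Poisson. -/
theorem symPoisson_map {E' : Type*} [AddCommGroup E'] [Module K E'] {A' : Type*} [CommRing A']
    [Algebra K A'] {f' : E' →ₗ[K] A'} (hf' : IsSymmetricAlgebra f') {κ' : E' →ₗ[K] E' →ₗ[K] K}
    {φ : A →ₐ[K] A'} {ψ : E → E'} (hφ : ∀ u, φ (f u) = f' (ψ u))
    (hκ : ∀ u v, κ' (ψ u) (ψ v) = κ u v) (a b : A) :
    φ (symPoisson hf κ a b) = symPoisson hf' κ' (φ a) (φ b) := by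
  induction a using symAlg_induction hf with
  | algebraMap c => simp [symPoisson_algebraMap_left]
  | add a a' ha ha' => simp [ha, ha']
  | mul a a' ha ha' => simp only [map_mul, symPoisson_mul_left, map_add, ha, ha']
  | gen u =>
    induction b using symAlg_induction hf with
    | algebraMap c => simp [symPoisson_algebraMap_right]
    | add a a' ha ha' => simp [ha, ha']
    | mul a a' ha ha' => simp only [map_mul, symPoisson_mul_right, map_add, ha, ha']
    | gen v => rw [symPoisson_gen, hφ, hφ, symPoisson_gen, hκ]; simp

theorem symPoisson_antisymm (hκ : ∀ u v, κ u v = -κ v u) (a b : A) :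
    symPoisson hf κ a b = -symPoisson hf κ b a := by
  induction a using symAlg_induction hf with
  | algebraMap c => simp [symPoisson_algebraMap_left, symPoisson_algebraMap_right]
  | add a a' ha ha' => simp [ha, ha', add_comm]
  | mul a a' ha ha' =>
    rw [symPoisson_mul_left, symPoisson_mul_right, ha, ha']; ring
  | gen u =>
    induction b using symAlg_induction hf with
    | algebraMap c => simp [symPoisson_algebraMap_left, symPoisson_algebraMap_right]
    | add a a' ha ha' => simp [ha, ha', add_comm]
    | mul a a' ha ha' =>
      rw [symPoisson_mul_left, symPoisson_mul_right, ha, ha']; ring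
    | gen v => rw [symPoisson_gen, symPoisson_gen, hκ]; simp

/-- The Jacobi identity in derivation form, by comparing derivations in `c`. -/
theorem symPoisson_jacobi (hκ : ∀ u v, κ u v = -κ v u) (a b c : A) :
    symPoisson hf κ (symPoisson hf κ a b) c + symPoisson hf κ (symPoisson hf κ b c) a +
      symPoisson hf κ (symPoisson hf κ c a) b = 0 := by
  have anti := symPoisson_antisymm hf hκ
  -- For fixed `a` and `b` the cyclic sum is a derivation in `c`, so its vanishing can be tested on
  -- generators.
  have step : ∀ a b, (∀ u, symPoisson hf κ (symPoisson hf κ a b) (f u) +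
      symPoisson hf κ (symPoisson hf κ b (f u)) a +
      symPoisson hf κ (symPoisson hf κ (f u) a) b = 0) → ∀ c,
      symPoisson hf κ (symPoisson hf κ a b) c + symPoisson hf κ (symPoisson hf κ b c) a +
      symPoisson hf κ (symPoisson hf κ c a) b = 0 := by
    intro a b h c
    induction c using symAlg_induction hf with
    | algebraMap c => simp [symPoisson_algebraMap_left, symPoisson_algebraMap_right]
    | add c c' hc hc' =>
      simp only [map_add, LinearMap.add_apply]
      linear_combination hc + hc'
    | mul c c' hc hc' =>
      simp only [symPoisson_mul_left, symPoisson_mul_right, map_add, LinearMap.add_apply]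
      -- Antisymmetry brings the mixed products of single brackets into a form in which they cancel.
      rw [anti c b, anti c' b, anti c a, anti c' a] at *
      simp only [map_neg, LinearMap.neg_apply] at *
      linear_combination c' * hc + c * hc'
    | gen u => exact h u
  refine step a b (fun u => ?_) c
  -- The sum is invariant under cyclic permutations, so `step` applies to each variable in turn. For
  -- three generators the inner brackets are scalars, and every term vanishes.
  have h1 := step (f u) a (fun v => ?_) b
  · linear_combination h1
  have h2 := step (f v) (f u) (fun w => ?_) a
  · linear_combination h2
  simp [symPoisson_gen, symPoisson_algebraMap_left]

end Poisson

/-! ## Tensor products of symmetric algebras -/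

section SymTensor

variable {K : Type*} [Field K] {ι : Type*} {E : ι → Type*}
  [∀ i, AddCommGroup (E i)] [∀ i, Module K (E i)]

variable (K E) in
/-- The tensor product of the symmetric algebras of a finite family of vector spaces. -/
def SymTensor : Type _ := ⨂[K] i, SymmetricAlgebra K (E i)

instance : CommRing (SymTensor K E) :=
  inferInstanceAs (CommRing (⨂[K] i, SymmetricAlgebra K (E i)))

instance : Algebra K (SymTensor K E) :=
  inferInstanceAs (Algebra K (⨂[K] i, SymmetricAlgebra K (E i)))

variable (K E) in
/-- `SymTensor` is by definition a tensor product. -/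
def symTensorEquiv : (⨂[K] i, SymmetricAlgebra K (E i)) ≃ₗ[K] SymTensor K E where
  toFun a := a
  invFun a := a
  map_add' _ _ := rfl
  map_smul' _ _ := rfl
  left_inv _ := rfl
  right_inv _ := rfl

variable (K) in
/-- Decomposable tensors. -/
def symTprod (s : ∀ i, SymmetricAlgebra K (E i)) : SymTensor K E :=
  symTensorEquiv K E (PiTensorProduct.tprod K s)

theorem symTprod_mul (s t : ∀ i, SymmetricAlgebra K (E i)) :
    symTprod K s * symTprod K t = symTprod K (s * t) :=
  PiTensorProduct.tprod_mul_tprod (R := K) s t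

theorem symTprod_one : symTprod K (1 : ∀ i, SymmetricAlgebra K (E i)) = 1 := rfl

theorem symTprod_prod {κ : Type*} (J : Finset κ) (s : κ → ∀ i, SymmetricAlgebra K (E i)) :
    symTprod K (∏ j ∈ J, s j) = ∏ j ∈ J, symTprod K (s j) := by
  classical
  induction J using Finset.induction_on with
  | empty => simp only [Finset.prod_empty]; exact symTprod_one
  | insert j J hj ih => rw [Finset.prod_insert hj, Finset.prod_insert hj, ← symTprod_mul, ih]

theorem symTensor_linear_induction {P : SymTensor K E → Prop}
    (smul : ∀ (c : K) s, P (c • symTprod K s)) (add : ∀ a b, P a → P b → P (a + b))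
    (a : SymTensor K E) : P a :=
  PiTensorProduct.induction_on (motive := P) a smul add

/-- Linear maps out of `⨂ S(E i)`. -/
def symLiftLinear {B : Type*} [AddCommGroup B] [Module K B]
    (f : MultilinearMap K (fun i => SymmetricAlgebra K (E i)) B) : SymTensor K E →ₗ[K] B :=
  PiTensorProduct.lift f ∘ₗ (symTensorEquiv K E).symm.toLinearMap

theorem symLiftLinear_tprod {B : Type*} [AddCommGroup B] [Module K B]
    (f : MultilinearMap K (fun i => SymmetricAlgebra K (E i)) B)
    (s : ∀ i, SymmetricAlgebra K (E i)) : symLiftLinear f (symTprod K s) = f s :=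
  PiTensorProduct.lift.tprod s

/-- Algebra maps out of `⨂ S(E i)`. -/
def symLift [Fintype ι] {B : Type*} [CommRing B] [Algebra K B] (f : ∀ i, E i →ₗ[K] B) :
    SymTensor K E →ₐ[K] B :=
  AlgHom.ofLinearMap (symLiftLinear ((MultilinearMap.mkPiAlgebra K ι B).compLinearMap
      fun i => (SymmetricAlgebra.lift (f i)).toLinearMap))
    (by rw [← symTprod_one, symLiftLinear_tprod]; simp)
    (by
      intro a b
      induction a using symTensor_linear_induction with
      | add a a' ha ha' => rw [add_mul, map_add, ha, ha', map_add, add_mul]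
      | smul c s =>
        induction b using symTensor_linear_induction with
        | add b b' hb hb' => rw [mul_add, map_add, hb, hb', map_add, mul_add]
        | smul c' t =>
          rw [smul_mul_smul_comm, symTprod_mul, map_smul, map_smul, map_smul,
            smul_mul_smul_comm, symLiftLinear_tprod, symLiftLinear_tprod, symLiftLinear_tprod]
          simp [Finset.prod_mul_distrib])

theorem symLift_tprod [Fintype ι] {B : Type*} [CommRing B] [Algebra K B] (f : ∀ i, E i →ₗ[K] B)
    (s : ∀ i, SymmetricAlgebra K (E i)) :
    symLift f (symTprod K s) = ∏ i, SymmetricAlgebra.lift (f i) (s i) := by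
  refine (symLiftLinear_tprod _ s).trans ?_
  simp

variable [DecidableEq ι]

theorem symTprod_update_add (s : ∀ i, SymmetricAlgebra K (E i)) (i : ι)
    (a b : SymmetricAlgebra K (E i)) :
    symTprod K (Function.update s i (a + b)) =
      symTprod K (Function.update s i a) + symTprod K (Function.update s i b) := by
  unfold symTprod
  rw [MultilinearMap.map_update_add, map_add]

theorem symTprod_update_smul (s : ∀ i, SymmetricAlgebra K (E i)) (i : ι) (c : K)
    (a : SymmetricAlgebra K (E i)) :
    symTprod K (Function.update s i (c • a)) = c • symTprod K (Function.update s i a) := by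
  unfold symTprod
  rw [MultilinearMap.map_update_smul, map_smul]

variable (K E) in
/-- The inclusion of a factor. -/
def symSingle (i : ι) : SymmetricAlgebra K (E i) →ₐ[K] SymTensor K E :=
  AlgHom.ofLinearMap
    { toFun := fun s => symTprod K (Pi.mulSingle i s)
      map_add' := fun a b => symTprod_update_add 1 i a b
      map_smul' := fun c a => symTprod_update_smul 1 i c a }
    ((congrArg (symTprod K) (Pi.mulSingle_one i)).trans symTprod_one)
    fun a b => (congrArg (symTprod K) (Pi.mulSingle_mul i a b)).trans (symTprod_mul _ _).symm

theorem symSingle_apply (i : ι) (s : SymmetricAlgebra K (E i)) :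
    symSingle K E i s = symTprod K (Pi.mulSingle i s) := rfl

theorem symTprod_eq_prod_single [Fintype ι] (s : ∀ i, SymmetricAlgebra K (E i)) :
    symTprod K s = ∏ i, symSingle K E i (s i) := by
  conv_lhs => rw [← Finset.univ_prod_mulSingle s]
  rw [symTprod_prod]
  rfl

variable [Fintype ι]

variable (K E) in
/-- The generators of `⨂ S(E i)`. -/
def symGen : (∀ i, E i) →ₗ[K] SymTensor K E :=
  ∑ i, (symSingle K E i).toLinearMap ∘ₗ SymmetricAlgebra.ι K (E i) ∘ₗ LinearMap.proj i

theorem symGen_apply (u : ∀ i, E i) :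
    symGen K E u = ∑ i, symSingle K E i (SymmetricAlgebra.ι K (E i) (u i)) := by
  simp [symGen]

theorem symGen_single (i : ι) (u : E i) :
    symGen K E (Pi.single i u) = symSingle K E i (SymmetricAlgebra.ι K (E i) u) := by
  rw [symGen_apply, Finset.sum_eq_single i]
  · simp
  · intro j _ hj
    simp [hj]
  · simp

/-- A decomposable tensor is the product of its one-factor parts, and on each factor an algebra map
is determined by the generators. -/
theorem symTensor_algHom_ext {B : Type*} [CommRing B] [Algebra K B] {F G : SymTensor K E →ₐ[K] B}
    (h : ∀ i u, F (symSingle K E i (SymmetricAlgebra.ι K (E i) u)) =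
      G (symSingle K E i (SymmetricAlgebra.ι K (E i) u))) : F = G := by
  have h1 : ∀ i, F.comp (symSingle K E i) = G.comp (symSingle K E i) := fun i =>
    SymmetricAlgebra.algHom_ext (LinearMap.ext (h i))
  ext a
  induction a using symTensor_linear_induction with
  | smul c s =>
    rw [map_smul, map_smul, symTprod_eq_prod_single, map_prod, map_prod]
    congr 1
    exact Finset.prod_congr rfl fun i _ => DFunLike.congr_fun (h1 i) (s i)
  | add a b ha hb => rw [map_add, map_add, ha, hb]

/-- `⨂ S(E i)` is the symmetric algebra of `Π i, E i`. -/
theorem isSymmetricAlgebra_symGen : IsSymmetricAlgebra (symGen K E) := by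
  -- The inverse of the map induced by `symGen`: on the `i`-th factor it is induced by the inclusion
  -- of `E i` in the product. The product is a direct sum because `ι` is finite.
  let F : SymTensor K E →ₐ[K] SymmetricAlgebra K (∀ i, E i) :=
    symLift fun i => SymmetricAlgebra.ι K (∀ i, E i) ∘ₗ LinearMap.single K E i
  have hF : ∀ i u, F (symSingle K E i (SymmetricAlgebra.ι K (E i) u)) =
      SymmetricAlgebra.ι K (∀ i, E i) (Pi.single i u) := by
    intro i u
    refine (symLift_tprod _ _).trans ?_
    rw [Finset.prod_eq_single i]
    · simp
    · intro j _ hj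
      simp [hj]
    · simp
  let e : SymmetricAlgebra K (∀ i, E i) ≃ₐ[K] SymTensor K E :=
    AlgEquiv.ofAlgHom (SymmetricAlgebra.lift (symGen K E)) F
      (symTensor_algHom_ext fun i u => by simp [hF, symGen_single])
      (by
        refine SymmetricAlgebra.algHom_ext (LinearMap.ext fun u => ?_)
        change F (SymmetricAlgebra.lift (symGen K E) (SymmetricAlgebra.ι K _ u)) =
          SymmetricAlgebra.ι K _ u
        rw [SymmetricAlgebra.lift_ι_apply, symGen_apply, map_sum]
        simp only [hF]
        rw [← map_sum, Finset.univ_sum_single])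
  exact IsSymmetricAlgebra.of_equiv e (LinearMap.ext fun u => by simp [e])

/-- A general generator is a sum of generators in single factors, so only the latter need to be
treated. -/
theorem symTensor_induction {P : SymTensor K E → Prop}
    (hc : ∀ c : K, P (algebraMap K (SymTensor K E) c))
    (add : ∀ a b, P a → P b → P (a + b)) (mul : ∀ a b, P a → P b → P (a * b))
    (single : ∀ i u, P (symSingle K E i (SymmetricAlgebra.ι K (E i) u))) (a : SymTensor K E) :
    P a := by
  have h0 : P 0 := by
    have := hc 0
    rwa [map_zero] at this
  have hgen : ∀ u, P (symGen K E u) := fun u => by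
    rw [symGen_apply]
    exact Finset.sum_induction _ P add h0 fun i _ => single i (u i)
  exact symAlg_induction (P := P) (isSymmetricAlgebra_symGen (K := K) (E := E)) hc add mul hgen a

/-- The Poisson bracket on `⨂ S(E i)` defined by a bilinear form on the generators. -/
def tensorPoisson (κ : (∀ i, E i) →ₗ[K] (∀ i, E i) →ₗ[K] K) :
    SymTensor K E →ₗ[K] SymTensor K E →ₗ[K] SymTensor K E :=
  symPoisson isSymmetricAlgebra_symGen κ

section TensorPoisson

variable (κ : (∀ i, E i) →ₗ[K] (∀ i, E i) →ₗ[K] K) (a b c : SymTensor K E)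

theorem tensorPoisson_single (i j : ι) (u : E i) (v : E j) :
    tensorPoisson κ (symSingle K E i (SymmetricAlgebra.ι K (E i) u))
      (symSingle K E j (SymmetricAlgebra.ι K (E j) v)) =
      algebraMap K _ (κ (Pi.single i u) (Pi.single j v)) := by
  rw [← symGen_single, ← symGen_single]
  exact symPoisson_gen _ _ _ _

theorem tensorPoisson_mul_left :
    tensorPoisson κ (a * b) c = tensorPoisson κ a c * b + a * tensorPoisson κ b c :=
  symPoisson_mul_left _ κ a b c

theorem tensorPoisson_mul_right :
    tensorPoisson κ a (b * c) = tensorPoisson κ a b * c + b * tensorPoisson κ a c :=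
  symPoisson_mul_right _ κ a b c

theorem tensorPoisson_one_left : tensorPoisson κ 1 a = 0 :=
  symPoisson_one_left _ κ a

theorem tensorPoisson_one_right : tensorPoisson κ a 1 = 0 :=
  symPoisson_one_right _ κ a

variable {κ}

theorem tensorPoisson_antisymm (hκ : ∀ u v, κ u v = -κ v u) :
    tensorPoisson κ a b = -tensorPoisson κ b a :=
  symPoisson_antisymm _ hκ a b

theorem tensorPoisson_jacobi (hκ : ∀ u v, κ u v = -κ v u) :
    tensorPoisson κ (tensorPoisson κ a b) c + tensorPoisson κ (tensorPoisson κ b c) a +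
      tensorPoisson κ (tensorPoisson κ c a) b = 0 :=
  symPoisson_jacobi _ hκ a b c

theorem tensorPoisson_map {ι' : Type*} {E' : ι' → Type*} [∀ i, AddCommGroup (E' i)]
    [∀ i, Module K (E' i)] [DecidableEq ι'] [Fintype ι']
    {κ' : (∀ i, E' i) →ₗ[K] (∀ i, E' i) →ₗ[K] K} {φ : SymTensor K E →ₐ[K] SymTensor K E'}
    {ψ : (∀ i, E i) → ∀ i, E' i} (hφ : ∀ u, φ (symGen K E u) = symGen K E' (ψ u))
    (hκ : ∀ u v, κ' (ψ u) (ψ v) = κ u v) :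
    φ (tensorPoisson κ a b) = tensorPoisson κ' (φ a) (φ b) :=
  symPoisson_map _ _ hφ hκ a b

end TensorPoisson

end SymTensor

/-! ## Sheaves of smooth sections -/

section Sections

variable {K : Type} [RCLike K] {X : SmoothSpace.{u} K}

/-- The smooth sections form a sheaf of modules over the smooth functions. -/
structure BundleData.Sheafy (E : BundleData.{u, v} X) : Prop where
  zero : ∀ x, E.SmoothAt (fun _ => 0) x
  add : ∀ {s t : ∀ x, E.fiber x} {x : X.carrier}, E.SmoothAt s x → E.SmoothAt t x →
    E.SmoothAt (fun y => s y + t y) x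
  smul : ∀ {c : X.carrier → K} {s : ∀ x, E.fiber x} {x : X.carrier}, X.SmoothAt c x →
    E.SmoothAt s x → E.SmoothAt (fun y => c y • s y) x
  congr : ∀ {s t : ∀ x, E.fiber x} {x : X.carrier}, E.SmoothAt s x → (∀ᶠ y in 𝓝 x, t y = s y) →
    E.SmoothAt t x

theorem BundleData.Sheafy.sum {E : BundleData.{u, v} X} (hE : E.Sheafy) {ι : Type*} (J : Finset ι)
    {s : ι → ∀ x, E.fiber x} {x : X.carrier} (h : ∀ i ∈ J, E.SmoothAt (s i) x) :
    E.SmoothAt (fun y => ∑ i ∈ J, s i y) x := by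
  classical
  induction J using Finset.induction_on with
  | empty => simpa using hE.zero x
  | insert i J hi ih =>
    simp only [Finset.sum_insert hi]
    exact hE.add (h i (Finset.mem_insert_self i J))
      (ih fun j hj => h j (Finset.mem_insert_of_mem hj))

variable {F : X.carrier → Type v} [∀ x, AddCommGroup (F x)] [∀ x, Module K (F x)]
  {G : (∀ x, F x) → X.carrier → Prop}

theorem generated_of_gen (hX : X.Regular) {g : ∀ x, F x} {x : X.carrier} (h : G g x) :
    GeneratedSmoothAt G g x :=
  ⟨1, fun _ _ => 1, fun _ => g, fun _ => ⟨hX.const 1 x, h⟩, Eventually.of_forall fun y => by simp⟩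

theorem generated_zero (x : X.carrier) : GeneratedSmoothAt G (fun _ => 0) x :=
  ⟨0, fun _ _ => 0, fun _ _ => 0, fun i => i.elim0, Eventually.of_forall fun y => by simp⟩

theorem generated_add {s t : ∀ x, F x} {x : X.carrier} (hs : GeneratedSmoothAt G s x)
    (ht : GeneratedSmoothAt G t x) : GeneratedSmoothAt G (fun y => s y + t y) x := by
  obtain ⟨n, c, g, h, he⟩ := hs
  obtain ⟨m, c', g', h', he'⟩ := ht
  refine ⟨n + m, Fin.append c c', Fin.append g g', fun i => ?_, ?_⟩
  · refine Fin.addCases (fun i => ?_) (fun i => ?_) i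
    · simpa using h i
    · simpa using h' i
  · filter_upwards [he, he'] with y hy hy'
    rw [hy, hy', Fin.sum_univ_add]
    simp

theorem generated_smul (hX : X.Regular) {c : X.carrier → K} {s : ∀ x, F x} {x : X.carrier}
    (hc : X.SmoothAt c x) (hs : GeneratedSmoothAt G s x) :
    GeneratedSmoothAt G (fun y => c y • s y) x := by
  obtain ⟨n, c', g, h, he⟩ := hs
  refine ⟨n, fun i y => c y * c' i y, g, fun i => ⟨hX.mul hc (h i).1, (h i).2⟩, ?_⟩
  filter_upwards [he] with y hy
  rw [hy, Finset.smul_sum]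
  simp only [mul_smul]

theorem generated_congr {s t : ∀ x, F x} {x : X.carrier} (hs : GeneratedSmoothAt G s x)
    (h : ∀ᶠ y in 𝓝 x, t y = s y) : GeneratedSmoothAt G t x := by
  obtain ⟨n, c', g, h', he⟩ := hs
  refine ⟨n, c', g, h', ?_⟩
  filter_upwards [he, h] with y hy hy'
  rw [hy', hy]

/-- The smooth sections of `E` are those generated by `G`. -/
def BundleData.IsGenerated (E : BundleData.{u, v} X)
    (G : (∀ x, E.fiber x) → X.carrier → Prop) : Prop :=
  ∀ s x, E.SmoothAt s x ↔ GeneratedSmoothAt G s x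

variable {E : BundleData.{u, v} X} {G : (∀ x, E.fiber x) → X.carrier → Prop}

theorem BundleData.IsGenerated.sheafy (hE : E.IsGenerated G) (hX : X.Regular) : E.Sheafy where
  zero x := (hE _ _).2 (generated_zero x)
  add hs ht := (hE _ _).2 (generated_add ((hE _ _).1 hs) ((hE _ _).1 ht))
  smul hc hs := (hE _ _).2 (generated_smul hX hc ((hE _ _).1 hs))
  congr hs h := (hE _ _).2 (generated_congr ((hE _ _).1 hs) h)

theorem BundleData.IsGenerated.of_gen (hE : E.IsGenerated G) (hX : X.Regular) {g : ∀ x, E.fiber x}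
    {x : X.carrier} (h : G g x) : E.SmoothAt g x :=
  (hE _ _).2 (generated_of_gen hX h)

/-- Fibrewise linear maps are smooth if they send generators to smooth sections. -/
theorem BundleData.IsGenerated.smooth_map (hE : E.IsGenerated G) {F : BundleData.{u, w} X}
    (hF : F.Sheafy) (app : ∀ x, E.fiber x →ₗ[K] F.fiber x)
    (h : ∀ g x, G g x → F.SmoothAt (fun y => app y (g y)) x) (s : ∀ x, E.fiber x) (x : X.carrier)
    (hs : E.SmoothAt s x) : F.SmoothAt (fun y => app y (s y)) x := by
  obtain ⟨n, c, g, hcg, he⟩ := (hE _ _).1 hs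
  refine hF.congr (hF.sum Finset.univ fun i _ => hF.smul (hcg i).1 (h (g i) x (hcg i).2)) ?_
  filter_upwards [he] with y hy
  rw [hy, map_sum]
  simp only [map_smul]

/-- `BundleData` imposes no axioms on its smooth sections. Those of a vector bundle inherit the
sheaf properties of their coefficients in a local frame. -/
theorem BundleData.IsVectorBundle.sheafy (hE : E.IsVectorBundle) (hX : X.Regular) : E.Sheafy where
  zero x := by
    obtain ⟨ι, e, h⟩ := hE x
    exact (h.self_of_nhds.2.2 _).2 ⟨∅, fun _ _ => 0, by simp, by simp⟩
  add {s t x} hs ht := by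
    classical
    obtain ⟨ι, e, h⟩ := hE x
    have h2 := h.self_of_nhds.2.2
    obtain ⟨J, c, hc, he⟩ := (h2 _).1 hs
    obtain ⟨J', c', hc', he'⟩ := (h2 _).1 ht
    -- Smoothness of `c` and `c'` is known only for indices in `J` and `J'`, so both are cut off by
    -- zero before they are added over the union.
    refine (h2 _).2 ⟨J ∪ J', fun i y => (if i ∈ J then c i y else 0) +
      (if i ∈ J' then c' i y else 0), fun i _ => ?_, ?_⟩
    · refine hX.add ?_ ?_
      · by_cases hi : i ∈ J
        · simpa [hi] using hc i hi
        · simpa [hi] using hX.const 0 x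
      · by_cases hi : i ∈ J'
        · simpa [hi] using hc' i hi
        · simpa [hi] using hX.const 0 x
    · filter_upwards [he, he'] with y hy hy'
      rw [hy, hy']
      simp only [add_smul, Finset.sum_add_distrib, ite_smul, zero_smul]
      rw [Finset.sum_ite_mem, Finset.sum_ite_mem]
      simp
  smul {f s x} hf hs := by
    obtain ⟨ι, e, h⟩ := hE x
    have h2 := h.self_of_nhds.2.2
    obtain ⟨J, c, hc, he⟩ := (h2 _).1 hs
    refine (h2 _).2 ⟨J, fun i y => f y * c i y, fun i hi => hX.mul hf (hc i hi), ?_⟩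
    filter_upwards [he] with y hy
    rw [hy, Finset.smul_sum]
    simp only [mul_smul]
  congr {s t x} hs ht := by
    obtain ⟨ι, e, h⟩ := hE x
    have h2 := h.self_of_nhds.2.2
    obtain ⟨J, c, hc, he⟩ := (h2 _).1 hs
    refine (h2 _).2 ⟨J, c, hc, ?_⟩
    filter_upwards [he, ht] with y hy hy'
    rw [hy', hy]

/-- A vector bundle from a local frame of generated sections. -/
theorem BundleData.IsGenerated.isVectorBundle (hE : E.IsGenerated G) (hX : X.Regular)
    (h : ∀ x₀ : X.carrier, ∃ (ι : Type v) (e : ι → ∀ x, E.fiber x), ∀ᶠ y in 𝓝 x₀,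
      LinearIndependent K (fun i => e i y) ∧
      Submodule.span K (Set.range fun i => e i y) = ⊤ ∧ (∀ i, E.SmoothAt (e i) y) ∧
      ∀ g, G g y → ∃ (J : Finset ι) (c : ι → X.carrier → K), (∀ i ∈ J, X.SmoothAt (c i) y) ∧
        ∀ᶠ z in 𝓝 y, g z = ∑ i ∈ J, c i z • e i z) : E.IsVectorBundle := by
  intro x₀
  obtain ⟨ι, e, he⟩ := h x₀
  refine ⟨ι, e, he.mono ?_⟩
  rintro y ⟨h1, h2, h3, h4⟩
  refine ⟨h1, h2, fun s => ⟨fun hs => ?_, ?_⟩⟩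
  · classical
    obtain ⟨n, c, g, hcg, hev⟩ := (hE _ _).1 hs
    choose J b hb hJ using fun i => h4 (g i) (hcg i).2
    -- Each generator is expanded in the frame and the coefficients are collected; `b i j` is used
    -- only for `j ∈ J i`, where it is known to be smooth.
    refine ⟨Finset.univ.biUnion J, fun j z => ∑ i, c i z * (if j ∈ J i then b i j z else 0),
      fun j _ => ?_, ?_⟩
    · refine hX.sum _ fun i _ => hX.mul (hcg i).1 ?_
      by_cases hj : j ∈ J i
      · simpa [hj] using hb i j hj
      · simpa [hj] using hX.const 0 y
    · filter_upwards [hev, eventually_all.2 hJ] with z hz hz'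
      rw [hz]
      simp only [Finset.sum_smul]
      rw [Finset.sum_comm]
      refine Finset.sum_congr rfl fun i _ => ?_
      rw [hz' i, Finset.smul_sum]
      simp only [mul_ite, mul_zero, ite_smul, zero_smul, mul_smul]
      rw [Finset.sum_ite_mem]
      congr 1
      exact (Finset.inter_eq_right.2 (Finset.subset_biUnion_of_mem J (Finset.mem_univ i))).symm
  · rintro ⟨J, c, hc, hs⟩
    exact (hE.sheafy hX).congr ((hE.sheafy hX).sum J fun i hi => (hE.sheafy hX).smul (hc i hi) (h3 i))
      hs

end Sections

/-! ## Bundle maps out of a Cauchy tensor product -/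

section CauchyMaps

universe w'

variable {K : Type} [RCLike K] {d : ℕ} {M : Type u} [TopologicalSpace M]
  [ChartedSpace (EuclideanSpace ℝ (Fin d)) M] {A : BundleData.{u, v} (UConf K d M)}
  {B : BundleData.{u, w} (UConf K d M)} {C : BundleData.{u, w'} (UConf K d M)}

/-- Bilinear maps on the fibres over disjoint configurations. -/
abbrev SplitBilin (A : BundleData.{u, v} (UConf K d M)) (B : BundleData.{u, w} (UConf K d M))
    (C : BundleData.{u, w'} (UConf K d M)) :=
  ∀ {x y z : Finset M}, IsSplit x y z → (A.fiber x →ₗ[K] B.fiber y →ₗ[K] C.fiber z)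

theorem cauchyMk_add_left {x y z : Finset M} (h : IsSplit x y z) (a a' : A.fiber x)
    (b : B.fiber y) : cauchyMk (A := A) (B := B) h (a + a') b = cauchyMk h a b + cauchyMk h a' b := by
  unfold cauchyMk
  rw [TensorProduct.add_tmul, map_add]

theorem cauchyMk_add_right {x y z : Finset M} (h : IsSplit x y z) (a : A.fiber x)
    (b b' : B.fiber y) : cauchyMk (A := A) (B := B) h a (b + b') = cauchyMk h a b + cauchyMk h a b' := by
  unfold cauchyMk
  rw [TensorProduct.tmul_add, map_add]

theorem cauchyMk_smul_left {x y z : Finset M} (h : IsSplit x y z) (c : K) (a : A.fiber x)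
    (b : B.fiber y) : cauchyMk (A := A) (B := B) h (c • a) b = c • cauchyMk h a b := by
  classical
  unfold cauchyMk
  rw [← TensorProduct.smul_tmul']
  exact (DirectSum.lof K {q : Finset M × Finset M // IsSplit q.1 q.2 z}
    (fun q => A.fiber q.1.1 ⊗[K] B.fiber q.1.2) ⟨(x, y), h⟩).map_smul c _

theorem cauchyMk_smul_right {x y z : Finset M} (h : IsSplit x y z) (c : K) (a : A.fiber x)
    (b : B.fiber y) : cauchyMk (A := A) (B := B) h a (c • b) = c • cauchyMk h a b := by
  rw [← cauchyMk_smul_left]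
  unfold cauchyMk
  rw [TensorProduct.smul_tmul]

/-- The components of a bundle map out of a Cauchy tensor product, as bilinear maps. -/
def Hom.onLinear (m : Hom (A.cauchy B) C) : SplitBilin A B C := fun {_ _ z} h =>
  LinearMap.mk₂ K (m.on h)
    (fun a a' b => by unfold Hom.on; rw [cauchyMk_add_left, map_add])
    (fun c a b => by unfold Hom.on; rw [cauchyMk_smul_left, map_smul])
    (fun a b b' => by unfold Hom.on; rw [cauchyMk_add_right, map_add])
    (fun c a b => by unfold Hom.on; rw [cauchyMk_smul_right, map_smul])

theorem Hom.onLinear_apply (m : Hom (A.cauchy B) C) {x y z : Finset M} (h : IsSplit x y z)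
    (a : A.fiber x) (b : B.fiber y) : m.onLinear h a b = m.on h a b := rfl

/-- The fibres of `A ⊠ B` are direct sums of tensor products, hence generated by the vectors
`cauchyMk`. -/
theorem Hom.ext_on {m m' : Hom (A.cauchy B) C}
    (h : ∀ {x y z : Finset M} (h : IsSplit x y z) (a : A.fiber x) (b : B.fiber y),
      m.on h a b = m'.on h a b) : m = m' := by
  classical
  refine Hom.ext (funext fun z => DirectSum.linearMap_ext K fun q => TensorProduct.ext' fun a b => ?_)
  exact h q.2 a b

/-- The linear map on the Cauchy tensor product defined by bilinear maps. -/
def cauchyLift (β : SplitBilin A B C) (z : Finset M) : CauchyFiber A B z →ₗ[K] C.fiber z := by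
  classical
  exact DirectSum.toModule K _ _ fun q => TensorProduct.lift (β q.2)

theorem cauchyLift_mk (β : SplitBilin A B C) {x y z : Finset M} (h : IsSplit x y z)
    (a : A.fiber x) (b : B.fiber y) : cauchyLift β z (cauchyMk h a b) = β h a b := by
  classical
  unfold cauchyLift cauchyMk
  exact (DirectSum.toModule_lof K (ι := {q : Finset M × Finset M // IsSplit q.1 q.2 z})
    (M := fun q => A.fiber q.1.1 ⊗[K] B.fiber q.1.2) ⟨(x, y), h⟩ _).trans
    (TensorProduct.lift.tmul _ _)

theorem cauchy_isGenerated : (A.cauchy B).IsGenerated fun g x =>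
    ∃ (U U' : Set M) (s : ∀ y, A.fiber y) (t : ∀ y, B.fiber y),
      IsOpen U ∧ IsOpen U' ∧ Disjoint U U' ∧ (∀ p ∈ x, p ∈ U ∪ U') ∧
      A.SmoothAt s (restrict x U) ∧ B.SmoothAt t (restrict x U') ∧
      ∀ (y : Finset M) (h : IsSplit (restrict y U) (restrict y U') y),
        g y = cauchyMk h (s (restrict y U)) (t (restrict y U')) := fun _ _ => Iff.rfl

/-- Bilinear maps on split fibres send smooth sections to smooth sections. -/
def SmoothBilin (β : SplitBilin A B C) : Prop :=
  ∀ (x : Finset M) (U U' : Set M) (s : ∀ y, A.fiber y) (t : ∀ y, B.fiber y),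
    IsOpen U → IsOpen U' → Disjoint U U' → (∀ p ∈ x, p ∈ U ∪ U') →
    A.SmoothAt s (restrict x U) → B.SmoothAt t (restrict x U') →
    ∀ g : ∀ y, C.fiber y,
      (∀ (y : Finset M) (h : IsSplit (restrict y U) (restrict y U') y),
        g y = β h (s (restrict y U)) (t (restrict y U'))) → C.SmoothAt g x

/-- The bundle map defined by smooth bilinear maps on split fibres. -/
def cauchyHom (β : SplitBilin A B C) (hβ : SmoothBilin β) (hC : C.Sheafy) :
    Hom (A.cauchy B) C where
  app := cauchyLift β
  smooth := by
    refine cauchy_isGenerated.smooth_map hC _ ?_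
    rintro g x ⟨U, U', s, t, hU, hU', hd, hx, hs, ht, hg⟩
    refine hβ x U U' s t hU hU' hd hx hs ht _ fun y h => ?_
    rw [hg y h]
    exact cauchyLift_mk β h _ _

theorem cauchyHom_on (β : SplitBilin A B C) (hβ : SmoothBilin β) (hC : C.Sheafy)
    {x y z : Finset M} (h : IsSplit x y z) (a : A.fiber x) (b : B.fiber y) :
    (cauchyHom β hβ hC).on h a b = β h a b :=
  cauchyLift_mk β h a b

variable [T2Space M]

/-- The section `y ↦ s (y ∩ U) ⊗ t (y ∩ U')` of `A ⊠ B` is smooth. Its value `0` where `U` and `U'`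
do not split `y` is harmless, because every configuration near `x` is split. -/
theorem Hom.smoothBilin (m : Hom (A.cauchy B) C) (hC : C.Sheafy) : SmoothBilin m.onLinear := by
  classical
  intro x U U' s t hU hU' hd hx hs ht g hg
  let g' : ∀ y, CauchyFiber A B y := fun y =>
    if h : IsSplit (restrict y U) (restrict y U') y then
      cauchyMk h (s (restrict y U)) (t (restrict y U')) else 0
  have hg' : (A.cauchy B).SmoothAt g' x :=
    cauchy_isGenerated.of_gen (uConf_regular K d M)
      ⟨U, U', s, t, hU, hU', hd, hx, hs, ht, fun y h => by simp [g', h]⟩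
  refine hC.congr (m.smooth g' x hg') ?_
  refine (eventually_isSplit_restrict hU hU' hd hx).mono fun y h => ?_
  rw [hg y h]
  simp only [g', h, dif_pos]
  rfl

/-- Smoothness of bilinear maps may be tested on generators. -/
theorem smoothBilin_of_generators {GA : (∀ x, A.fiber x) → Finset M → Prop}
    {GB : (∀ x, B.fiber x) → Finset M → Prop} (hA : ∀ s x, A.SmoothAt s x → GeneratedSmoothAt (X := UConf K d M) GA s x)
    (hB : ∀ s x, B.SmoothAt s x → GeneratedSmoothAt (X := UConf K d M) GB s x) (hC : C.Sheafy) (β : SplitBilin A B C)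
    (h : ∀ (x : Finset M) (U U' : Set M) (s : ∀ y, A.fiber y) (t : ∀ y, B.fiber y),
      IsOpen U → IsOpen U' → Disjoint U U' → (∀ p ∈ x, p ∈ U ∪ U') →
      GA s (restrict x U) → GB t (restrict x U') →
      ∃ g : ∀ y, C.fiber y, C.SmoothAt g x ∧
        ∀ᶠ y in 𝓝 x, ∀ h : IsSplit (restrict y U) (restrict y U') y,
          g y = β h (s (restrict y U)) (t (restrict y U'))) : SmoothBilin β := by
  intro x U U' s t hU hU' hd hx hs ht g hg
  obtain ⟨n, c, a, hca, hs⟩ := hA _ _ hs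
  obtain ⟨m, c', b, hcb, ht⟩ := hB _ _ ht
  choose g' hg' hgg using fun i j => h x U U' (a i) (b j) hU hU' hd hx (hca i).2 (hcb j).2
  have hx' : ∀ p ∈ x, p ∈ U' ∪ U := fun p hp => (hx p hp).symm
  have hs1 := (tendsto_restrict hU hU' hd hx).eventually hs
  have ht1 := (tendsto_restrict hU' hU hd.symm hx').eventually ht
  -- The coefficients live on `y ∩ U` and `y ∩ U'`; `smoothAt_restrict` turns them into smooth
  -- functions of `y`, and bilinearity takes them out of `β`.
  refine hC.congr (hC.sum (Finset.univ : Finset (Fin n)) fun i _ =>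
    hC.sum (Finset.univ : Finset (Fin m)) fun j _ =>
    hC.smul (smoothAt_restrict hU hU' hd hx (hca i).1)
      (hC.smul (smoothAt_restrict hU' hU hd.symm hx' (hcb j).1) (hg' i j))) ?_
  have h0 := eventually_isSplit_restrict hU hU' hd hx
  have h1 := eventually_all.2 fun i => eventually_all.2 fun j => hgg i j
  filter_upwards [h0, h1, hs1, ht1] with y h0 h1 h2 h3
  rw [hg y h0, h2, h3]
  simp only [map_sum, LinearMap.sum_apply, map_smul, LinearMap.smul_apply, h1 _ _ h0]
  rw [Finset.sum_comm]
  refine Finset.sum_congr rfl fun j _ => ?_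
  rw [Finset.smul_sum]
  exact Finset.sum_congr rfl fun i _ => smul_comm _ _ _

end CauchyMaps

/-! ## The fibres of the Cauchy symmetric bundle -/

section SFiber

variable {K : Type} [RCLike K] {d : ℕ} {M : Type u} [TopologicalSpace M]
  [ChartedSpace (EuclideanSpace ℝ (Fin d)) M] (V : BundleData.{u, v} (manifold K d M))

theorem sEquiv_symm_tprod (x : Finset M) (s : ∀ p : M, V.fiber p) :
    (sEquiv V x).symm (PiTensorProduct.tprod K fun p : x => s p.1) = boxProd V x s := by
  rw [← sEquiv_boxProd, LinearEquiv.symm_apply_apply]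

theorem boxProd_congr {x : Finset M} {s t : ∀ p : M, V.fiber p} (h : ∀ p ∈ x, s p = t p) :
    boxProd V x s = boxProd V x t := by
  rw [← sEquiv_symm_tprod, ← sEquiv_symm_tprod]
  congr 2
  funext p
  exact h p.1 p.2

theorem exists_extension (x : Finset M) (s : ∀ p : x, V.fiber p.1) :
    ∃ s' : ∀ p : M, V.fiber p, (fun p : x => s' p.1) = s := by
  classical
  exact ⟨fun p => if h : p ∈ x then s ⟨p, h⟩ else 0, funext fun p => by simp⟩

theorem sFiber_induction {x : Finset M} {P : SFiber V x → Prop}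
    (smul : ∀ (c : K) s, P (c • boxProd V x s)) (add : ∀ a b, P a → P b → P (a + b))
    (a : SFiber V x) : P a := by
  obtain ⟨b, rfl⟩ := (sEquiv V x).symm.surjective a
  induction b using PiTensorProduct.induction_on with
  | smul_tprod c s =>
    obtain ⟨s', rfl⟩ := exists_extension V x s
    rw [map_smul, sEquiv_symm_tprod]
    exact smul c s'
  | add a b ha hb =>
    rw [map_add]
    exact add _ _ ha hb

/-- The fibre over `x` as a tensor product over a type in bijection with the points of `x`. -/
def sEquivOf {ι : Type*} {x : Finset M} (τ : ι ≃ x) :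
    (⨂[K] i, V.fiber (τ i).1) ≃ₗ[K] SFiber V x :=
  (PiTensorProduct.reindex K (fun p : x => V.fiber p.1) τ.symm).symm ≪≫ₗ (sEquiv V x).symm

theorem sEquivOf_tprod {ι : Type*} {x : Finset M} (τ : ι ≃ x) (s : ∀ p : M, V.fiber p) :
    sEquivOf V τ (PiTensorProduct.tprod K fun i => s (τ i).1) = boxProd V x s := by
  have h : PiTensorProduct.reindex K (fun p : x => V.fiber p.1) τ.symm
      (PiTensorProduct.tprod K fun p : x => s p.1) =
      PiTensorProduct.tprod K fun i => s (τ i).1 := by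
    rw [PiTensorProduct.reindex_tprod]
    rfl
  unfold sEquivOf
  rw [LinearEquiv.trans_apply, ← sEquiv_symm_tprod]
  congr 1
  exact (congrArg _ h.symm).trans (LinearEquiv.symm_apply_apply _ _)

/-- The product `⊡` as a family of bilinear maps. -/
def boxdotLinear : SplitBilin V.cauchySym V.cauchySym V.cauchySym := fun {x y z} h =>
  -- The point `h.sumEquiv (Sum.inl i)` is definitionally `i`, so `sEquiv` can be retyped with the
  -- factors expected by `tmulEquivDep`.
  let ex : SFiber V x →ₗ[K] ⨂[K] i : x, V.fiber (h.sumEquiv (Sum.inl i)).1 :=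
    (sEquiv V x).toLinearMap
  let ey : SFiber V y →ₗ[K] ⨂[K] i : y, V.fiber (h.sumEquiv (Sum.inr i)).1 :=
    (sEquiv V y).toLinearMap
  ((TensorProduct.mk K _ _).compr₂
    ((sEquiv V z).symm.toLinearMap ∘ₗ
      (PiTensorProduct.reindex K (fun p : z => V.fiber p.1) h.sumEquiv.symm).symm.toLinearMap ∘ₗ
      (PiTensorProduct.tmulEquivDep K
        (fun i : x ⊕ y => V.fiber (h.sumEquiv i).1)).toLinearMap)).compl₁₂ ex ey

theorem boxdotLinear_apply {x y z : Finset M} (h : IsSplit x y z) (a : SFiber V x)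
    (b : SFiber V y) : boxdotLinear V h a b = boxdot V h a b := rfl

theorem boxdot_add_left {x y z : Finset M} (h : IsSplit x y z) (a a' : SFiber V x)
    (b : SFiber V y) : boxdot V h (a + a') b = boxdot V h a b + boxdot V h a' b :=
  (boxdotLinear V h).map_add₂ a a' b

theorem boxdot_add_right {x y z : Finset M} (h : IsSplit x y z) (a : SFiber V x)
    (b b' : SFiber V y) : boxdot V h a (b + b') = boxdot V h a b + boxdot V h a b' :=
  (boxdotLinear V h a).map_add b b'

theorem boxdot_smul_left {x y z : Finset M} (h : IsSplit x y z) (c : K) (a : SFiber V x)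
    (b : SFiber V y) : boxdot V h (c • a) b = c • boxdot V h a b :=
  (boxdotLinear V h).map_smul₂ c a b

theorem boxdot_smul_right {x y z : Finset M} (h : IsSplit x y z) (c : K) (a : SFiber V x)
    (b : SFiber V y) : boxdot V h a (c • b) = c • boxdot V h a b :=
  (boxdotLinear V h a).map_smul c b

open Classical in
/-- The section that agrees with `s` on `U` and with `t` elsewhere. -/
def glue {F : M → Type*} (U : Set M) (s t : ∀ p : M, F p) (p : M) : F p :=
  if p ∈ U then s p else t p

omit [TopologicalSpace M] [ChartedSpace (EuclideanSpace ℝ (Fin d)) M] in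
theorem glue_mem {F : M → Type*} {U : Set M} {s t : ∀ p : M, F p} {p : M} (h : p ∈ U) :
    glue U s t p = s p := if_pos h

omit [TopologicalSpace M] [ChartedSpace (EuclideanSpace ℝ (Fin d)) M] in
theorem glue_notMem {F : M → Type*} {U : Set M} {s t : ∀ p : M, F p} {p : M} (h : p ∉ U) :
    glue U s t p = t p := if_neg h

theorem boxdot_glue {x y z : Finset M} (h : IsSplit x y z) (s t : ∀ p : M, V.fiber p) :
    boxdot V h (boxProd V x s) (boxProd V y t) = boxProd V z (glue (x : Set M) s t) :=
  boxdot_boxProd V h s t _ (fun _ hp => glue_mem (Finset.mem_coe.2 hp))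
    fun _ hp => glue_notMem fun h' => Finset.disjoint_right.1 h.disj hp (Finset.mem_coe.1 h')

theorem boxdot_comm {x y z : Finset M} (h : IsSplit x y z) (a : SFiber V x) (b : SFiber V y) :
    boxdot V h a b = boxdot V h.symm b a := by
  induction a using sFiber_induction with
  | add a a' ha ha' => rw [boxdot_add_left, boxdot_add_right, ha, ha']
  | smul c s =>
    induction b using sFiber_induction with
    | add b b' hb hb' => rw [boxdot_add_left, boxdot_add_right, hb, hb']
    | smul c' t =>
      rw [boxdot_smul_left, boxdot_smul_left, boxdot_smul_right, boxdot_smul_right, smul_comm,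
        boxdot_glue]
      congr 2
      exact (boxdot_boxProd V h.symm t s _
        (fun _ hp => glue_notMem fun h' => Finset.disjoint_right.1 h.disj hp (Finset.mem_coe.1 h'))
        fun _ hp => glue_mem (Finset.mem_coe.2 hp)).symm

/-- By multilinearity only decomposable classes matter. Both sides are then `boxProd` of glued
families that agree on `x`, on `y` and on the rest of `w`. -/
theorem boxdot_assoc {x y z xy yz w : Finset M} (h₁ : IsSplit x y xy) (h₂ : IsSplit xy z w)
    (h₃ : IsSplit y z yz) (h₄ : IsSplit x yz w) (a : SFiber V x) (b : SFiber V y)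
    (c : SFiber V z) :
    boxdot V h₂ (boxdot V h₁ a b) c = boxdot V h₄ a (boxdot V h₃ b c) := by
  induction a using sFiber_induction with
  | add a a' ha ha' => simp only [boxdot_add_left, ha, ha']
  | smul r s =>
    induction b using sFiber_induction with
    | add b b' hb hb' => simp only [boxdot_add_left, boxdot_add_right, hb, hb']
    | smul r' t =>
      induction c using sFiber_induction with
      | add c c' hc hc' => simp only [boxdot_add_right, hc, hc']
      | smul r'' q =>
        simp only [boxdot_smul_left, boxdot_smul_right]
        congr 3
        rw [boxdot_glue V h₁, boxdot_glue V h₃, boxdot_glue V h₂, boxdot_glue V h₄]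
        refine boxProd_congr V fun p hp => ?_
        by_cases hx : p ∈ x
        · rw [glue_mem (Finset.mem_coe.2 ((h₁.mem_iff p).2 (Or.inl hx))),
            glue_mem (Finset.mem_coe.2 hx), glue_mem (Finset.mem_coe.2 hx)]
        · by_cases hy : p ∈ y
          · rw [glue_mem (Finset.mem_coe.2 ((h₁.mem_iff p).2 (Or.inr hy))),
              glue_notMem (mt Finset.mem_coe.1 hx), glue_notMem (mt Finset.mem_coe.1 hx),
              glue_mem (Finset.mem_coe.2 hy)]
          · have hxy : p ∉ xy := fun h => ((h₁.mem_iff p).1 h).elim hx hy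
            rw [glue_notMem (mt Finset.mem_coe.1 hxy), glue_notMem (mt Finset.mem_coe.1 hx),
              glue_notMem (mt Finset.mem_coe.1 hy)]

/-- The unit of `⊡`. -/
theorem boxdot_one_left (x : Finset M) (s : ∀ p : M, V.fiber p) (a : SFiber V x) :
    boxdot V (IsSplit.empty_left x) (boxProd V ∅ s) a = a := by
  induction a using sFiber_induction with
  | add a a' ha ha' => rw [boxdot_add_right, ha, ha']
  | smul c t =>
    rw [boxdot_smul_right, boxdot_boxProd V _ s t t (by simp) fun _ _ => rfl]

end SFiber

/-! ## Expansion of products -/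

section Expansion

variable {K : Type} [RCLike K] {d : ℕ} {M : Type u} [TopologicalSpace M]
  [ChartedSpace (EuclideanSpace ℝ (Fin d)) M] (V : BundleData.{u, v} (manifold K d M))

open Classical in
/-- The section that agrees with `f i` on `N i`. -/
def pick {ι : Type*} {F : M → Type*} [∀ q, Zero (F q)] (N : ι → Set M) (f : ι → ∀ q, F q) (q : M) :
    F q :=
  if h : ∃ i, q ∈ N i then f h.choose q else 0

omit [TopologicalSpace M] [ChartedSpace (EuclideanSpace ℝ (Fin d)) M] in
theorem pick_mem {ι : Type*} {F : M → Type*} [∀ q, Zero (F q)] {N : ι → Set M}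
    (hd : Pairwise (Disjoint on N)) (f : ι → ∀ q, F q) {i : ι} {q : M} (hq : q ∈ N i) :
    pick N f q = f i q := by
  have h : ∃ i, q ∈ N i := ⟨i, hq⟩
  have hi : h.choose = i := by
    by_contra hne
    exact Set.disjoint_left.1 (hd hne) h.choose_spec hq
  unfold pick
  rw [dif_pos h, hi]

variable {V}

theorem smoothAt_pick (hV : V.Sheafy) {ι : Type*} {N : ι → Set M} (hN : ∀ i, IsOpen (N i))
    (hd : Pairwise (Disjoint on N)) {f : ι → ∀ q, V.fiber q} {i : ι} {q : M} (hq : q ∈ N i)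
    (hf : V.SmoothAt (f i) q) : V.SmoothAt (pick N f) q :=
  hV.congr hf (((hN i).eventually_mem hq).mono fun _ hy => pick_mem hd f hy)

theorem smoothAt_pick_fun {ι : Type*} {N : ι → Set M} (hN : ∀ i, IsOpen (N i))
    (hd : Pairwise (Disjoint on N)) {f : ι → M → K} {i : ι} {q : M} (hq : q ∈ N i)
    (hf : (manifold K d M).SmoothAt (f i) q) : (manifold K d M).SmoothAt (pick N f) q :=
  (manifold_regular K d M).congr hf
    (((hN i).eventually_mem hq).mono fun _ hy => pick_mem hd f hy)

variable (V) in
/-- Decomposable tensors as a multilinear map in a family indexed by `ι`. -/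
def boxMulti {ι : Type*} {x : Finset M} (τ : ι ≃ x) :
    MultilinearMap K (fun i => V.fiber (τ i).1) (SFiber V x) :=
  (sEquivOf V τ).toLinearMap.compMultilinearMap (PiTensorProduct.tprod K)

theorem boxMulti_apply {ι : Type*} {x : Finset M} (τ : ι ≃ x) (s : ∀ p : M, V.fiber p) :
    boxMulti V τ (fun i => s (τ i).1) = boxProd V x s :=
  sEquivOf_tprod V τ s

theorem eventually_exists_equiv' [T2Space M] {ι : Type*} {x : Finset M} (τ : ι ≃ x)
    {A : ι → Set M} (hA : ∀ i, A i ∈ 𝓝 (τ i).1) :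
    ∀ᶠ y : Finset M in 𝓝 x, ∃ τ' : ι ≃ y, ∀ i, (τ' i).1 ∈ A i := by
  classical
  refine (eventually_exists_equiv x
    (fun p => if h : p ∈ x then A (τ.symm ⟨p, h⟩) else Set.univ) fun p hp => ?_).mono ?_
  · rw [dif_pos hp]
    simpa using hA (τ.symm ⟨p, hp⟩)
  · rintro y ⟨σ, hσ⟩
    refine ⟨τ.trans σ, fun i => ?_⟩
    have := hσ (τ i)
    rw [dif_pos (τ i).2] at this
    simpa using this

/-- If `s` is a combination of sections `g i j` near each point of `x`, then `s x_1 ⊡ ⋯ ⊡ s x_k` is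
a combination of products of the `g i j`. -/
theorem boxProd_expand [T2Space M] {ι : Type*} [Fintype ι] [DecidableEq ι] {N : ι → Set M}
    (hN : ∀ i, IsOpen (N i)) (hd : Pairwise (Disjoint on N)) {x : Finset M} (τ : ι ≃ x)
    (hτ : ∀ i, (τ i).1 ∈ N i) {κ : ι → Type*} (J : ∀ i, Finset (κ i)) (c : ∀ i, κ i → M → K)
    (g : ∀ i, κ i → ∀ q, V.fiber q) {s : ∀ q, V.fiber q}
    (hs : ∀ i, ∀ᶠ q in 𝓝 (τ i).1, s q = ∑ j ∈ J i, c i j q • g i j q) :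
    ∀ᶠ y : Finset M in 𝓝 x, boxProd V y s = ∑ a ∈ Fintype.piFinset J,
      (∏ q ∈ y, pick N (fun i => c i (a i)) q) • boxProd V y (pick N fun i => g i (a i)) := by
  -- A configuration near `x` has exactly one point in each `N i`, and this point may be assumed to
  -- lie where the expansion of `s` holds.
  refine (eventually_exists_equiv' τ
    (A := fun i => N i ∩ {q | s q = ∑ j ∈ J i, c i j q • g i j q}) fun i =>
      inter_mem ((hN i).mem_nhds (hτ i)) (hs i)).mono ?_
  rintro y ⟨σ, hσ⟩
  have h1 : (fun i => s (σ i).1) = fun i => ∑ j ∈ J i, c i j (σ i).1 • g i j (σ i).1 :=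
    funext fun i => (hσ i).2
  -- Multilinear expansion: `a` selects one summand at each point. On `N i`, `pick` returns the
  -- `i`-th selected coefficient or section, which lets the summands be written as global sections.
  rw [← boxMulti_apply σ, h1, MultilinearMap.map_sum_finset]
  refine Finset.sum_congr rfl fun a _ => ?_
  rw [MultilinearMap.map_smul_univ, ← boxMulti_apply σ]
  congr 1
  · refine Eq.trans ?_ (Finset.prod_coe_sort y (pick N fun i => c i (a i)))
    refine Fintype.prod_equiv σ _ _ fun i => ?_
    rw [pick_mem hd _ (hσ i).1]
  · congr 1
    funext i
    rw [pick_mem hd _ (hσ i).1]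

end Expansion

/-! ## The Cauchy symmetric bundle is a commutative `⊠`-algebra bundle -/

section CauchySymBundle

variable {K : Type} [RCLike K] {d : ℕ} {M : Type u} [TopologicalSpace M]
  [ChartedSpace (EuclideanSpace ℝ (Fin d)) M] {V : BundleData.{u, v} (manifold K d M)}

theorem cauchySym_isGenerated : V.cauchySym.IsGenerated fun g x =>
    ∃ s : ∀ p : M, V.fiber p, (∀ p ∈ x, V.SmoothAt s p) ∧ g = fun y => boxProd V y s :=
  fun _ _ => Iff.rfl

variable [T2Space M]

theorem cauchySym_sheafy : V.cauchySym.Sheafy := cauchySym_isGenerated.sheafy (uConf_regular K d M)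

theorem smoothAt_boxProd {s : ∀ p : M, V.fiber p} {x : Finset M} (h : ∀ p ∈ x, V.SmoothAt s p) :
    V.cauchySym.SmoothAt (fun y => boxProd V y s) x :=
  cauchySym_isGenerated.of_gen (uConf_regular K d M) ⟨s, h, rfl⟩

omit [ChartedSpace (EuclideanSpace ℝ (Fin d)) M] in
/-- Disjoint neighbourhoods of the points of a configuration, inside given neighbourhoods. -/
theorem exists_separation (x : Finset M) (A : M → Set M) (hA : ∀ p ∈ x, A p ∈ 𝓝 p) :
    ∃ N : x → Set M, (∀ p, IsOpen (N p)) ∧ Pairwise (Disjoint on N) ∧ (∀ p, p.1 ∈ N p) ∧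
      ∀ p, N p ⊆ A p.1 := by
  obtain ⟨U, hU, hd⟩ := (x.finite_toSet).t2_separation
  refine ⟨fun p => U p.1 ∩ interior (A p.1), fun p => (hU p.1).2.inter isOpen_interior,
    fun p q hpq => ?_, fun p => ⟨(hU p.1).1, mem_interior_iff_mem_nhds.2 (hA p.1 p.2)⟩,
    fun p => Set.inter_subset_right.trans interior_subset⟩
  exact (hd p.2 q.2 fun h => hpq (Subtype.ext h)).mono Set.inter_subset_left Set.inter_subset_left

/-- Local frames of `V` near the points of `x₀`, used on disjoint neighbourhoods, give a frame
indexed by the choices `a` of one frame section per point. It is the tensor product basis in each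
nearby fibre, and `boxProd_expand` supplies the coefficients. -/
theorem cauchySym_isVectorBundle (hV : V.IsVectorBundle) : V.cauchySym.IsVectorBundle := by
  classical
  have hS := hV.sheafy (manifold_regular K d M)
  refine cauchySym_isGenerated.isVectorBundle (uConf_regular K d M) fun x₀ => ?_
  choose κ e he using hV
  obtain ⟨N, hN, hd, hmem, hsub⟩ := exists_separation x₀ _ fun p _ => he p
  refine ⟨∀ p : x₀, κ p.1, fun a y => boxProd V y (pick N fun p => e p.1 (a p)), ?_⟩
  refine (eventually_exists_equiv' (Equiv.refl x₀) fun p => (hN p).mem_nhds (hmem p)).mono ?_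
  rintro y ⟨τ, hτ⟩
  have hgood := fun p => hsub p (hτ p)
  let b : ∀ p : x₀, Module.Basis (κ p.1) K (V.fiber (τ p).1) := fun p =>
    Module.Basis.mk (hgood p).1 (hgood p).2.1.ge
  -- The point `τ p` of `y` lies in `N p`, so there `pick` is the frame section chosen for `p`.
  have hbasis : (fun a : ∀ p : x₀, κ p.1 => boxProd V y (pick N fun p => e p.1 (a p))) =
      ((Basis.piTensorProduct b).map (sEquivOf V τ)) := by
    funext a
    rw [Module.Basis.map_apply, Basis.piTensorProduct_apply, ← sEquivOf_tprod V τ]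
    congr 2
    funext p
    rw [pick_mem hd _ (hτ p), Module.Basis.mk_apply]
  refine ⟨?_, ?_, fun a => ?_, ?_⟩
  · exact hbasis ▸ Module.Basis.linearIndependent _
  · exact hbasis ▸ Module.Basis.span_eq _
  · refine smoothAt_boxProd fun q hq => ?_
    obtain ⟨p, hp⟩ := τ.surjective ⟨q, hq⟩
    obtain rfl : (τ p).1 = q := congrArg Subtype.val hp
    refine smoothAt_pick hS hN hd (hτ p) (((hgood p).2.2 _).2 ?_)
    refine ⟨{a p}, fun _ _ => 1, fun _ _ => (manifold_regular K d M).const 1 _, ?_⟩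
    exact Eventually.of_forall fun z => by simp
  · rintro _ ⟨s, hs, rfl⟩
    choose J c hc hJ using fun p => ((hgood p).2.2 s).1 (hs _ (τ p).2)
    refine ⟨Fintype.piFinset J, fun a z => ∏ q ∈ z, pick N (fun p => c p (a p)) q, fun a ha => ?_,
      boxProd_expand hN hd τ hτ J c (fun p j => e p.1 j) hJ⟩
    refine smoothAt_prod_mem fun q hq => ?_
    obtain ⟨p, hp⟩ := τ.surjective ⟨q, hq⟩
    obtain rfl : (τ p).1 = q := congrArg Subtype.val hp
    exact smoothAt_pick_fun hN hd (hτ p) (hc p _ (Fintype.mem_piFinset.1 ha p))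

omit [T2Space M] in
theorem smoothAt_glue (hV : V.Sheafy) {x : Finset M} {U U' : Set M} (hU : IsOpen U)
    (hU' : IsOpen U') (hd : Disjoint U U') (hx : ∀ p ∈ x, p ∈ U ∪ U') {s t : ∀ p : M, V.fiber p}
    (hs : ∀ p ∈ restrict x U, V.SmoothAt s p) (ht : ∀ p ∈ restrict x U', V.SmoothAt t p) :
    ∀ p ∈ x, V.SmoothAt (glue U s t) p := by
  intro p hp
  rcases hx p hp with h | h
  · exact hV.congr (hs p (mem_restrict.2 ⟨hp, h⟩))
      ((hU.eventually_mem h).mono fun _ hy => glue_mem hy)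
  · exact hV.congr (ht p (mem_restrict.2 ⟨hp, h⟩))
      ((hU'.eventually_mem h).mono fun _ hy =>
        glue_notMem (Set.disjoint_right.1 hd hy))

/-- The product of `⊡ s` over `y ∩ U` and `⊡ t` over `y ∩ U'` is `⊡` of the section equal to `s` on
`U` and to `t` on `U'`, which is smooth near `x` because `U` and `U'` are open. -/
theorem boxdot_smoothBilin (hV : V.Sheafy) : SmoothBilin (boxdotLinear V) := by
  refine smoothBilin_of_generators (fun s x => (cauchySym_isGenerated s x).1)
    (fun s x => (cauchySym_isGenerated s x).1) cauchySym_sheafy _ ?_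
  rintro x U U' _ _ hU hU' hd hx ⟨s, hs, rfl⟩ ⟨t, ht, rfl⟩
  refine ⟨_, smoothAt_boxProd (smoothAt_glue hV hU hU' hd hx hs ht),
    Eventually.of_forall fun y h => ?_⟩
  exact (boxdot_boxProd V h s t _ (fun p hp => glue_mem (mem_restrict.1 hp).2)
    fun p hp => glue_notMem (Set.disjoint_right.1 hd (mem_restrict.1 hp).2)).symm

omit [T2Space M] in
theorem eventually_empty [T2Space M] : ∀ᶠ y : Finset M in 𝓝 ∅, y = ∅ :=
  (eventually_card_eq (∅ : Finset M)).mono fun y hy => by simpa using hy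

open Classical in
/-- The bundle map from the unit of the Cauchy tensor product given by a vector over `∅`. -/
def unitHom (A : BundleData.{u, w} (UConf K d M)) (hA : A.Sheafy) (e : ∀ x, A.fiber x)
    (he : A.SmoothAt e (∅ : Finset M)) : Hom (cauchyUnit K d M) A where
  app x := if h : x = (∅ : Finset M) then
    (LinearMap.proj (⟨(), h⟩ : {_a : Unit // x = (∅ : Finset M)})).smulRight (e x) else 0
  smooth s x _ := by
    by_cases hx : x = (∅ : Finset M)
    · subst hx
      refine hA.congr (hA.smul ((uConf_regular K d M).const (s (∅ : Finset M) ⟨(), rfl⟩) _) he) ?_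
      refine eventually_empty.mono ?_
      rintro y rfl
      rw [dif_pos rfl]
      rfl
    · refine hA.congr (hA.zero x) ?_
      refine (eventually_card_eq x).mono fun y hy => ?_
      have hy' : y ≠ (∅ : Finset M) := by
        rintro rfl
        exact hx (Finset.card_eq_zero.1 hy.symm)
      rw [dif_neg hy']
      rfl

theorem unitHom_app (A : BundleData.{u, w} (UConf K d M)) (hA : A.Sheafy) (e : ∀ x, A.fiber x)
    (he : A.SmoothAt e (∅ : Finset M)) (c : (cauchyUnit K d M).fiber (∅ : Finset M)) :
    (unitHom A hA e he).app (∅ : Finset M) c = c ⟨(), rfl⟩ • e (∅ : Finset M) := by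
  unfold unitHom
  simp only [dif_pos]
  rfl

variable (V) in
/-- The product of the Cauchy symmetric bundle. -/
def boxdotHom (hV : V.Sheafy) : Hom (V.cauchySym.cauchy V.cauchySym) V.cauchySym :=
  cauchyHom (boxdotLinear V) (boxdot_smoothBilin hV) cauchySym_sheafy

theorem boxdotHom_on (hV : V.Sheafy) {x y z : Finset M} (h : IsSplit x y z) (a : SFiber V x)
    (b : SFiber V y) : (boxdotHom V hV).on h a b = boxdot V h a b :=
  (cauchyHom_on (boxdotLinear V) (boxdot_smoothBilin hV) cauchySym_sheafy h a b).trans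
    (boxdotLinear_apply V h a b)

variable (V) in
/-- The unit of the Cauchy symmetric bundle. -/
def boxUnit : Hom (cauchyUnit K d M) V.cauchySym :=
  unitHom V.cauchySym cauchySym_sheafy (fun x => boxProd V x 0) (smoothAt_boxProd (by simp))

theorem boxUnit_app (c : (cauchyUnit K d M).fiber (∅ : Finset M)) :
    (boxUnit V).app (∅ : Finset M) c = c ⟨(), rfl⟩ • boxProd V ∅ 0 :=
  unitHom_app _ _ _ _ c

/-- The Cauchy symmetric bundle as a commutative `⊠`-algebra bundle. -/
def cauchySymAlgebra (hV : V.IsVectorBundle) : CommCauchyAlgebra V.cauchySym where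
  isVectorBundle := cauchySym_isVectorBundle hV
  mul := boxdotHom V (hV.sheafy (manifold_regular K d M))
  unit := boxUnit V
  mul_assoc h₁ h₂ h₃ h₄ a b c := by
    simp only [boxdotHom_on]
    exact boxdot_assoc V h₁ h₂ h₃ h₄ a b c
  one_mul x a := by
    rw [boxdotHom_on, boxUnit_app, one_smul]
    exact boxdot_one_left V x _ a
  mul_one x a := by
    rw [boxdotHom_on, boxUnit_app, one_smul, boxdot_comm]
    exact boxdot_one_left V x _ a
  mul_comm h a b := by
    rw [boxdotHom_on, boxdotHom_on]
    exact boxdot_comm V h a b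

end CauchySymBundle

/-! ## Symmetric algebra bundles and Hadamard tensor products -/

section SymBundle

variable {K : Type} [RCLike K] {X : SmoothSpace.{u} K} {E : BundleData.{u, v} X}

/-- A section generated by a frame is a finite combination of the frame. -/
theorem exists_combination_of_generated (hX : X.Regular) {F : X.carrier → Type w}
    [∀ x, AddCommGroup (F x)] [∀ x, Module K (F x)] {ι : Type*} {e : ι → ∀ x, F x} {s : ∀ x, F x}
    {x : X.carrier} (h : GeneratedSmoothAt (fun g _ => ∃ i, g = e i) s x) :
    ∃ (J : Finset ι) (c : ι → X.carrier → K), (∀ i ∈ J, X.SmoothAt (c i) x) ∧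
      ∀ᶠ y in 𝓝 x, s y = ∑ i ∈ J, c i y • e i y := by
  classical
  obtain ⟨n, c, g, hcg, hs⟩ := h
  choose f hf using fun i => (hcg i).2
  refine ⟨Finset.univ.image f, fun i y => ∑ k with f k = i, c k y,
    fun i _ => hX.sum _ fun k _ => (hcg k).1, hs.mono fun y hy => ?_⟩
  rw [hy]
  simp only [Finset.sum_smul]
  rw [← Finset.sum_fiberwise_of_maps_to (g := f) (t := Finset.univ.image f)
    fun k _ => Finset.mem_image_of_mem f (Finset.mem_univ k)]
  refine Finset.sum_congr rfl fun i _ => Finset.sum_congr rfl fun k hk => ?_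
  rw [hf k, (Finset.mem_filter.1 hk).2]

theorem generated_mul (hX : X.Regular)
    {G : (∀ x, SymmetricAlgebra K (E.fiber x)) → X.carrier → Prop}
    (hG : ∀ {g g' x}, G g x → G g' x → G (fun y => g y * g' y) x)
    {s t : ∀ x, SymmetricAlgebra K (E.fiber x)} {x : X.carrier}
    (hs : GeneratedSmoothAt (X := X) G s x) (ht : GeneratedSmoothAt (X := X) G t x) :
    GeneratedSmoothAt (X := X) G (fun y => s y * t y) x := by
  obtain ⟨n, c, g, h, he⟩ := hs
  obtain ⟨m, c', g', h', he'⟩ := ht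
  refine ⟨n * m, fun k y => c (finProdFinEquiv.symm k).1 y * c' (finProdFinEquiv.symm k).2 y,
    fun k y => g (finProdFinEquiv.symm k).1 y * g' (finProdFinEquiv.symm k).2 y,
    fun k => ⟨hX.mul (h _).1 (h' _).1, hG (h _).2 (h' _).2⟩, ?_⟩
  filter_upwards [he, he'] with y hy hy'
  rw [hy, hy', finProdFinEquiv.symm.sum_comp fun k => (c k.1 y * c' k.2 y) • (g k.1 y * g' k.2 y),
    Fintype.sum_prod_type, Finset.sum_mul_sum]
  simp only [smul_mul_smul_comm]

theorem sym_isGenerated : E.sym.IsGenerated fun g x =>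
    ∃ (m : ℕ) (t : Fin m → ∀ y, E.fiber y), (∀ j, E.SmoothAt (t j) x) ∧
      g = fun y => ∏ j, SymmetricAlgebra.ι K (E.fiber y) (t j y) := fun _ _ => Iff.rfl

theorem sym_smoothAt_mul (hX : X.Regular) {s t : ∀ x, SymmetricAlgebra K (E.fiber x)}
    {x : X.carrier} (hs : E.sym.SmoothAt s x) (ht : E.sym.SmoothAt t x) :
    E.sym.SmoothAt (fun y => s y * t y) x := by
  refine (sym_isGenerated _ _).2
    (generated_mul hX ?_ ((sym_isGenerated _ _).1 hs) ((sym_isGenerated _ _).1 ht))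
  rintro _ _ x ⟨m, t, ht, rfl⟩ ⟨m', t', ht', rfl⟩
  refine ⟨m + m', Fin.append t t', fun j => ?_, ?_⟩
  · refine Fin.addCases (fun i => ?_) (fun i => ?_) j
    · simpa using ht i
    · simpa using ht' i
  · funext y
    rw [Fin.prod_univ_add]
    simp

theorem sym_smoothAt_one (hX : X.Regular) (x : X.carrier) :
    E.sym.SmoothAt (fun y => (1 : SymmetricAlgebra K (E.fiber y))) x :=
  sym_isGenerated.of_gen hX ⟨0, fun _ _ => 0, fun j => j.elim0, by simp⟩

theorem sym_smoothAt_ι (hX : X.Regular) {t : ∀ x, E.fiber x} {x : X.carrier}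
    (ht : E.SmoothAt t x) :
    E.sym.SmoothAt (fun y => SymmetricAlgebra.ι K (E.fiber y) (t y)) x :=
  sym_isGenerated.of_gen hX ⟨1, fun _ => t, fun _ => ht, by simp⟩

theorem sym_smoothAt_prod (hX : X.Regular) {ι : Type*} (J : Finset ι)
    {s : ι → ∀ x, SymmetricAlgebra K (E.fiber x)} {x : X.carrier}
    (hs : ∀ i ∈ J, E.sym.SmoothAt (s i) x) : E.sym.SmoothAt (fun y => ∏ i ∈ J, s i y) x := by
  classical
  induction J using Finset.induction_on with
  | empty => simpa using sym_smoothAt_one hX x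
  | insert i J hi ih =>
    simp only [Finset.prod_insert hi]
    exact sym_smoothAt_mul hX (hs i (Finset.mem_insert_self i J))
      (ih fun j hj => hs j (Finset.mem_insert_of_mem hj))

theorem sym_smoothAt_pow (hX : X.Regular) {s : ∀ x, SymmetricAlgebra K (E.fiber x)}
    {x : X.carrier} (hs : E.sym.SmoothAt s x) (n : ℕ) : E.sym.SmoothAt (fun y => s y ^ n) x := by
  simpa using sym_smoothAt_prod hX (Finset.range n) fun _ _ => hs

theorem symmetricAlgebra_basis_apply {R N κ : Type*} [CommRing R] [AddCommGroup N] [Module R N]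
    (b : Module.Basis κ R N) (m : κ →₀ ℕ) :
    b.symmetricAlgebra m = m.prod fun i n => SymmetricAlgebra.ι R N (b i) ^ n := by
  simp [Module.Basis.symmetricAlgebra, MvPolynomial.monomial_eq, map_finsuppProd]

/-- The monomials in a local frame of `E`, indexed by finitely supported exponents, form a frame. -/
theorem sym_isVectorBundle (hX : X.Regular) (hE : E.IsVectorBundle) : E.sym.IsVectorBundle := by
  refine sym_isGenerated.isVectorBundle hX fun x₀ => ?_
  obtain ⟨ι, e, he⟩ := hE x₀
  let e' : (ι →₀ ℕ) → ∀ x, SymmetricAlgebra K (E.fiber x) := fun m x =>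
    m.prod fun i n => SymmetricAlgebra.ι K (E.fiber x) (e i x) ^ n
  refine ⟨ι →₀ ℕ, e', he.mono ?_⟩
  rintro y ⟨h1, h2, h3⟩
  let b : Module.Basis ι K (E.fiber y) := Module.Basis.mk h1 h2.ge
  have hb : (fun m => e' m y) = b.symmetricAlgebra := by
    funext m
    rw [symmetricAlgebra_basis_apply]
    simp only [e', b, Module.Basis.mk_apply]
  have hsm : ∀ i, E.SmoothAt (e i) y := fun i =>
    (h3 _).2 ⟨{i}, fun _ _ => 1, fun _ _ => hX.const 1 _, Eventually.of_forall fun z => by simp⟩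
  refine ⟨hb ▸ b.symmetricAlgebra.linearIndependent, hb ▸ b.symmetricAlgebra.span_eq,
    fun m => ?_, ?_⟩
  · exact sym_smoothAt_prod hX m.support fun i _ =>
      sym_smoothAt_pow hX (sym_smoothAt_ι hX (hsm i)) (m i)
  · rintro _ ⟨m, t, ht, rfl⟩
    refine exists_combination_of_generated hX ?_
    -- Combinations of monomials are closed under products, since exponents add. They contain `1`
    -- and all `ι (t j)`, hence every generating section.
    have hmul : ∀ {s t : ∀ x, SymmetricAlgebra K (E.fiber x)},
        GeneratedSmoothAt (X := X) (fun g _ => ∃ i, g = e' i) s y →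
        GeneratedSmoothAt (X := X) (fun g _ => ∃ i, g = e' i) t y →
        GeneratedSmoothAt (X := X) (fun g _ => ∃ i, g = e' i) (fun y => s y * t y) y := by
      refine generated_mul hX ?_
      rintro _ _ x ⟨i, rfl⟩ ⟨j, rfl⟩
      refine ⟨i + j, funext fun z => (Finsupp.prod_add_index' (by simp) ?_).symm⟩
      exact fun i n m => pow_add _ n m
    have hone : GeneratedSmoothAt (X := X) (fun g _ => ∃ i, g = e' i)
        (fun z => (1 : SymmetricAlgebra K (E.fiber z))) y :=
      generated_of_gen hX ⟨0, funext fun z => by simp [e']⟩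
    have hι : ∀ j, GeneratedSmoothAt (X := X) (fun g _ => ∃ i, g = e' i)
        (fun z => SymmetricAlgebra.ι K (E.fiber z) (t j z)) y := by
      intro j
      obtain ⟨J, c, hc, hev⟩ := (h3 _).1 (ht j)
      have hsum : ∀ J : Finset ι, (∀ i ∈ J, X.SmoothAt (c i) y) →
          GeneratedSmoothAt (X := X) (fun g _ => ∃ i, g = e' i)
          (fun z => ∑ i ∈ J, c i z • SymmetricAlgebra.ι K (E.fiber z) (e i z)) y := by
        intro J
        classical
        induction J using Finset.induction_on with
        | empty => intro _; simpa using generated_zero y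
        | insert i J hi ih =>
          intro hJ
          simp only [Finset.sum_insert hi]
          refine generated_add (generated_smul hX (hJ i (Finset.mem_insert_self i J))
            (generated_of_gen hX ⟨Finsupp.single i 1, funext fun z => by simp [e']⟩))
            (ih fun k hk => hJ k (Finset.mem_insert_of_mem hk))
      refine generated_congr (hsum J hc) (hev.mono fun z hz => ?_)
      simp only [hz, map_sum, map_smul]
    have hprod : ∀ J : Finset (Fin m), GeneratedSmoothAt (X := X) (fun g _ => ∃ i, g = e' i)
        (fun z => ∏ j ∈ J, SymmetricAlgebra.ι K (E.fiber z) (t j z)) y := by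
      intro J
      classical
      induction J using Finset.induction_on with
      | empty => simpa using hone
      | insert i J hi ih =>
        simp only [Finset.prod_insert hi]
        exact hmul (hι i) ih
    exact hprod Finset.univ

/-! ### Hadamard tensor products of vector bundles -/

variable {F : BundleData.{u, w} X}

theorem hadamard_isGenerated : (E.hadamard F).IsGenerated fun g x =>
    ∃ (s : ∀ y, E.fiber y) (t : ∀ y, F.fiber y), E.SmoothAt s x ∧ F.SmoothAt t x ∧
      g = fun y => s y ⊗ₜ[K] t y := fun _ _ => Iff.rfl

theorem smoothAt_tmul (hX : X.Regular) {s : ∀ y, E.fiber y} {t : ∀ y, F.fiber y} {x : X.carrier}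
    (hs : E.SmoothAt s x) (ht : F.SmoothAt t x) :
    (E.hadamard F).SmoothAt (fun y => s y ⊗ₜ[K] t y) x :=
  hadamard_isGenerated.of_gen hX ⟨s, t, hs, ht, rfl⟩

theorem hadamard_isVectorBundle (hX : X.Regular) (hE : E.IsVectorBundle) (hF : F.IsVectorBundle) :
    (E.hadamard F).IsVectorBundle := by
  refine hadamard_isGenerated.isVectorBundle hX fun x₀ => ?_
  obtain ⟨ι, e, he⟩ := hE x₀
  obtain ⟨κ, f, hf⟩ := hF x₀
  refine ⟨ι × κ, fun i y => e i.1 y ⊗ₜ[K] f i.2 y, (he.and hf).mono ?_⟩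
  rintro y ⟨⟨h1, h2, h3⟩, h1', h2', h3'⟩
  have hb : (fun i : ι × κ => e i.1 y ⊗ₜ[K] f i.2 y) =
      (Module.Basis.mk h1 h2.ge).tensorProduct (Module.Basis.mk h1' h2'.ge) := by
    funext i
    refine Eq.symm ((Module.Basis.tensorProduct_apply _ _ i.1 i.2).trans ?_)
    rw [Module.Basis.mk_apply, Module.Basis.mk_apply]
  refine ⟨hb ▸ Module.Basis.linearIndependent _, hb ▸ Module.Basis.span_eq _,
    fun i => smoothAt_tmul hX ?_ ?_, ?_⟩
  · exact (h3 _).2 ⟨{i.1}, fun _ _ => 1, fun _ _ => hX.const 1 _,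
      Eventually.of_forall fun z => by simp⟩
  · exact (h3' _).2 ⟨{i.2}, fun _ _ => 1, fun _ _ => hX.const 1 _,
      Eventually.of_forall fun z => by simp⟩
  · rintro _ ⟨s, t, hs, ht, rfl⟩
    obtain ⟨J, c, hc, hs⟩ := (h3 _).1 hs
    obtain ⟨J', c', hc', ht⟩ := (h3' _).1 ht
    refine ⟨J ×ˢ J', fun i z => c i.1 z * c' i.2 z, fun i hi => ?_, ?_⟩
    · exact hX.mul (hc _ (Finset.mem_product.1 hi).1) (hc' _ (Finset.mem_product.1 hi).2)
    · filter_upwards [hs, ht] with z hz hz'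
      rw [hz, hz', TensorProduct.sum_tmul, Finset.sum_product]
      refine Finset.sum_congr rfl fun i _ => ?_
      rw [TensorProduct.tmul_sum]
      refine Finset.sum_congr rfl fun j _ => ?_
      rw [TensorProduct.smul_tmul_smul]

end SymBundle

/-! ## The bracket on the fibres of `S^⊠ S^⊗ V` -/

section FiberAlgebra

variable {K : Type} [RCLike K] {d : ℕ} {M : Type u} [TopologicalSpace M]
  [ChartedSpace (EuclideanSpace ℝ (Fin d)) M] (V : BundleData.{u, v} (manifold K d M))

/-- The fibre of `S^⊠ S^⊗ V` over `x` as an algebra. -/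
abbrev FiberAlg (x : Finset M) : Type _ := SymTensor K fun p : x => V.fiber p.1

/-- The identification of the fibre of `S^⊠ S^⊗ V` with an algebra. -/
def toAlg (x : Finset M) : SFiber V.sym x ≃ₗ[K] FiberAlg V x :=
  (sEquiv V.sym x).trans (symTensorEquiv K fun p : x => V.fiber p.1)

theorem toAlg_boxProd (x : Finset M) (s : ∀ p : M, SymmetricAlgebra K (V.fiber p)) :
    toAlg V x (boxProd V.sym x s) = symTprod K fun p : x => s p.1 :=
  congrArg (symTensorEquiv K fun p : x => V.fiber p.1) (sEquiv_boxProd V.sym x s)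

theorem toAlg_oneAt (x : Finset M) : toAlg V x (oneAt V x) = 1 :=
  (toAlg_boxProd V x _).trans symTprod_one

/-- The product `⊙` as a bilinear map. -/
def odotLinear (x : Finset M) : SFiber V.sym x →ₗ[K] SFiber V.sym x →ₗ[K] SFiber V.sym x :=
  ((PiTensorProduct.map₂ fun p : x => LinearMap.mul K (SymmetricAlgebra K (V.fiber p.1))).compr₂
    (sEquiv V.sym x).symm.toLinearMap).compl₁₂ (sEquiv V.sym x).toLinearMap
      (sEquiv V.sym x).toLinearMap

theorem odotLinear_apply {x : Finset M} (a b : SFiber V.sym x) :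
    odotLinear V x a b = odot V a b := rfl

theorem toAlg_odot {x : Finset M} (a b : SFiber V.sym x) :
    toAlg V x (odot V a b) = toAlg V x a * toAlg V x b := by
  rw [← odotLinear_apply]
  induction a using sFiber_induction with
  | add a a' ha ha' => rw [map_add, LinearMap.add_apply, map_add, map_add, ha, ha', add_mul]
  | smul c s =>
    induction b using sFiber_induction with
    | add b b' hb hb' => rw [map_add, map_add, map_add, hb, hb', mul_add]
    | smul c' t =>
      rw [map_smul, LinearMap.map_smul₂, map_smul, map_smul, map_smul, map_smul,
        odotLinear_apply, odot_boxProd, toAlg_boxProd, toAlg_boxProd, toAlg_boxProd,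
        smul_mul_smul_comm, symTprod_mul, smul_smul, mul_comm]
      rfl

open scoped Classical

/-- The inclusion of algebras for an inclusion of configurations. -/
def incl {x z : Finset M} (h : x ⊆ z) : FiberAlg V x →ₐ[K] FiberAlg V z :=
  symLift fun p : x => (symSingle K (fun p : z => V.fiber p.1) ⟨p.1, h p.2⟩).toLinearMap ∘ₗ
    SymmetricAlgebra.ι K (V.fiber p.1)

theorem incl_tprod {x z : Finset M} (h : x ⊆ z) (s : ∀ p : x, SymmetricAlgebra K (V.fiber p.1)) :
    incl V h (symTprod K s) =
      ∏ p : x, symSingle K (fun p : z => V.fiber p.1) ⟨p.1, h p.2⟩ (s p) := by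
  refine (symLift_tprod _ s).trans (Finset.prod_congr rfl fun p _ => ?_)
  have : SymmetricAlgebra.lift ((symSingle K (fun p : z => V.fiber p.1) ⟨p.1, h p.2⟩).toLinearMap ∘ₗ
      SymmetricAlgebra.ι K (V.fiber p.1)) =
      symSingle K (fun p : z => V.fiber p.1) ⟨p.1, h p.2⟩ :=
    SymmetricAlgebra.algHom_ext (LinearMap.ext fun u => by simp)
  rw [this]

theorem incl_single {x z : Finset M} (h : x ⊆ z) (p : x) (s : SymmetricAlgebra K (V.fiber p.1)) :
    incl V h (symSingle K (fun p : x => V.fiber p.1) p s) =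
      symSingle K (fun p : z => V.fiber p.1) ⟨p.1, h p.2⟩ s := by
  rw [symSingle_apply, incl_tprod, Finset.prod_eq_single p]
  · rw [Pi.mulSingle_eq_same]
  · intro q _ hq
    rw [Pi.mulSingle_eq_of_ne hq, map_one]
  · simp

theorem incl_incl {x y z : Finset M} (h : x ⊆ y) (h' : y ⊆ z) (a : FiberAlg V x) :
    incl V h' (incl V h a) = incl V (h.trans h') a := by
  have : (incl V h').comp (incl V h) = incl V (h.trans h') :=
    symTensor_algHom_ext fun p u => by
      rw [AlgHom.comp_apply]
      exact (congrArg (incl V h') (incl_single V h p _)).trans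
        ((incl_single V h' ⟨p.1, h p.2⟩ _).trans (incl_single V (h.trans h') p _).symm)
  exact DFunLike.congr_fun this a

theorem IsSplit.left_subset {M : Type*} {x y z : Finset M} (h : IsSplit x y z) : x ⊆ z :=
  fun p hp => (h.mem_iff p).2 (Or.inl hp)

theorem IsSplit.right_subset {M : Type*} {x y z : Finset M} (h : IsSplit x y z) : y ⊆ z :=
  fun p hp => (h.mem_iff p).2 (Or.inr hp)

/-- This makes `⊡` an ordinary product in the algebra over `z`. On decomposable classes it is the
splitting of a product over `z` into products over `x` and over `y`. -/
theorem toAlg_boxdot {x y z : Finset M} (h : IsSplit x y z) (a : SFiber V.sym x)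
    (b : SFiber V.sym y) : toAlg V z (boxdot V.sym h a b) =
      incl V h.left_subset (toAlg V x a) * incl V h.right_subset (toAlg V y b) := by
  induction a using sFiber_induction with
  | add a a' ha ha' => rw [boxdot_add_left, map_add, map_add, map_add, ha, ha', add_mul]
  | smul c s =>
    induction b using sFiber_induction with
    | add b b' hb hb' => rw [boxdot_add_right, map_add, map_add, map_add, hb, hb', mul_add]
    | smul c' t =>
      rw [boxdot_smul_left, boxdot_smul_right]
      simp only [map_smul]
      rw [smul_mul_smul_comm, ← smul_smul]
      congr 2
      rw [boxdot_glue V.sym h, toAlg_boxProd, toAlg_boxProd, toAlg_boxProd, incl_tprod, incl_tprod,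
        symTprod_eq_prod_single, ← h.sumEquiv.prod_comp, Fintype.prod_sum_type]
      congr 1
      · refine Finset.prod_congr rfl fun p _ => ?_
        exact congrArg _ (glue_mem (Finset.mem_coe.2 p.2))
      · refine Finset.prod_congr rfl fun p _ => ?_
        exact congrArg _ (glue_notMem fun h' =>
          Finset.disjoint_right.1 h.disj p.2 (Finset.mem_coe.1 h'))

omit [TopologicalSpace M] in
theorem isSplit_erase {x : Finset M} {p : M} (hp : p ∈ x) : IsSplit {p} (x.erase p) x :=
  ⟨by simp, fun q => by
    by_cases h : q = p
    · simp [h, hp]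
    · simp [h]⟩

theorem incl_genAt (u : ∀ p : M, V.fiber p) {p : M} {z : Finset M} (hp : p ∈ z)
    (h : {p} ⊆ z) : incl V h (toAlg V {p} (genAt V u p)) =
      symSingle K (fun p : z => V.fiber p.1) ⟨p, hp⟩ (SymmetricAlgebra.ι K (V.fiber p) (u p)) := by
  have : toAlg V {p} (genAt V u p) =
      symTprod K fun q : ({p} : Finset M) => SymmetricAlgebra.ι K (V.fiber q.1) (u q.1) :=
    toAlg_boxProd V {p} _
  rw [this, incl_tprod]
  have huniv : (Finset.univ : Finset ({p} : Finset M)) = {⟨p, Finset.mem_singleton_self p⟩} := by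
    ext q
    simp [Subtype.ext_iff]
  rw [huniv, Finset.prod_singleton]

/-- The fibres of `S^⊠ S^⊗ V` are generated under `⊙` by the vectors `u p ⊡ 1`. -/
theorem symFiber_induction {x : Finset M} {P : SFiber V.sym x → Prop}
    (smul : ∀ (c : K) a, P a → P (c • a)) (one : P (oneAt V x))
    (add : ∀ a b, P a → P b → P (a + b)) (odot : ∀ a b, P a → P b → P (odot V a b))
    (gen : ∀ {p : M} {x' : Finset M} (h : IsSplit {p} x' x) (u : ∀ p : M, V.fiber p),
      P (boxdot V.sym h (genAt V u p) (oneAt V x'))) (a : SFiber V.sym x) : P a := by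
  have key : ∀ b : FiberAlg V x, P ((toAlg V x).symm b) := by
    intro b
    induction b using symTensor_induction with
    | hc c =>
      rw [Algebra.algebraMap_eq_smul_one, map_smul, ← toAlg_oneAt, LinearEquiv.symm_apply_apply]
      exact smul c _ one
    | add a b ha hb => rw [map_add]; exact add _ _ ha hb
    | mul a b ha hb =>
      have := odot _ _ ha hb
      rwa [(LinearEquiv.eq_symm_apply _).2 (toAlg_odot V _ _), LinearEquiv.apply_symm_apply,
        LinearEquiv.apply_symm_apply] at this
    | single p u =>
      -- The vector `u` is extended to a section by zero; only its value at `p` enters.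
      have := gen (isSplit_erase p.2) fun q => if h : q = p.1 then h ▸ u else 0
      rw [(LinearEquiv.eq_symm_apply _).2 (toAlg_boxdot V _ _ _), toAlg_oneAt, map_one, mul_one,
        incl_genAt V _ p.2] at this
      simpa using this
  simpa using key (toAlg V x a)

end FiberAlgebra

/-! ### The Poisson bracket of a kernel on the fibres -/

section KernelBracket

variable {K : Type} [RCLike K] {d : ℕ} {M : Type u} [TopologicalSpace M]
  [ChartedSpace (EuclideanSpace ℝ (Fin d)) M] {V : BundleData.{u, v} (manifold K d M)}
  (k : Kernel V)

open scoped Classical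

variable (V) in
/-- The inclusion of `V p` in the fibre of `i_* V` over `{p}`. -/
def pushLinear (p : M) : V.fiber p →ₗ[K] V.push.fiber ({p} : Finset M) where
  toFun u q := Finset.singleton_injective q.2 ▸ u
  map_add' u v := by
    funext ⟨q, hq⟩
    obtain rfl := Finset.singleton_injective hq
    rfl
  map_smul' c u := by
    funext ⟨q, hq⟩
    obtain rfl := Finset.singleton_injective hq
    rfl

theorem pushLinear_apply (u : ∀ p : M, V.fiber p) (p : M) :
    pushLinear V p (u p) = V.pushVec u p := by
  funext ⟨q, hq⟩
  obtain rfl := Finset.singleton_injective hq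
  rfl

omit [TopologicalSpace M] in
theorem isSplit_pair {p q : M} (h : p ≠ q) : IsSplit {p} {q} {p, q} :=
  ⟨by simpa using h, by simp⟩

omit [TopologicalSpace M] in
theorem IsSplit.eq {x y z z' : Finset M} (h : IsSplit x y z) (h' : IsSplit x y z') : z = z' := by
  ext p
  rw [h.mem_iff, h'.mem_iff]

omit [TopologicalSpace M] in
theorem IsSplit.ne {p q : M} {z : Finset M} (h : IsSplit {p} {q} z) : p ≠ q := by
  simpa using h.disj

/-- The kernel on vectors over points. -/
def Kernel.pt (p q : M) : V.fiber p →ₗ[K] V.fiber q →ₗ[K] K :=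
  if h : p ≠ q then
    LinearMap.compl₁₂ (k.onLinear (isSplit_pair h) :
      V.push.fiber ({p} : Finset M) →ₗ[K] V.push.fiber ({q} : Finset M) →ₗ[K] K)
      (pushLinear V p) (pushLinear V q)
  -- The kernel says nothing about two vectors over one point. The value `0` keeps the form
  -- antisymmetric, and it never enters a bracket over disjoint configurations.
  else 0

theorem Kernel.pt_eq {p q : M} {z : Finset M} (h : IsSplit {p} {q} z) (u v : ∀ p : M, V.fiber p) :
    k.pt p q (u p) (v q) = k.on h (V.pushVec u p) (V.pushVec v q) := by
  obtain rfl := (isSplit_pair h.ne).eq h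
  unfold Kernel.pt
  rw [dif_pos h.ne, LinearMap.compl₁₂_apply, pushLinear_apply, pushLinear_apply]
  rfl

theorem exists_section (p : M) (u : V.fiber p) : ∃ s : ∀ p : M, V.fiber p, s p = u :=
  ⟨fun q => if h : q = p then h ▸ u else 0, by simp⟩

theorem Kernel.pt_antisymm (hk : k.IsAntisymm) (p q : M) (u : V.fiber p) (v : V.fiber q) :
    k.pt p q u v = -k.pt q p v u := by
  by_cases h : p = q
  · unfold Kernel.pt
    rw [dif_neg (not_not.2 h), dif_neg (not_not.2 h.symm)]
    simp
  · obtain ⟨s, rfl⟩ := exists_section p u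
    obtain ⟨t, rfl⟩ := exists_section q v
    rw [k.pt_eq (isSplit_pair h), k.pt_eq (isSplit_pair h).symm]
    exact hk _ _ _

/-- The bilinear form on the generators over a configuration. -/
def Kernel.form (x : Finset M) :
    (∀ p : x, V.fiber p.1) →ₗ[K] (∀ p : x, V.fiber p.1) →ₗ[K] K :=
  ∑ p : x, ∑ q : x, (k.pt p.1 q.1).compl₁₂ (LinearMap.proj p) (LinearMap.proj q)

theorem Kernel.form_apply (x : Finset M) (u v : ∀ p : x, V.fiber p.1) :
    k.form x u v = ∑ p : x, ∑ q : x, k.pt p.1 q.1 (u p) (v q) := by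
  simp [Kernel.form, LinearMap.sum_apply]

theorem Kernel.form_single (x : Finset M) (p q : x) (u : V.fiber p.1) (v : V.fiber q.1) :
    k.form x (Pi.single p u) (Pi.single q v) = k.pt p.1 q.1 u v := by
  rw [Kernel.form_apply, Finset.sum_eq_single p, Finset.sum_eq_single q]
  · simp
  · intro r _ hr
    simp [hr]
  · simp
  · intro r _ hr
    simp [hr]
  · simp

theorem Kernel.form_antisymm (hk : k.IsAntisymm) (x : Finset M) (u v : ∀ p : x, V.fiber p.1) :
    k.form x u v = -k.form x v u := by
  rw [Kernel.form_apply, Kernel.form_apply, Finset.sum_comm, ← Finset.sum_neg_distrib]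
  refine Finset.sum_congr rfl fun p _ => ?_
  rw [← Finset.sum_neg_distrib]
  exact Finset.sum_congr rfl fun q _ => k.pt_antisymm hk _ _ _ _

/-- The Poisson bracket on the fibre of `S^⊠ S^⊗ V`. -/
def Kernel.poisson (x : Finset M) :
    FiberAlg V x →ₗ[K] FiberAlg V x →ₗ[K] FiberAlg V x :=
  tensorPoisson (K := K) (E := fun p : x => V.fiber p.1) (k.form x)

section

variable {x : Finset M} (a b c : FiberAlg V x)

theorem Kernel.poisson_single (p q : x) (u : V.fiber p.1) (v : V.fiber q.1) :
    k.poisson x (symSingle K (fun p : x => V.fiber p.1) p (SymmetricAlgebra.ι K _ u))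
      (symSingle K (fun p : x => V.fiber p.1) q (SymmetricAlgebra.ι K _ v)) =
      algebraMap K _ (k.pt p.1 q.1 u v) :=
  (tensorPoisson_single (K := K) (E := fun p : x => V.fiber p.1) (k.form x) p q u v).trans
    (congrArg _ (k.form_single x p q u v))

theorem Kernel.poisson_mul_left :
    k.poisson x (a * b) c = k.poisson x a c * b + a * k.poisson x b c :=
  tensorPoisson_mul_left (K := K) (E := fun p : x => V.fiber p.1) (k.form x) a b c

theorem Kernel.poisson_mul_right :
    k.poisson x a (b * c) = k.poisson x a b * c + b * k.poisson x a c :=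
  tensorPoisson_mul_right (K := K) (E := fun p : x => V.fiber p.1) (k.form x) a b c

theorem Kernel.poisson_one_left : k.poisson x 1 a = 0 :=
  tensorPoisson_one_left (K := K) (E := fun p : x => V.fiber p.1) (k.form x) a

theorem Kernel.poisson_one_right : k.poisson x a 1 = 0 :=
  tensorPoisson_one_right (K := K) (E := fun p : x => V.fiber p.1) (k.form x) a

theorem Kernel.poisson_antisymm (hk : k.IsAntisymm) : k.poisson x a b = -k.poisson x b a :=
  tensorPoisson_antisymm (K := K) (E := fun p : x => V.fiber p.1) (κ := k.form x) a b
    (k.form_antisymm hk x)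

theorem Kernel.poisson_jacobi (hk : k.IsAntisymm) :
    k.poisson x (k.poisson x a b) c + k.poisson x (k.poisson x b c) a +
      k.poisson x (k.poisson x c a) b = 0 :=
  tensorPoisson_jacobi (K := K) (E := fun p : x => V.fiber p.1) (κ := k.form x) a b c
    (k.form_antisymm hk x)

theorem incl_symGen {z : Finset M} (h : x ⊆ z) (u : ∀ p : x, V.fiber p.1) :
    incl V h (symGen K (fun p : x => V.fiber p.1) u) = symGen K (fun p : z => V.fiber p.1)
      (∑ p : x, Pi.single (⟨p.1, h p.2⟩ : z) (u p)) := by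
  rw [symGen_apply, map_sum, map_sum]
  refine Finset.sum_congr rfl fun p _ => ?_
  rw [incl_single]
  exact (symGen_single (E := fun p : z => V.fiber p.1) ⟨p.1, h p.2⟩ (u p)).symm

theorem Kernel.form_sum_single {z : Finset M} (h : x ⊆ z) (u v : ∀ p : x, V.fiber p.1) :
    k.form z (∑ p : x, Pi.single (⟨p.1, h p.2⟩ : z) (u p))
      (∑ p : x, Pi.single (⟨p.1, h p.2⟩ : z) (v p)) = k.form x u v := by
  rw [k.form_apply x, map_sum, Finset.sum_comm]
  refine Finset.sum_congr rfl fun q _ => ?_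
  rw [map_sum, LinearMap.sum_apply]
  exact Finset.sum_congr rfl fun p _ =>
    k.form_single z (⟨p.1, h p.2⟩ : z) (⟨q.1, h q.2⟩ : z) (u p) (v q)

/-- The form over `z` restricts to the form over `x`, so the inclusion is a Poisson map. Iterated
brackets can therefore be computed over the largest configuration. -/
theorem Kernel.incl_poisson {z : Finset M} (h : x ⊆ z) :
    incl V h (k.poisson x a b) = k.poisson z (incl V h a) (incl V h b) :=
  tensorPoisson_map (K := K) (E := fun p : x => V.fiber p.1) (E' := fun p : z => V.fiber p.1)
    (κ := k.form x) (κ' := k.form z) a b (incl_symGen h) (k.form_sum_single h)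

end

/-- The bracket `{ , }_k` on fibres over disjoint configurations. -/
def Kernel.bracket {x y z : Finset M} (h : IsSplit x y z) (a : SFiber V.sym x)
    (b : SFiber V.sym y) : SFiber V.sym z :=
  (toAlg V z).symm (k.poisson z (incl V h.left_subset (toAlg V x a))
    (incl V h.right_subset (toAlg V y b)))

/-- The bracket `{ , }_k` as a family of bilinear maps. -/
def Kernel.bracketLinear : SplitBilin V.sym.cauchySym V.sym.cauchySym V.sym.cauchySym :=
  fun {x y z} h =>
  ((k.poisson z).compr₂ (toAlg V z).symm.toLinearMap).compl₁₂
    ((incl V h.left_subset).toLinearMap ∘ₗ (toAlg V x).toLinearMap)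
    ((incl V h.right_subset).toLinearMap ∘ₗ (toAlg V y).toLinearMap)

theorem Kernel.bracketLinear_apply {x y z : Finset M} (h : IsSplit x y z) (a : SFiber V.sym x)
    (b : SFiber V.sym y) : k.bracketLinear h a b = k.bracket h a b := rfl

theorem Kernel.toAlg_bracket {x y z : Finset M} (h : IsSplit x y z) (a : SFiber V.sym x)
    (b : SFiber V.sym y) : toAlg V z (k.bracket h a b) =
      k.poisson z (incl V h.left_subset (toAlg V x a)) (incl V h.right_subset (toAlg V y b)) :=
  (toAlg V z).apply_symm_apply _

theorem Kernel.bracket_antisymm (hk : k.IsAntisymm) {x y z : Finset M} (h : IsSplit x y z)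
    (a : SFiber V.sym x) (b : SFiber V.sym y) :
    k.bracket h a b = -k.bracket h.symm b a := by
  apply (toAlg V z).injective
  rw [map_neg, Kernel.toAlg_bracket, Kernel.toAlg_bracket]
  exact k.poisson_antisymm _ _ hk

/-- By `Kernel.incl_poisson` and `incl_incl`, all three terms are double Poisson brackets of the
images of `a`, `b`, `c` in the single algebra over `w`. -/
theorem Kernel.bracket_jacobi (hk : k.IsAntisymm) {x y z xy yz zx w : Finset M}
    (hxy : IsSplit x y xy) (hyz : IsSplit y z yz)
    (hzx : IsSplit z x zx) (h₁ : IsSplit xy z w) (h₂ : IsSplit yz x w) (h₃ : IsSplit zx y w)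
    (a : SFiber V.sym x) (b : SFiber V.sym y) (c : SFiber V.sym z) :
    k.bracket h₁ (k.bracket hxy a b) c +
      k.bracket h₂ (k.bracket hyz b c) a +
      k.bracket h₃ (k.bracket hzx c a) b = 0 := by
  apply (toAlg V w).injective
  simp only [map_add, Kernel.toAlg_bracket, Kernel.incl_poisson, incl_incl, map_zero]
  exact k.poisson_jacobi _ _ _ hk

/-- Since `⊡` is multiplication in the algebra over `w`, this is the derivation property of its
Poisson bracket. -/
theorem Kernel.bracket_boxdot_right {x y z xy yz xz w : Finset M} (hxy : IsSplit x y xy)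
    (hyz : IsSplit y z yz) (hxz : IsSplit x z xz) (h₁ : IsSplit x yz w) (h₂ : IsSplit xy z w)
    (h₃ : IsSplit y xz w) (a : SFiber V.sym x) (b : SFiber V.sym y) (c : SFiber V.sym z) :
    k.bracket h₁ a (boxdot V.sym hyz b c) =
      boxdot V.sym h₂ (k.bracket hxy a b) c +
        boxdot V.sym h₃ b (k.bracket hxz a c) := by
  apply (toAlg V w).injective
  simp only [map_add, Kernel.toAlg_bracket, Kernel.incl_poisson, incl_incl, toAlg_boxdot, map_mul]
  exact k.poisson_mul_right _ _ _

theorem Kernel.bracket_boxdot_left {x y z xy yz xz w : Finset M} (hxy : IsSplit x y xy)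
    (hyz : IsSplit y z yz) (hxz : IsSplit x z xz) (h₁ : IsSplit xy z w) (h₂ : IsSplit xz y w)
    (h₃ : IsSplit x yz w) (a : SFiber V.sym x) (b : SFiber V.sym y) (c : SFiber V.sym z) :
    k.bracket h₁ (boxdot V.sym hxy a b) c =
      boxdot V.sym h₂ (k.bracket hxz a c) b +
        boxdot V.sym h₃ a (k.bracket hyz b c) := by
  apply (toAlg V w).injective
  simp only [map_add, Kernel.toAlg_bracket, Kernel.incl_poisson, incl_incl, toAlg_boxdot, map_mul]
  exact k.poisson_mul_left _ _ _

/-- Also a derivation property, now over `z`: the class `b ⊡ 1` is the image of `b` under the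
inclusion of algebras. -/
theorem Kernel.bracket_odot_left {x y z : Finset M} (h : IsSplit x y z) (a b : SFiber V.sym x)
    (c : SFiber V.sym y) : k.bracket h (odot V a b) c =
      odot V (k.bracket h a c) (boxdot V.sym h b (oneAt V y)) +
      odot V (boxdot V.sym h a (oneAt V y)) (k.bracket h b c) := by
  apply (toAlg V z).injective
  simp only [map_add, Kernel.toAlg_bracket, toAlg_odot, toAlg_boxdot, map_mul, toAlg_oneAt, map_one,
    mul_one]
  exact k.poisson_mul_left _ _ _

theorem Kernel.bracket_odot_right {x y z : Finset M} (h : IsSplit x y z) (a : SFiber V.sym x)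
    (b c : SFiber V.sym y) : k.bracket h a (odot V b c) =
      odot V (k.bracket h a b) (boxdot V.sym h (oneAt V x) c) +
      odot V (boxdot V.sym h (oneAt V x) b) (k.bracket h a c) := by
  apply (toAlg V z).injective
  simp only [map_add, Kernel.toAlg_bracket, toAlg_odot, toAlg_boxdot, map_mul, toAlg_oneAt, map_one,
    one_mul]
  exact k.poisson_mul_right _ _ _

theorem Kernel.bracket_one_left {x y z : Finset M} (h : IsSplit x y z) (b : SFiber V.sym y) :
    k.bracket h (oneAt V x) b = 0 := by
  apply (toAlg V z).injective
  rw [Kernel.toAlg_bracket, toAlg_oneAt, map_one, map_zero]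
  exact k.poisson_one_left _

theorem Kernel.bracket_one_right {x y z : Finset M} (h : IsSplit x y z) (a : SFiber V.sym x) :
    k.bracket h a (oneAt V y) = 0 := by
  apply (toAlg V z).injective
  rw [Kernel.toAlg_bracket, toAlg_oneAt, map_one, map_zero]
  exact k.poisson_one_right _

theorem Kernel.bracket_gen {p q : M} {z : Finset M} (h : IsSplit {p} {q} z)
    (u v : ∀ p : M, V.fiber p) : k.bracket h (genAt V u p) (genAt V v q) =
      (k.on h (V.pushVec u p) (V.pushVec v q) : K) • boxdot V.sym h (oneAt V {p}) (oneAt V {q}) := by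
  apply (toAlg V z).injective
  rw [Kernel.toAlg_bracket, map_smul, toAlg_boxdot, toAlg_oneAt, toAlg_oneAt, map_one, map_one,
    mul_one, incl_genAt V u ((h.mem_iff p).2 (Or.inl (by simp))),
    incl_genAt V v ((h.mem_iff q).2 (Or.inr (by simp))), Kernel.poisson_single, ← k.pt_eq h,
    Algebra.algebraMap_eq_smul_one]

/-! ### Uniqueness of the bracket -/

variable {k}

/-- The rules for `⊙` reduce each argument to `u p ⊡ 1`. The rules for `⊡`, with the vanishing on
units, then remove the factor `1`, and two generators over distinct points remain. -/
theorem IsKernelBracket.ext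
    {B B' : Hom (V.sym.cauchySym.cauchy V.sym.cauchySym) V.sym.cauchySym}
    (hB : IsKernelBracket k B) (hB' : IsKernelBracket k B') : B = B' := by
  have h1 : ∀ {p : M} {y z : Finset M} (h : IsSplit {p} y z) (u : ∀ p : M, V.fiber p)
      (b : SFiber V.sym y), B.onLinear h (genAt V u p) b = B'.onLinear h (genAt V u p) b := by
    intro p y z h u b
    induction b using symFiber_induction with
    | smul c b hb => rw [map_smul, map_smul, hb]
    | one => exact (hB.unit_right h _).trans (hB'.unit_right h _).symm
    | add b b' hb hb' => rw [map_add, map_add, hb, hb']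
    | odot b c hb hc =>
      have e1 := hB.odot_right h (genAt V u p) b c
      have e2 := hB'.odot_right h (genAt V u p) b c
      simp only [← Hom.onLinear_apply] at e1 e2
      rw [e1, e2, hb, hc]
    | @gen q x' h' v =>
      have hpq : p ≠ q := fun e => Finset.disjoint_left.1 h.disj (Finset.mem_singleton_self p)
        ((h'.mem_iff p).2 (Or.inl (by simp [e])))
      have hpx : p ∉ x' := fun e => Finset.disjoint_left.1 h.disj (Finset.mem_singleton_self p)
        ((h'.mem_iff p).2 (Or.inr e))
      have s1 : IsSplit {p} {q} {p, q} := isSplit_pair hpq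
      have s2 : IsSplit {p} x' (insert p x') := ⟨by simpa using hpx, by simp⟩
      have s3 : IsSplit {p, q} x' z := by
        refine ⟨?_, fun r => ?_⟩
        · rw [Finset.disjoint_left]
          intro r hr
          rcases Finset.mem_insert.1 hr with rfl | hr
          · exact hpx
          · exact Finset.disjoint_left.1 h'.disj hr
        · rw [h.mem_iff, h'.mem_iff]
          simp [or_assoc]
      have s4 : IsSplit {q} (insert p x') z := by
        refine ⟨?_, fun r => ?_⟩
        · rw [Finset.disjoint_left]
          intro r hr hr'
          obtain rfl := Finset.mem_singleton.1 hr
          rcases Finset.mem_insert.1 hr' with e | e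
          · exact hpq e.symm
          · exact Finset.disjoint_left.1 h'.disj hr e
        · rw [h.mem_iff, h'.mem_iff]
          simp [or_left_comm]
      -- In `{u, v ⊡ 1}` the term with `{u, 1}` drops out, and `{u, v}` is given by `k`; the result
      -- is the same for `B` and `B'`.
      have e1 := hB.boxdot_right s1 h' s2 h s3 s4 (genAt V u p) (genAt V v q) (oneAt V x')
      have e2 := hB'.boxdot_right s1 h' s2 h s3 s4 (genAt V u p) (genAt V v q) (oneAt V x')
      rw [hB.unit_right, hB.gen] at e1
      rw [hB'.unit_right, hB'.gen] at e2
      exact e1.trans e2.symm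
  refine Hom.ext_on fun {x y z} h a b => ?_
  suffices B.onLinear h a b = B'.onLinear h a b from this
  induction a using symFiber_induction with
  | smul c a ha => rw [map_smul, map_smul, LinearMap.smul_apply, LinearMap.smul_apply, ha]
  | one => exact (hB.unit_left h _).trans (hB'.unit_left h _).symm
  | add a a' ha ha' => rw [map_add, map_add, LinearMap.add_apply, LinearMap.add_apply, ha, ha']
  | odot a a' ha ha' =>
    have e1 := hB.odot_left h a a' b
    have e2 := hB'.odot_left h a a' b
    simp only [← Hom.onLinear_apply] at e1 e2
    rw [e1, e2, ha, ha']
  | @gen p x' h' u =>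
    have hp : p ∉ y := fun e => Finset.disjoint_left.1 h.disj
      ((h'.mem_iff p).2 (Or.inl (by simp))) e
    have hx' : Disjoint x' y := h.disj.mono_left h'.right_subset
    have s1 : IsSplit x' y (x' ∪ y) := ⟨hx', by simp⟩
    have s2 : IsSplit {p} y (insert p y) := ⟨by simpa using hp, by simp⟩
    have s3 : IsSplit (insert p y) x' z := by
      refine ⟨?_, fun r => ?_⟩
      · rw [Finset.disjoint_left]
        intro r hr
        rcases Finset.mem_insert.1 hr with rfl | hr
        · exact Finset.disjoint_left.1 h'.disj (Finset.mem_singleton_self _)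
        · exact Finset.disjoint_right.1 hx' hr
      · rw [h.mem_iff, h'.mem_iff]
        simp only [Finset.mem_singleton, Finset.mem_insert]
        tauto
    have s4 : IsSplit {p} (x' ∪ y) z := by
      refine ⟨?_, fun r => ?_⟩
      · rw [Finset.disjoint_union_right]
        exact ⟨h'.disj, by simpa using hp⟩
      · rw [h.mem_iff, h'.mem_iff]
        simp [or_assoc]
    -- Likewise `{u ⊡ 1, b}` reduces to `{u, b}`, which is the case `h1`.
    have e1 := hB.boxdot_left h' s1 s2 h s3 s4 (genAt V u p) (oneAt V x') b
    have e2 := hB'.boxdot_left h' s1 s2 h s3 s4 (genAt V u p) (oneAt V x') b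
    have e3 : B.on s2 (genAt V u p) b = B'.on s2 (genAt V u p) b := h1 s2 u b
    rw [hB.unit_left, e3] at e1
    rw [hB'.unit_left] at e2
    exact e1.trans e2.symm

end KernelBracket

/-! ## Smoothness of the bracket -/

section Smoothness

variable {K : Type} [RCLike K] {d : ℕ} {M : Type u} [TopologicalSpace M]
  [ChartedSpace (EuclideanSpace ℝ (Fin d)) M] {V : BundleData.{u, v} (manifold K d M)}

theorem trivialLine_sheafy {X : SmoothSpace.{u} K} (hX : X.Regular) : (trivialLine X).Sheafy where
  zero x := hX.const 0 x
  add := hX.add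
  smul := hX.mul
  congr := hX.congr

variable (V) in
/-- Near `x`, the section `r` is of degree one near one point of `x` and is `1` near the others. -/
def IsElementary (r : ∀ p : M, SymmetricAlgebra K (V.fiber p)) (x : Finset M) : Prop :=
  ∃ p ∈ x, ∃ (O O' : Set M) (t : ∀ p : M, V.fiber p), IsOpen O ∧ IsOpen O' ∧ Disjoint O O' ∧
    p ∈ O ∧ (∀ q ∈ x, q ≠ p → q ∈ O') ∧ V.SmoothAt t p ∧
    (∀ q ∈ O, r q = SymmetricAlgebra.ι K (V.fiber q) (t q)) ∧ ∀ q ∈ O', r q = 1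

theorem IsElementary.smoothAt {r : ∀ p : M, SymmetricAlgebra K (V.fiber p)} {x : Finset M}
    (h : IsElementary V r x) {q : M} (hq : q ∈ x) : V.sym.SmoothAt r q := by
  have hX := manifold_regular K d M
  have hS : V.sym.Sheafy := sym_isGenerated.sheafy hX
  obtain ⟨p, hp, O, O', t, hO, hO', -, hpO, hx, ht, h1, h2⟩ := h
  by_cases hqp : q = p
  · subst hqp
    exact hS.congr (sym_smoothAt_ι hX ht) ((hO.eventually_mem hpO).mono h1)
  · exact hS.congr (sym_smoothAt_one hX q) ((hO'.eventually_mem (hx q hq hqp)).mono h2)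

variable [T2Space M]

variable (V) in
/-- Near `x`, the section `g` of `S^⊠ S^⊗ V` is a product of elementary sections. -/
def IsElementaryProduct (g : ∀ x, SFiber V.sym x) (x : Finset M) : Prop :=
  ∃ (ι : Type u) (J : Finset ι) (r : ι → ∀ p : M, SymmetricAlgebra K (V.fiber p)),
    (∀ l ∈ J, IsElementary V (r l) x) ∧
    ∀ᶠ y in 𝓝 x, g y = boxProd V.sym y fun q => ∏ l ∈ J, r l q

open Classical in
/-- Smooth sections of `S^⊠ S^⊗ V` are generated by products of elementary sections. -/
theorem generated_by_elementary (s : ∀ x, SFiber V.sym x) (x : Finset M)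
    (hs : V.sym.cauchySym.SmoothAt s x) :
    GeneratedSmoothAt (X := UConf K d M) (IsElementaryProduct V) s x := by
  -- The same fibres with the smooth structure generated by elementary products; the claim is that
  -- `s` is smooth for it, and its sheaf properties can be used.
  let E : BundleData.{u, max u v} (UConf K d M) :=
    { fiber := SFiber V.sym
      SmoothAt := GeneratedSmoothAt (X := UConf K d M) (IsElementaryProduct V) }
  have hX := uConf_regular K d M
  have hE : E.Sheafy := BundleData.IsGenerated.sheafy (E := E) (G := IsElementaryProduct V) (fun _ _ => Iff.rfl) hX
  change E.SmoothAt s x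
  obtain ⟨n, c, g, hcg, hev⟩ := (cauchySym_isGenerated _ _).1 hs
  refine hE.congr (hE.sum Finset.univ fun i _ => hE.smul (hcg i).1 ?_) hev
  obtain ⟨s₀, hs₀, hg⟩ := (hcg i).2
  rw [hg]
  -- Near each `p ∈ x` the section of `S^⊗ V` is a combination of products of degree-one sections;
  -- `boxProd_expand` then reduces to one such product at each point.
  choose n' c' g' hc' hev' using fun p : x => (sym_isGenerated _ _).1 (hs₀ p.1 p.2)
  choose m t ht hg' using fun p i => (hc' p i).2
  obtain ⟨N, hN, hd, hmem, -⟩ := exists_separation x (fun _ => Set.univ) fun _ _ => univ_mem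
  refine hE.congr (hE.sum _ fun a _ => hE.smul (smoothAt_prod_mem fun q hq => ?_) ?_)
    (boxProd_expand (V := V.sym) hN hd (Equiv.refl x) hmem (fun _ => Finset.univ) c' g' hev')
  · exact smoothAt_pick_fun hN hd (hmem ⟨q, hq⟩) (hc' ⟨q, hq⟩ _).1
  -- One elementary factor for each point `p` and each degree-one factor at `p`, extended by `1`
  -- outside `N p`. At a point of `N p` only the factors belonging to `p` survive.
  refine generated_of_gen hX ⟨(Σ p : x, Fin (m p (a p))), Finset.univ,
    fun l q => if q ∈ N l.1 then SymmetricAlgebra.ι K (V.fiber q) (t l.1 (a l.1) l.2 q) else 1,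
    fun l _ => ?_, ?_⟩
  · refine ⟨l.1.1, l.1.2, N l.1, ⋃ (p) (_ : p ≠ l.1), N p, t l.1 (a l.1) l.2, hN _,
      isOpen_biUnion fun p _ => hN p, ?_, hmem _, fun q hq hne => ?_, ht _ _ _, fun q hq => ?_,
      fun q hq => ?_⟩
    · exact Set.disjoint_iUnion₂_right.2 fun p hp => hd hp.symm
    · exact Set.mem_iUnion₂.2 ⟨⟨q, hq⟩, fun h => hne (congrArg Subtype.val h), hmem _⟩
    · exact if_pos hq
    · obtain ⟨p, hp, hqp⟩ := Set.mem_iUnion₂.1 hq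
      exact if_neg fun h => Set.disjoint_left.1 (hd hp) hqp h
  · refine (eventually_subset_union (isOpen_iUnion hN)
      fun p hp => Set.mem_iUnion.2 ⟨⟨p, hp⟩, hmem _⟩).mono fun y hy => boxProd_congr V.sym ?_
    intro q hq
    obtain ⟨p, hp⟩ := Set.mem_iUnion.1 (hy q hq)
    rw [pick_mem hd _ hp, hg', Fintype.prod_sigma, Finset.prod_eq_single p]
    · simp [hp]
    · intro p' _ hne
      refine Finset.prod_eq_one fun j _ => if_neg fun h => ?_
      exact Set.disjoint_left.1 (hd hne) h hp
    · simp

theorem odot_smoothAt {s t : ∀ x, SFiber V.sym x} {x : Finset M}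
    (hs : V.sym.cauchySym.SmoothAt s x) (ht : V.sym.cauchySym.SmoothAt t x) :
    V.sym.cauchySym.SmoothAt (fun y => odot V (s y) (t y)) x := by
  obtain ⟨n, c, g, hcg, hev⟩ := (cauchySym_isGenerated _ _).1 hs
  obtain ⟨n', c', g', hcg', hev'⟩ := (cauchySym_isGenerated _ _).1 ht
  have hS : V.sym.cauchySym.Sheafy := cauchySym_sheafy
  refine hS.congr (hS.sum Finset.univ fun i _ => hS.sum Finset.univ fun j _ =>
    hS.smul (hcg i).1 (hS.smul (hcg' j).1 (s := fun y => odot V (g i y) (g' j y)) ?_)) ?_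
  · obtain ⟨a, ha, hg⟩ := (hcg i).2
    obtain ⟨b, hb, hg'⟩ := (hcg' j).2
    rw [hg, hg']
    simp only [odot_boxProd]
    exact smoothAt_boxProd fun p hp => sym_smoothAt_mul (manifold_regular K d M) (ha p hp) (hb p hp)
  · filter_upwards [hev, hev'] with y h h'
    rw [← odotLinear_apply, h, h']
    simp only [map_sum, LinearMap.sum_apply, map_smul, LinearMap.smul_apply, odotLinear_apply]
    rw [Finset.sum_comm]
    refine Finset.sum_congr rfl fun i _ => ?_
    rw [Finset.smul_sum]
    exact Finset.sum_congr rfl fun j _ => smul_comm _ _ _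

omit [T2Space M] in
open Classical in
theorem toAlg_boxProd_single {x : Finset M} (r : ∀ p : M, SymmetricAlgebra K (V.fiber p)) (p : x)
    (h : ∀ q ∈ x, q ≠ p.1 → r q = 1) :
    toAlg V x (boxProd V.sym x r) = symSingle K (fun p : x => V.fiber p.1) p (r p.1) := by
  rw [toAlg_boxProd, symSingle_apply]
  congr 1
  funext q
  by_cases hq : q = p
  · subst hq
    rw [Pi.mulSingle_eq_same]
  · rw [Pi.mulSingle_eq_of_ne hq]
    exact h q.1 q.2 fun e => hq (Subtype.ext e)

omit [T2Space M] in
theorem Kernel.bracket_single (k : Kernel V) {x y z : Finset M} (h : IsSplit x y z)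
    {r r' : ∀ p : M, SymmetricAlgebra K (V.fiber p)} {p q : M} (hp : p ∈ x) (hq : q ∈ y)
    (hr : ∀ q ∈ x, q ≠ p → r q = 1) (hr' : ∀ p ∈ y, p ≠ q → r' p = 1) (u : V.fiber p)
    (v : V.fiber q) (hu : r p = SymmetricAlgebra.ι K _ u) (hv : r' q = SymmetricAlgebra.ι K _ v) :
    k.bracket h (boxProd V.sym x r) (boxProd V.sym y r') = k.pt p q u v • oneAt V z := by
  classical
  apply (toAlg V z).injective
  rw [Kernel.toAlg_bracket, map_smul, toAlg_oneAt, toAlg_boxProd_single r ⟨p, hp⟩ hr,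
    toAlg_boxProd_single r' ⟨q, hq⟩ hr', incl_single, incl_single, hu, hv, Kernel.poisson_single,
    Algebra.algebraMap_eq_smul_one]

theorem oneAt_smoothAt (x : Finset M) : V.sym.cauchySym.SmoothAt (oneAt V) x :=
  smoothAt_boxProd fun p _ => sym_smoothAt_one (manifold_regular K d M) p

variable (k : Kernel V) {x : Finset M} {U U' : Set M} (hU : IsOpen U) (hU' : IsOpen U')
  (hd : Disjoint U U') (hx : ∀ p ∈ x, p ∈ U ∪ U')

variable (x U U') in
/-- The bracket of `y ↦ ⊡ r` over `y ∩ U` and `y ↦ ⊡ r'` over `y ∩ U'` is smooth at `x`. -/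
def Kernel.SmoothBracket (r r' : ∀ p : M, SymmetricAlgebra K (V.fiber p)) : Prop :=
  ∃ g : ∀ y, SFiber V.sym y, V.sym.cauchySym.SmoothAt g x ∧
    ∀ᶠ y in 𝓝 x, ∀ h : IsSplit (restrict y U) (restrict y U') y,
      g y = k.bracket h (boxProd V.sym (restrict y U) r) (boxProd V.sym (restrict y U') r')

omit [TopologicalSpace M] in
theorem restrict_eq_singleton {y : Finset M} {U O O' : Set M} {p : M}
    (hO : O ⊆ U) (h : restrict y O = {p}) (hy : ∀ q ∈ y, q ∈ U → q ∈ O ∪ O') :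
    p ∈ restrict y U ∧ p ∈ O ∧ ∀ q ∈ restrict y U, q ≠ p → q ∈ O' := by
  have hp : p ∈ restrict y O := by simp [h]
  refine ⟨mem_restrict.2 ⟨(mem_restrict.1 hp).1, hO (mem_restrict.1 hp).2⟩, (mem_restrict.1 hp).2,
    fun q hq hne => ?_⟩
  obtain ⟨h1, h2⟩ := mem_restrict.1 hq
  refine (hy q h1 h2).resolve_left fun h3 => hne ?_
  have h4 : q ∈ restrict y O := mem_restrict.2 ⟨h1, h3⟩
  simpa [h] using h4

include hU hU' hd hx

/-- A configuration `y` near `x` has one point `a` near `p` and one point `b` near `q`, and the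
bracket over `y` is `k (t a, t' b)` times the unit. The scalar depends only on the two-point part of
`y`, and it is smooth there because `k` is a bundle map. -/
theorem Kernel.smoothBracket_elementary {r r' : ∀ p : M, SymmetricAlgebra K (V.fiber p)}
    (hr : IsElementary V r (restrict x U)) (hr' : IsElementary V r' (restrict x U')) :
    k.SmoothBracket x U U' r r' := by
  classical
  obtain ⟨p, hp, O, N, t, hO, hN, hON, hpO, hxN, ht, h1, h2⟩ := hr
  obtain ⟨q, hq, O', N', t', hO', hN', hON', hqO', hxN', ht', h1', h2'⟩ := hr'
  rw [mem_restrict] at hp hq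
  have hOU : IsOpen (O ∩ U) := hO.inter hU
  have hOU' : IsOpen (O' ∩ U') := hO'.inter hU'
  have hNU : IsOpen (N ∩ U) := hN.inter hU
  have hNU' : IsOpen (N' ∩ U') := hN'.inter hU'
  have dOO : Disjoint (O ∩ U) (O' ∩ U') := hd.mono Set.inter_subset_right Set.inter_subset_right
  have hcov : ∀ r ∈ x, (r = p ∨ r ∈ N ∩ U) ∨ (r = q ∨ r ∈ N' ∩ U') := by
    intro r hr
    rcases hx r hr with h | h
    · by_cases e : r = p
      · exact Or.inl (Or.inl e)
      · exact Or.inl (Or.inr ⟨hxN r (mem_restrict.2 ⟨hr, h⟩) e, h⟩)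
    · by_cases e : r = q
      · exact Or.inr (Or.inl e)
      · exact Or.inr (Or.inr ⟨hxN' r (mem_restrict.2 ⟨hr, h⟩) e, h⟩)
  have hxp : restrict x (O ∩ U) = {p} := by
    ext r
    rw [mem_restrict, Finset.mem_singleton]
    refine ⟨fun h => by_contra fun e => ?_, ?_⟩
    · exact Set.disjoint_left.1 hON h.2.1 (hxN r (mem_restrict.2 ⟨h.1, h.2.2⟩) e)
    · rintro rfl
      exact ⟨hp.1, hpO, hp.2⟩
  have hxq : restrict x (O' ∩ U') = {q} := by
    ext r
    rw [mem_restrict, Finset.mem_singleton]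
    refine ⟨fun h => by_contra fun e => ?_, ?_⟩
    · exact Set.disjoint_left.1 hON' h.2.1 (hxN' r (mem_restrict.2 ⟨h.1, h.2.2⟩) e)
    · rintro rfl
      exact ⟨hq.1, hqO', hq.2⟩
  have dON : Disjoint (O ∩ U) (N ∩ U) := hON.mono Set.inter_subset_left Set.inter_subset_left
  have dON' : Disjoint (O' ∩ U') (N' ∩ U') := hON'.mono Set.inter_subset_left Set.inter_subset_left
  have dUN' : Disjoint (O ∩ U) (N' ∩ U') := hd.mono Set.inter_subset_right Set.inter_subset_right
  have dUN : Disjoint (N ∩ U) (O' ∩ U') := hd.mono Set.inter_subset_right Set.inter_subset_right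
  have hC : IsOpen ((N ∩ U) ∪ (N' ∩ U')) := hNU.union hNU'
  have dC : Disjoint ((O ∩ U) ∪ (O' ∩ U')) ((N ∩ U) ∪ (N' ∩ U')) :=
    Set.disjoint_union_left.2 ⟨Set.disjoint_union_right.2 ⟨dON, dUN'⟩,
      Set.disjoint_union_right.2 ⟨dUN.symm, dON'⟩⟩
  have hxC : ∀ r ∈ x, r ∈ ((O ∩ U) ∪ (O' ∩ U')) ∪ ((N ∩ U) ∪ (N' ∩ U')) := by
    intro r hr
    rcases hcov r hr with (rfl | h) | (rfl | h)
    · exact Or.inl (Or.inl ⟨hpO, hp.2⟩)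
    · exact Or.inr (Or.inl h)
    · exact Or.inl (Or.inr ⟨hqO', hq.2⟩)
    · exact Or.inr (Or.inr h)
  -- The scalar as a function of a configuration; the value `0` away from split configurations plays
  -- no role, as only restrictions to the two neighbourhoods are inserted.
  let f : Finset M → K := fun w =>
    if h : IsSplit (restrict w (O ∩ U)) (restrict w (O' ∩ U')) w then
      k.on h (fun q => t q.1) (fun q => t' q.1) else 0
  have hxx : ∀ (A : Set M) (w : Finset M), A ⊆ (O ∩ U) ∪ (O' ∩ U') →
      restrict (restrict w ((O ∩ U) ∪ (O' ∩ U'))) A = restrict w A := by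
    intro A w hA
    ext r
    simp only [mem_restrict]
    exact ⟨fun h => ⟨h.1.1, h.2⟩, fun h => ⟨⟨h.1, hA h.2⟩, h.2⟩⟩
  have hf : (UConf K d M).SmoothAt f (restrict x ((O ∩ U) ∪ (O' ∩ U'))) := by
    refine k.smoothBilin (trivialLine_sheafy (uConf_regular K d M)) _ (O ∩ U) (O' ∩ U')
      (fun w q => t q.1) (fun w q => t' q.1) hOU hOU' dOO
      (fun r hr => (mem_restrict.1 hr).2) ?_ ?_ f fun w h => ?_
    · rw [hxx _ _ Set.subset_union_left, hxp]
      intro p' hp'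
      obtain rfl := Finset.singleton_injective hp'
      exact ht
    · rw [hxx _ _ Set.subset_union_right, hxq]
      intro p' hp'
      obtain rfl := Finset.singleton_injective hp'
      exact ht'
    · simp only [f, h, dif_pos]
      rfl
  have hS : V.sym.cauchySym.Sheafy := cauchySym_sheafy
  refine ⟨_, hS.smul (smoothAt_restrict (hOU.union hOU') hC dC hxC hf) (oneAt_smoothAt x), ?_⟩
  -- The number of points in `O ∩ U` is locally constant, hence `1` near `x`; the same holds below
  -- for `O' ∩ U'`.
  have e1 := (tendsto_restrict hOU (hC.union hOU')
    (Set.disjoint_union_right.2 ⟨Set.disjoint_union_right.2 ⟨dON, dUN'⟩, dOO⟩) fun r hr => by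
      rcases hxC r hr with (h | h) | h
      exacts [Or.inl h, Or.inr (Or.inr h), Or.inr (Or.inl h)]).eventually
    (eventually_card_eq (restrict x (O ∩ U)))
  have e2 := (tendsto_restrict hOU' (hC.union hOU)
    (Set.disjoint_union_right.2 ⟨Set.disjoint_union_right.2 ⟨dUN.symm, dON'⟩, dOO.symm⟩)
      fun r hr => by
        rcases hxC r hr with (h | h) | h
        exacts [Or.inr (Or.inr h), Or.inl h, Or.inr (Or.inl h)]).eventually
    (eventually_card_eq (restrict x (O' ∩ U')))
  have e3 := eventually_subset_union ((hOU.union hOU').union hC) hxC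
  filter_upwards [e1, e2, e3] with y h1y h2y h3y h
  rw [hxp, Finset.card_singleton] at h1y
  rw [hxq, Finset.card_singleton] at h2y
  obtain ⟨a, ha⟩ := Finset.card_eq_one.1 h1y
  obtain ⟨b, hb⟩ := Finset.card_eq_one.1 h2y
  obtain ⟨a1, a2, a3⟩ := restrict_eq_singleton Set.inter_subset_right ha fun r hr hrU => by
    rcases h3y r hr with (h | h) | (h | h)
    exacts [Or.inl h, (Set.disjoint_left.1 hd hrU h.2).elim, Or.inr h,
      (Set.disjoint_left.1 hd hrU h.2).elim]
  obtain ⟨b1, b2, b3⟩ := restrict_eq_singleton Set.inter_subset_right hb fun r hr hrU => by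
    rcases h3y r hr with (h | h) | (h | h)
    exacts [(Set.disjoint_right.1 hd hrU h.2).elim, Or.inl h,
      (Set.disjoint_right.1 hd hrU h.2).elim, Or.inr h]
  rw [k.bracket_single h a1 b1 (fun r hr hne => h2 r (a3 r hr hne).1)
    (fun r hr hne => h2' r (b3 r hr hne).1) (t a) (t' b) (h1 a a2.1) (h1' b b2.1)]
  congr 1
  have hw : IsSplit (restrict (restrict y ((O ∩ U) ∪ (O' ∩ U'))) (O ∩ U))
      (restrict (restrict y ((O ∩ U) ∪ (O' ∩ U'))) (O' ∩ U'))
      (restrict y ((O ∩ U) ∪ (O' ∩ U'))) :=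
    isSplit_restrict dOO fun r hr => (mem_restrict.1 hr).2
  -- The parts of `y` are equal to `{a}` and `{b}` only propositionally; with arbitrary `A` and `B`
  -- these equalities can be substituted.
  have key : ∀ {A B C : Finset M} (h : IsSplit A B C), A = {a} → B = {b} →
      k.on h (fun q => t q.1) (fun q => t' q.1) = k.pt a b (t a) (t' b) := by
    rintro A B C h rfl rfl
    exact (k.pt_eq h t t').symm
  simp only [f, hw, dif_pos]
  exact key hw ((hxx _ _ Set.subset_union_left).trans ha)
    ((hxx _ _ Set.subset_union_right).trans hb)

/-- By the Leibniz rule for `⊙`, with `r ⊡ 1` realized as the smooth section that is `r` on `U` and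
`1` outside `U`. -/
theorem Kernel.smoothBracket_mul_left {r₁ r₂ r' : ∀ p : M, SymmetricAlgebra K (V.fiber p)}
    (h₁ : ∀ p ∈ restrict x U, V.sym.SmoothAt r₁ p) (h₂ : ∀ p ∈ restrict x U, V.sym.SmoothAt r₂ p)
    (hr₁ : k.SmoothBracket x U U' r₁ r') (hr₂ : k.SmoothBracket x U U' r₂ r') :
    k.SmoothBracket x U U' (fun q => r₁ q * r₂ q) r' := by
  obtain ⟨g₁, hg₁, e₁⟩ := hr₁
  obtain ⟨g₂, hg₂, e₂⟩ := hr₂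
  have hX := manifold_regular K d M
  have hS : V.sym.Sheafy := sym_isGenerated.sheafy hX
  have sm : ∀ {r : ∀ p : M, SymmetricAlgebra K (V.fiber p)},
      (∀ p ∈ restrict x U, V.sym.SmoothAt r p) →
      V.sym.cauchySym.SmoothAt (fun y => boxProd V.sym y (glue U r fun _ => 1)) x := fun h =>
    smoothAt_boxProd (smoothAt_glue hS hU hU' hd hx h fun p _ => sym_smoothAt_one hX p)
  refine ⟨_, cauchySym_sheafy.add (odot_smoothAt hg₁ (sm h₂)) (odot_smoothAt (sm h₁) hg₂), ?_⟩
  filter_upwards [e₁, e₂] with y h₁ h₂ h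
  have hg : ∀ r : ∀ p : M, SymmetricAlgebra K (V.fiber p),
      boxdot V.sym h (boxProd V.sym (restrict y U) r) (oneAt V (restrict y U')) =
        boxProd V.sym y (glue U r fun _ => 1) := fun r =>
    boxdot_boxProd V.sym h r (fun _ => 1) _ (fun p hp => glue_mem (mem_restrict.1 hp).2)
      fun p hp => glue_notMem (Set.disjoint_right.1 hd (mem_restrict.1 hp).2)
  rw [← odot_boxProd, Kernel.bracket_odot_left, hg, hg, h₁ h, h₂ h]

theorem Kernel.smoothBracket_mul_right {r r₁ r₂ : ∀ p : M, SymmetricAlgebra K (V.fiber p)}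
    (h₁ : ∀ p ∈ restrict x U', V.sym.SmoothAt r₁ p) (h₂ : ∀ p ∈ restrict x U', V.sym.SmoothAt r₂ p)
    (hr₁ : k.SmoothBracket x U U' r r₁) (hr₂ : k.SmoothBracket x U U' r r₂) :
    k.SmoothBracket x U U' r (fun q => r₁ q * r₂ q) := by
  obtain ⟨g₁, hg₁, e₁⟩ := hr₁
  obtain ⟨g₂, hg₂, e₂⟩ := hr₂
  have hX := manifold_regular K d M
  have hS : V.sym.Sheafy := sym_isGenerated.sheafy hX
  have sm : ∀ {r : ∀ p : M, SymmetricAlgebra K (V.fiber p)},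
      (∀ p ∈ restrict x U', V.sym.SmoothAt r p) →
      V.sym.cauchySym.SmoothAt (fun y => boxProd V.sym y (glue U (fun _ => 1) r)) x := fun h =>
    smoothAt_boxProd (smoothAt_glue hS hU hU' hd hx (fun p _ => sym_smoothAt_one hX p) h)
  refine ⟨_, cauchySym_sheafy.add (odot_smoothAt hg₁ (sm h₂)) (odot_smoothAt (sm h₁) hg₂), ?_⟩
  filter_upwards [e₁, e₂] with y h₁ h₂ h
  have hg : ∀ r : ∀ p : M, SymmetricAlgebra K (V.fiber p),
      boxdot V.sym h (oneAt V (restrict y U)) (boxProd V.sym (restrict y U') r) =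
        boxProd V.sym y (glue U (fun _ => 1) r) := fun r =>
    boxdot_boxProd V.sym h (fun _ => 1) r _ (fun p hp => glue_mem (mem_restrict.1 hp).2)
      fun p hp => glue_notMem (Set.disjoint_right.1 hd (mem_restrict.1 hp).2)
  rw [← odot_boxProd, Kernel.bracket_odot_right, hg, hg, h₁ h, h₂ h]

/-- Induction on the factors of both arguments; an empty product is a unit, whose brackets vanish.
-/
theorem Kernel.smoothBracket_prod {ι κ : Type*} (J : Finset ι) (J' : Finset κ)
    {r : ι → ∀ p : M, SymmetricAlgebra K (V.fiber p)}
    {r' : κ → ∀ p : M, SymmetricAlgebra K (V.fiber p)}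
    (hr : ∀ l ∈ J, IsElementary V (r l) (restrict x U))
    (hr' : ∀ l ∈ J', IsElementary V (r' l) (restrict x U')) :
    k.SmoothBracket x U U' (fun q => ∏ l ∈ J, r l q) (fun q => ∏ l ∈ J', r' l q) := by
  classical
  have hX := manifold_regular K d M
  have hone : ∀ p : M, V.sym.SmoothAt (fun q => (1 : SymmetricAlgebra K (V.fiber q))) p :=
    sym_smoothAt_one hX
  induction J using Finset.induction_on with
  | empty =>
    refine ⟨fun _ => 0, cauchySym_sheafy.zero x, Eventually.of_forall fun y h => ?_⟩
    simp only [Finset.prod_empty]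
    exact (k.bracket_one_left h _).symm
  | insert l J hl ih =>
    simp only [Finset.prod_insert hl]
    refine k.smoothBracket_mul_left hU hU' hd hx
      (fun p hp => (hr l (Finset.mem_insert_self l J)).smoothAt hp)
      (fun p hp => sym_smoothAt_prod hX J fun i hi =>
        (hr i (Finset.mem_insert_of_mem hi)).smoothAt hp) ?_
      (ih fun i hi => hr i (Finset.mem_insert_of_mem hi))
    have hl' := hr l (Finset.mem_insert_self l J)
    clear ih hr
    induction J' using Finset.induction_on with
    | empty =>
      refine ⟨fun _ => 0, cauchySym_sheafy.zero x, Eventually.of_forall fun y h => ?_⟩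
      simp only [Finset.prod_empty]
      exact (k.bracket_one_right h _).symm
    | insert l' J' hl₂ ih =>
      simp only [Finset.prod_insert hl₂]
      exact k.smoothBracket_mul_right hU hU' hd hx
        (fun p hp => (hr' l' (Finset.mem_insert_self l' J')).smoothAt hp)
        (fun p hp => sym_smoothAt_prod hX J' fun i hi =>
          (hr' i (Finset.mem_insert_of_mem hi)).smoothAt hp)
        (k.smoothBracket_elementary hU hU' hd hx hl' (hr' l' (Finset.mem_insert_self l' J')))
        (ih fun i hi => hr' i (Finset.mem_insert_of_mem hi))

omit hU hU' hd hx

theorem Kernel.bracket_smoothBilin : SmoothBilin k.bracketLinear := by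
  refine smoothBilin_of_generators generated_by_elementary generated_by_elementary
    cauchySym_sheafy _ ?_
  rintro x U U' s t hU hU' hd hx ⟨ι, J, r, hr, hs⟩ ⟨κ, J', r', hr', ht⟩
  obtain ⟨g, hg, hev⟩ := k.smoothBracket_prod hU hU' hd hx J J' hr hr'
  refine ⟨g, hg, ?_⟩
  have hx' : ∀ p ∈ x, p ∈ U' ∪ U := fun p hp => (hx p hp).symm
  filter_upwards [hev, (tendsto_restrict hU hU' hd hx).eventually hs,
    (tendsto_restrict hU' hU hd.symm hx').eventually ht] with y h1 h2 h3 h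
  rw [h1 h, h2, h3]
  rfl

/-- The bracket `{ , }_k` as a bundle map. -/
def Kernel.bracketHom : Hom (V.sym.cauchySym.cauchy V.sym.cauchySym) V.sym.cauchySym :=
  cauchyHom k.bracketLinear k.bracket_smoothBilin cauchySym_sheafy

theorem Kernel.bracketHom_on {x y z : Finset M} (h : IsSplit x y z) (a : SFiber V.sym x)
    (b : SFiber V.sym y) : k.bracketHom.on h a b = k.bracket h a b :=
  (cauchyHom_on k.bracketLinear k.bracket_smoothBilin cauchySym_sheafy h a b).trans
    (k.bracketLinear_apply h a b)

theorem Kernel.isKernelBracket : IsKernelBracket k k.bracketHom where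
  unit_right h a := (k.bracketHom_on h _ _).trans (k.bracket_one_right h a)
  unit_left h a := (k.bracketHom_on h _ _).trans (k.bracket_one_left h a)
  gen h u v := (k.bracketHom_on h _ _).trans (k.bracket_gen h u v)
  odot_left h a b c := by
    simp only [Kernel.bracketHom_on]
    exact k.bracket_odot_left h a b c
  odot_right h a b c := by
    simp only [Kernel.bracketHom_on]
    exact k.bracket_odot_right h a b c
  boxdot_left hxy hyz hxz h₁ h₂ h₃ a b c := by
    simp only [Kernel.bracketHom_on]
    exact k.bracket_boxdot_left hxy hyz hxz h₁ h₂ h₃ a b c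
  boxdot_right hxy hyz hxz h₁ h₂ h₃ a b c := by
    simp only [Kernel.bracketHom_on]
    exact k.bracket_boxdot_right hxy hyz hxz h₁ h₂ h₃ a b c

/-- The Poisson `⊠`-algebra bundle `S^⊠ S^⊗ V`. -/
def Kernel.poissonAlgebra (hk : k.IsAntisymm) (hV : V.IsVectorBundle) :
    PoissonCauchyAlgebra V.sym.cauchySym where
  toCommCauchyAlgebra := cauchySymAlgebra (sym_isVectorBundle (manifold_regular K d M) hV)
  bracket := k.bracketHom
  antisymm h a b := by
    rw [Kernel.bracketHom_on, Kernel.bracketHom_on]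
    exact k.bracket_antisymm hk h a b
  jacobi hxy hyz hzx h₁ h₂ h₃ a b c := by
    simp only [Kernel.bracketHom_on]
    exact k.bracket_jacobi hk hxy hyz hzx h₁ h₂ h₃ a b c
  leibniz hxy hyz hxz h₁ h₂ h₃ a b c := by
    simp only [Kernel.bracketHom_on, cauchySymAlgebra, boxdotHom_on]
    exact k.bracket_boxdot_right hxy hyz hxz h₁ h₂ h₃ a b c

end Smoothness

/-! ## Identities of bundle maps on generators -/

section Bilinearity

variable {K : Type} [RCLike K] {d : ℕ} {M : Type u} [TopologicalSpace M]
  [ChartedSpace (EuclideanSpace ℝ (Fin d)) M]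

variable {E : BundleData.{u, v} (UConf K d M)} (m : Hom (E.cauchy E) E) {x y z : Finset M}
  (h : IsSplit x y z)

theorem Hom.on_add_left (a a' : E.fiber x) (b : E.fiber y) :
    m.on h (a + a') b = m.on h a b + m.on h a' b := (m.onLinear h).map_add₂ a a' b

theorem Hom.on_add_right (a : E.fiber x) (b b' : E.fiber y) :
    m.on h a (b + b') = m.on h a b + m.on h a b' := (m.onLinear h a).map_add b b'

theorem Hom.on_zero_left (b : E.fiber y) : m.on h 0 b = 0 := (m.onLinear h).map_zero₂ b

theorem Hom.on_zero_right (a : E.fiber x) : m.on h a 0 = 0 := (m.onLinear h a).map_zero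

end Bilinearity

section OfGenerators

variable {K : Type} [RCLike K] {d : ℕ} {M : Type u} [TopologicalSpace M]
  [ChartedSpace (EuclideanSpace ℝ (Fin d)) M] {E : BundleData.{u, v} (UConf K d M)}

/-- The vectors in `S` generate the fibres of `E` as additive monoids. -/
def BundleData.AddGenerated (E : BundleData.{u, v} (UConf K d M)) (S : ∀ x, Set (E.fiber x)) :
    Prop :=
  ∀ (x : Finset M) (P : E.fiber x → Prop), P 0 → (∀ a ∈ S x, P a) →
    (∀ a b, P a → P b → P (a + b)) → ∀ a, P a

variable {S : ∀ x, Set (E.fiber x)} (hS : E.AddGenerated S) (m n : Hom (E.cauchy E) E)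

include hS

theorem BundleData.AddGenerated.induction {x : Finset M} {P : E.fiber x → Prop} (zero : P 0)
    (mem : ∀ a ∈ S x, P a) (add : ∀ a b, P a → P b → P (a + b)) (a : E.fiber x) : P a :=
  hS x P zero mem add a

/-- Both sides are additive in each variable. This and the following lemmas are meant for Hadamard
products, whose fibres are additively generated by pure tensors. -/
theorem assoc_of_generators {x y z xy yz w : Finset M} (h₁ : IsSplit x y xy) (h₂ : IsSplit xy z w)
    (h₃ : IsSplit y z yz) (h₄ : IsSplit x yz w)
    (h : ∀ a ∈ S x, ∀ b ∈ S y, ∀ c ∈ S z, m.on h₂ (m.on h₁ a b) c = m.on h₄ a (m.on h₃ b c))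
    (a : E.fiber x) (b : E.fiber y) (c : E.fiber z) :
    m.on h₂ (m.on h₁ a b) c = m.on h₄ a (m.on h₃ b c) := by
  induction a using hS.induction with
  | zero => simp only [Hom.on_zero_left]
  | add a a' ha ha' => simp only [Hom.on_add_left, ha, ha']
  | mem a ha =>
    induction b using hS.induction with
    | zero => simp only [Hom.on_zero_left, Hom.on_zero_right]
    | add b b' hb hb' => simp only [Hom.on_add_left, Hom.on_add_right, hb, hb']
    | mem b hb =>
      induction c using hS.induction with
      | zero => simp only [Hom.on_zero_right]
      | add c c' hc hc' => simp only [Hom.on_add_right, hc, hc']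
      | mem c hc => exact h a ha b hb c hc

theorem comm_of_generators {x y z : Finset M} (hxy : IsSplit x y z)
    (h : ∀ a ∈ S x, ∀ b ∈ S y, m.on hxy a b = m.on hxy.symm b a)
    (a : E.fiber x) (b : E.fiber y) : m.on hxy a b = m.on hxy.symm b a := by
  induction a using hS.induction with
  | zero => simp only [Hom.on_zero_left, Hom.on_zero_right]
  | add a a' ha ha' => simp only [Hom.on_add_left, Hom.on_add_right, ha, ha']
  | mem a ha =>
    induction b using hS.induction with
    | zero => simp only [Hom.on_zero_left, Hom.on_zero_right]
    | add b b' hb hb' => simp only [Hom.on_add_left, Hom.on_add_right, hb, hb']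
    | mem b hb => exact h a ha b hb

theorem antisymm_of_generators {x y z : Finset M} (hxy : IsSplit x y z)
    (h : ∀ a ∈ S x, ∀ b ∈ S y, m.on hxy a b = -m.on hxy.symm b a)
    (a : E.fiber x) (b : E.fiber y) : m.on hxy a b = -m.on hxy.symm b a := by
  induction a using hS.induction with
  | zero => simp only [Hom.on_zero_left, Hom.on_zero_right, neg_zero]
  | add a a' ha ha' => rw [Hom.on_add_left, Hom.on_add_right, ha, ha', neg_add]
  | mem a ha =>
    induction b using hS.induction with
    | zero => simp only [Hom.on_zero_left, Hom.on_zero_right, neg_zero]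
    | add b b' hb hb' => rw [Hom.on_add_left, Hom.on_add_right, hb, hb', neg_add]
    | mem b hb => exact h a ha b hb

theorem jacobi_of_generators {x y z xy yz zx w : Finset M} (hxy : IsSplit x y xy)
    (hyz : IsSplit y z yz) (hzx : IsSplit z x zx) (h₁ : IsSplit xy z w) (h₂ : IsSplit yz x w)
    (h₃ : IsSplit zx y w)
    (h : ∀ a ∈ S x, ∀ b ∈ S y, ∀ c ∈ S z, m.on h₁ (m.on hxy a b) c + m.on h₂ (m.on hyz b c) a +
      m.on h₃ (m.on hzx c a) b = 0)
    (a : E.fiber x) (b : E.fiber y) (c : E.fiber z) :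
    m.on h₁ (m.on hxy a b) c + m.on h₂ (m.on hyz b c) a + m.on h₃ (m.on hzx c a) b = 0 := by
  have aux : ∀ {p q r p' q' r' : E.fiber w}, p + q + r = 0 → p' + q' + r' = 0 →
      p + p' + (q + q') + (r + r') = 0 := by
    intro p q r p' q' r' e e'
    rw [← add_zero (0 : E.fiber w)]
    nth_rewrite 1 [← e]
    rw [← e']
    abel
  induction a using hS.induction with
  | zero => simp only [Hom.on_zero_left, Hom.on_zero_right, add_zero]
  | add a a' ha ha' =>
    simp only [Hom.on_add_left, Hom.on_add_right]
    exact aux ha ha'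
  | mem a ha =>
    induction b using hS.induction with
    | zero => simp only [Hom.on_zero_left, Hom.on_zero_right, add_zero]
    | add b b' hb hb' =>
      simp only [Hom.on_add_left, Hom.on_add_right]
      exact aux hb hb'
    | mem b hb =>
      induction c using hS.induction with
      | zero => simp only [Hom.on_zero_left, Hom.on_zero_right, add_zero]
      | add c c' hc hc' =>
        simp only [Hom.on_add_left, Hom.on_add_right]
        exact aux hc hc'
      | mem c hc => exact h a ha b hb c hc

theorem leibniz_of_generators {x y z xy yz xz w : Finset M} (hxy : IsSplit x y xy)
    (hyz : IsSplit y z yz) (hxz : IsSplit x z xz) (h₁ : IsSplit x yz w) (h₂ : IsSplit xy z w)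
    (h₃ : IsSplit y xz w)
    (h : ∀ a ∈ S x, ∀ b ∈ S y, ∀ c ∈ S z,
      n.on h₁ a (m.on hyz b c) = m.on h₂ (n.on hxy a b) c + m.on h₃ b (n.on hxz a c))
    (a : E.fiber x) (b : E.fiber y) (c : E.fiber z) :
    n.on h₁ a (m.on hyz b c) = m.on h₂ (n.on hxy a b) c + m.on h₃ b (n.on hxz a c) := by
  induction a using hS.induction with
  | zero => simp only [Hom.on_zero_left, Hom.on_zero_right, add_zero]
  | add a a' ha ha' =>
    simp only [Hom.on_add_left, Hom.on_add_right, ha, ha']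
    abel
  | mem a ha =>
    induction b using hS.induction with
    | zero => simp only [Hom.on_zero_left, Hom.on_zero_right, add_zero]
    | add b b' hb hb' =>
      simp only [Hom.on_add_left, Hom.on_add_right, hb, hb']
      abel
    | mem b hb =>
      induction c using hS.induction with
      | zero => simp only [Hom.on_zero_right, add_zero]
      | add c c' hc hc' =>
        simp only [Hom.on_add_right, hc, hc']
        abel
      | mem c hc => exact h a ha b hb c hc

theorem unit_of_generators {x y z : Finset M} (hxy : IsSplit x y z) (e : E.fiber x)
    {f : E.fiber y →ₗ[K] E.fiber z} (h : ∀ a ∈ S y, m.on hxy e a = f a) (a : E.fiber y) :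
    m.on hxy e a = f a := by
  induction a using hS.induction with
  | zero => rw [Hom.on_zero_right, map_zero]
  | add a a' ha ha' => rw [Hom.on_add_right, ha, ha', map_add]
  | mem a ha => exact h a ha

end OfGenerators

/-! ## Hadamard tensor products of `⊠`-algebra bundles -/

section HadamardAlgebra

variable {K : Type} [RCLike K] {d : ℕ} {M : Type u} [TopologicalSpace M]
  [ChartedSpace (EuclideanSpace ℝ (Fin d)) M] {A : BundleData.{u, v} (UConf K d M)}
  {B : BundleData.{u, w} (UConf K d M)}

/-- The componentwise operation `(a ⊗ b, a' ⊗ b') ↦ α (a, a') ⊗ β (b, b')`. -/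
def tensorBilin (α : SplitBilin A A A) (β : SplitBilin B B B) :
    SplitBilin (A.hadamard B) (A.hadamard B) (A.hadamard B) :=
  fun h => TensorProduct.map₂ (α h) (β h)

theorem tensorBilin_tmul (α : SplitBilin A A A) (β : SplitBilin B B B) {x y z : Finset M}
    (h : IsSplit x y z) (a : A.fiber x) (b : B.fiber x) (a' : A.fiber y) (b' : B.fiber y) :
    tensorBilin α β h (a ⊗ₜ[K] b) (a' ⊗ₜ[K] b') = α h a a' ⊗ₜ[K] β h b b' :=
  (DFunLike.congr_fun (TensorProduct.map₂_apply_tmul (α h) (β h) a b) (a' ⊗ₜ[K] b')).trans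
    (TensorProduct.map_tmul _ _ _ _)

variable [T2Space M]

theorem hadamard_sheafy : (A.hadamard B).Sheafy :=
  hadamard_isGenerated.sheafy (uConf_regular K d M)

/-- On tensor products of smooth sections the result is the tensor product of the sections produced
by `α` and by `β`, each extended by zero where `U` and `U'` do not split the configuration. -/
theorem tensorBilin_smoothBilin {α : SplitBilin A A A} {β : SplitBilin B B B}
    (hα : SmoothBilin α) (hβ : SmoothBilin β) : SmoothBilin (tensorBilin α β) := by
  classical
  refine smoothBilin_of_generators (fun s x => (hadamard_isGenerated s x).1)
    (fun s x => (hadamard_isGenerated s x).1) hadamard_sheafy _ ?_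
  rintro x U U' _ _ hU hU' hd hx ⟨a, b, ha, hb, rfl⟩ ⟨a', b', ha', hb', rfl⟩
  let g : ∀ y, A.fiber y := fun y => if h : IsSplit (restrict y U) (restrict y U') y then
    α h (a (restrict y U)) (a' (restrict y U')) else 0
  let f : ∀ y, B.fiber y := fun y => if h : IsSplit (restrict y U) (restrict y U') y then
    β h (b (restrict y U)) (b' (restrict y U')) else 0
  have hg : A.SmoothAt g x := hα x U U' a a' hU hU' hd hx ha ha' g fun y h => by simp only [g, h, dif_pos]
  have hf : B.SmoothAt f x := hβ x U U' b b' hU hU' hd hx hb hb' f fun y h => by simp only [f, h, dif_pos]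
  refine ⟨_, smoothAt_tmul (uConf_regular K d M) hg hf, Eventually.of_forall fun y h => ?_⟩
  simp only [g, f, h, dif_pos]
  exact (tensorBilin_tmul α β h _ _ _ _).symm

/-- The bundle map of a componentwise operation. -/
def tensorHom (m : Hom (A.cauchy A) A) (hA : A.Sheafy) (n : Hom (B.cauchy B) B) (hB : B.Sheafy) :
    Hom ((A.hadamard B).cauchy (A.hadamard B)) (A.hadamard B) :=
  cauchyHom (tensorBilin m.onLinear n.onLinear)
    (tensorBilin_smoothBilin (m.smoothBilin hA) (n.smoothBilin hB)) hadamard_sheafy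

theorem tensorHom_on_tmul (m : Hom (A.cauchy A) A) (hA : A.Sheafy) (n : Hom (B.cauchy B) B)
    (hB : B.Sheafy) {x y z : Finset M} (h : IsSplit x y z) (a : A.fiber x) (b : B.fiber x)
    (a' : A.fiber y) (b' : B.fiber y) :
    (tensorHom m hA n hB).on h (a ⊗ₜ[K] b) (a' ⊗ₜ[K] b') = m.on h a a' ⊗ₜ[K] n.on h b b' :=
  (cauchyHom_on _ _ hadamard_sheafy h _ _).trans (tensorBilin_tmul _ _ h a b a' b')

variable (P : PoissonCauchyAlgebra A) (C : CommCauchyAlgebra B)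

/-- The product on the Hadamard tensor product. -/
def hadamardMul : Hom ((A.hadamard B).cauchy (A.hadamard B)) (A.hadamard B) :=
  tensorHom P.mul (P.isVectorBundle.sheafy (uConf_regular K d M)) C.mul
    (C.isVectorBundle.sheafy (uConf_regular K d M))

/-- The bracket on the Hadamard tensor product. -/
def hadamardBracket : Hom ((A.hadamard B).cauchy (A.hadamard B)) (A.hadamard B) :=
  tensorHom P.bracket (P.isVectorBundle.sheafy (uConf_regular K d M)) C.mul
    (C.isVectorBundle.sheafy (uConf_regular K d M))

theorem hadamardMul_on {x y z : Finset M} (h : IsSplit x y z) (a : A.fiber x) (b : B.fiber x)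
    (a' : A.fiber y) (b' : B.fiber y) : (hadamardMul P C).on h (a ⊗ₜ[K] b) (a' ⊗ₜ[K] b') =
      P.mul.on h a a' ⊗ₜ[K] C.mul.on h b b' :=
  tensorHom_on_tmul _ _ _ _ h a b a' b'

theorem hadamardBracket_on {x y z : Finset M} (h : IsSplit x y z) (a : A.fiber x) (b : B.fiber x)
    (a' : A.fiber y) (b' : B.fiber y) : (hadamardBracket P C).on h (a ⊗ₜ[K] b) (a' ⊗ₜ[K] b') =
      P.bracket.on h a a' ⊗ₜ[K] C.mul.on h b b' :=
  tensorHom_on_tmul _ _ _ _ h a b a' b'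

/-- The unit of the Hadamard tensor product. -/
def hadamardUnit : Hom (cauchyUnit K d M) (A.hadamard B) :=
  unitHom (A.hadamard B) hadamard_sheafy
    (fun x => P.unit.app x (fun _ => 1) ⊗ₜ[K] C.unit.app x fun _ => 1)
    (smoothAt_tmul (uConf_regular K d M) (P.unit.smooth (fun _ _ => 1) _ trivial)
      (C.unit.smooth (fun _ _ => 1) _ trivial))

theorem hadamardUnit_app (c : (cauchyUnit K d M).fiber (∅ : Finset M)) :
    (hadamardUnit P C).app (∅ : Finset M) c = c ⟨(), rfl⟩ •
      (P.unit.app (∅ : Finset M) (fun _ => 1) ⊗ₜ[K] C.unit.app (∅ : Finset M) fun _ => 1) :=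
  unitHom_app _ _ _ _ c

omit [T2Space M] in
theorem hadamard_addGenerated : (A.hadamard B).AddGenerated fun x =>
    Set.range fun q : A.fiber x × B.fiber x => q.1 ⊗ₜ[K] q.2 :=
  fun _ P h0 h1 h2 a => TensorProduct.induction_on (motive := P) a h0
    (fun a b => h1 _ ⟨(a, b), rfl⟩) h2

/-- The Hadamard tensor product of a Poisson `⊠`-algebra bundle and a commutative `⊠`-algebra
bundle. -/
def hadamardPoisson : PoissonCauchyAlgebra (A.hadamard B) where
  isVectorBundle := hadamard_isVectorBundle (uConf_regular K d M) P.isVectorBundle C.isVectorBundle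
  mul := hadamardMul P C
  unit := hadamardUnit P C
  mul_assoc h₁ h₂ h₃ h₄ := by
    refine assoc_of_generators hadamard_addGenerated _ h₁ h₂ h₃ h₄ ?_
    rintro _ ⟨⟨a, a'⟩, rfl⟩ _ ⟨⟨b, b'⟩, rfl⟩ _ ⟨⟨c, c'⟩, rfl⟩
    simp only [hadamardMul_on, P.mul_assoc h₁ h₂ h₃ h₄, C.mul_assoc h₁ h₂ h₃ h₄]
  one_mul x := by
    refine unit_of_generators hadamard_addGenerated _ _ _ (f := LinearMap.id) ?_
    rintro _ ⟨⟨a, a'⟩, rfl⟩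
    rw [hadamardUnit_app, one_smul, hadamardMul_on, P.one_mul, C.one_mul]
    rfl
  mul_one x a := by
    refine (comm_of_generators hadamard_addGenerated _ _ ?_ _ _).trans
      (unit_of_generators hadamard_addGenerated _ _ _ (f := LinearMap.id) ?_ a)
    · rintro _ ⟨⟨a, a'⟩, rfl⟩ _ ⟨⟨b, b'⟩, rfl⟩
      rw [hadamardMul_on, hadamardMul_on, P.mul_comm, C.mul_comm]
    · rintro _ ⟨⟨a, a'⟩, rfl⟩
      rw [hadamardUnit_app, one_smul, hadamardMul_on, P.one_mul, C.one_mul]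
      rfl
  mul_comm h := by
    refine comm_of_generators hadamard_addGenerated _ h ?_
    rintro _ ⟨⟨a, a'⟩, rfl⟩ _ ⟨⟨b, b'⟩, rfl⟩
    rw [hadamardMul_on, hadamardMul_on, P.mul_comm, C.mul_comm]
  bracket := hadamardBracket P C
  antisymm h := by
    refine antisymm_of_generators hadamard_addGenerated _ h ?_
    rintro _ ⟨⟨a, a'⟩, rfl⟩ _ ⟨⟨b, b'⟩, rfl⟩
    rw [hadamardBracket_on, hadamardBracket_on, P.antisymm h, C.mul_comm h]
    exact TensorProduct.neg_tmul _ _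
  jacobi hxy hyz hzx h₁ h₂ h₃ := by
    refine jacobi_of_generators hadamard_addGenerated _ hxy hyz hzx h₁ h₂ h₃ ?_
    rintro _ ⟨⟨a, a'⟩, rfl⟩ _ ⟨⟨b, b'⟩, rfl⟩ _ ⟨⟨c, c'⟩, rfl⟩
    simp only [hadamardBracket_on]
    -- Commutativity and associativity identify the three cyclic products in `B`; the common factor
    -- splits off and leaves the Jacobi identity of `P`.
    have e₁ : C.mul.on h₂ (C.mul.on hyz b' c') a' = C.mul.on h₁ (C.mul.on hxy a' b') c' := by
      rw [C.mul_comm h₂, C.mul_assoc hxy h₁ hyz h₂.symm]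
    have e₂ : C.mul.on h₃ (C.mul.on hzx c' a') b' = C.mul.on h₁ (C.mul.on hxy a' b') c' := by
      rw [C.mul_assoc hzx h₃ hxy h₁.symm, C.mul_comm h₁]
    rw [e₁, e₂]
    refine (congrArg₂ (· + ·) (TensorProduct.add_tmul _ _ _).symm rfl).trans
      ((TensorProduct.add_tmul _ _ _).symm.trans ?_)
    rw [P.jacobi hxy hyz hzx h₁ h₂ h₃]
    exact TensorProduct.zero_tmul _ _
  leibniz hxy hyz hxz h₁ h₂ h₃ := by
    refine leibniz_of_generators hadamard_addGenerated _ _ hxy hyz hxz h₁ h₂ h₃ ?_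
    rintro _ ⟨⟨a, a'⟩, rfl⟩ _ ⟨⟨b, b'⟩, rfl⟩ _ ⟨⟨c, c'⟩, rfl⟩
    simp only [hadamardBracket_on, hadamardMul_on]
    have e : C.mul.on h₃ b' (C.mul.on hxz a' c') = C.mul.on h₂ (C.mul.on hxy a' b') c' := by
      rw [← C.mul_assoc hxy.symm h₂ hxz h₃, ← C.mul_comm hxy]
    rw [e, ← C.mul_assoc hxy h₂ hyz h₁, P.leibniz hxy hyz hxz h₁ h₂ h₃]
    exact TensorProduct.add_tmul _ _ _

end HadamardAlgebra

/-! ## Transport of Poisson structures -/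

section Transport

variable {K : Type} [RCLike K] {d : ℕ} {M : Type u} [TopologicalSpace M]
  [ChartedSpace (EuclideanSpace ℝ (Fin d)) M] {A : BundleData.{u, v} (UConf K d M)}
  {B : BundleData.{u, w} (UConf K d M)} (Φ : Iso A B)

theorem Iso.injective (x : Finset M) : Injective (Φ.hom.app x) :=
  LeftInverse.injective (g := Φ.inv.app x) (Φ.hom_inv x)

/-- The pullback of an operation under an isomorphism. -/
def pullbackBilin (β : SplitBilin B B B) : SplitBilin A A A := fun {x y z} h =>
  ((β h).compr₂ (Φ.inv.app z)).compl₁₂ (Φ.hom.app x) (Φ.hom.app y)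

theorem pullbackBilin_smoothBilin {β : SplitBilin B B B} (hβ : SmoothBilin β) :
    SmoothBilin (pullbackBilin Φ β) := by
  intro x U U' s t hU hU' hd hx hs ht g hg
  have h := Φ.inv.smooth (fun y => Φ.hom.app y (g y)) x
    (hβ x U U' _ _ hU hU' hd hx (Φ.hom.smooth s _ hs) (Φ.hom.smooth t _ ht) _ fun y h => by
      rw [hg y h]
      exact Φ.inv_hom _ _)
  simpa only [Φ.hom_inv] using h

variable [T2Space M]

/-- The pullback of a bundle map under an isomorphism. -/
def pullbackHom (m : Hom (B.cauchy B) B) (hB : B.Sheafy) (hA : A.Sheafy) : Hom (A.cauchy A) A :=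
  cauchyHom (pullbackBilin Φ m.onLinear) (pullbackBilin_smoothBilin Φ (m.smoothBilin hB)) hA

theorem hom_app_pullbackHom (m : Hom (B.cauchy B) B) (hB : B.Sheafy) (hA : A.Sheafy)
    {x y z : Finset M} (h : IsSplit x y z) (a : A.fiber x) (b : A.fiber y) :
    Φ.hom.app z ((pullbackHom Φ m hB hA).on h a b) =
      m.on h (Φ.hom.app x a) (Φ.hom.app y b) := by
  unfold pullbackHom
  rw [cauchyHom_on]
  exact Φ.inv_hom _ _

/-- The pullback of a Poisson structure under an isomorphism of `⊠`-algebra bundles. -/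
def pullbackPoisson (C : CommCauchyAlgebra A) (Q : PoissonCauchyAlgebra B)
    (hmul : ∀ {x y z : Finset M} (h : IsSplit x y z) (a : A.fiber x) (b : A.fiber y),
      Φ.hom.app z (C.mul.on h a b) = Q.mul.on h (Φ.hom.app x a) (Φ.hom.app y b)) :
    PoissonCauchyAlgebra A where
  toCommCauchyAlgebra := C
  bracket := pullbackHom Φ Q.bracket (Q.isVectorBundle.sheafy (uConf_regular K d M))
    (C.isVectorBundle.sheafy (uConf_regular K d M))
  antisymm h a b := by
    apply Φ.injective
    rw [map_neg, hom_app_pullbackHom, hom_app_pullbackHom]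
    exact Q.antisymm h _ _
  jacobi hxy hyz hzx h₁ h₂ h₃ a b c := by
    apply Φ.injective
    simp only [map_add, hom_app_pullbackHom, map_zero]
    exact Q.jacobi hxy hyz hzx h₁ h₂ h₃ _ _ _
  leibniz hxy hyz hxz h₁ h₂ h₃ a b c := by
    apply Φ.injective
    simp only [map_add, hom_app_pullbackHom, hmul]
    exact Q.leibniz hxy hyz hxz h₁ h₂ h₃ _ _ _

end Transport

/-! ## The isomorphism `S^⊠ (E ⊗ F) ≅ S^⊠ E ⊗ S^⊠ F` -/

section Canonical

variable {K : Type} [RCLike K] {d : ℕ} {M : Type u} [TopologicalSpace M]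
  [ChartedSpace (EuclideanSpace ℝ (Fin d)) M] (E : BundleData.{u, v} (manifold K d M))
  (F : BundleData.{u, w} (manifold K d M))

/-- The map `⨂ E_p × ⨂ F_p → ⨂ (E_p ⊗ F_p)`. -/
def zipLinear (x : Finset M) :
    SFiber E x →ₗ[K] SFiber F x →ₗ[K] SFiber (E.hadamard F) x :=
  let e : (⨂[K] p : x, E.fiber p.1 ⊗[K] F.fiber p.1) →ₗ[K] SFiber (E.hadamard F) x :=
    (sEquiv (E.hadamard F) x).symm.toLinearMap
  ((PiTensorProduct.map₂ fun p : x => TensorProduct.mk K (E.fiber p.1) (F.fiber p.1)).compr₂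
    e).compl₁₂ (sEquiv E x).toLinearMap (sEquiv F x).toLinearMap

theorem zipLinear_boxProd (x : Finset M) (s : ∀ p, E.fiber p) (t : ∀ p, F.fiber p) :
    zipLinear E F x (boxProd E x s) (boxProd F x t) =
      boxProd (E.hadamard F) x fun p => s p ⊗ₜ[K] t p := by
  have h1 := sEquiv_boxProd E x s
  have h2 := sEquiv_boxProd F x t
  refine Eq.trans ?_ (sEquiv_symm_tprod (E.hadamard F) x fun p => s p ⊗ₜ[K] t p)
  refine congrArg (sEquiv (E.hadamard F) x).symm ?_
  refine (congrArg₂ (fun a b => PiTensorProduct.map₂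
    (fun p : x => TensorProduct.mk K (E.fiber p.1) (F.fiber p.1)) a b) h1 h2).trans ?_
  exact PiTensorProduct.map₂_tprod_tprod _ _ _

theorem exists_basis (V : BundleData.{u, v} (manifold K d M)) (x : Finset M) {κ : x → Type*}
    (b : ∀ p : x, Module.Basis (κ p) K (V.fiber p.1)) :
    ∃ B : Module.Basis (∀ p, κ p) K (SFiber V x), ∀ (a : ∀ p, κ p) (s : ∀ p : M, V.fiber p),
      (∀ p : x, s p.1 = b p (a p)) → B a = boxProd V x s := by
  refine ⟨(Basis.piTensorProduct b).map (sEquiv V x).symm, fun a s hs => ?_⟩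
  rw [Module.Basis.map_apply, Basis.piTensorProduct_apply, ← sEquiv_symm_tprod]
  congr 2
  exact funext fun p => (hs p).symm

/-- The map carries a tensor product basis to a tensor product basis: a pair of choices over the
points of `x` is the same as a choice of pairs. -/
theorem zip_bijective (x : Finset M) : Bijective (TensorProduct.lift (zipLinear E F x)) := by
  classical
  let b := fun p : x => Module.Basis.ofVectorSpace K (E.fiber p.1)
  let c := fun p : x => Module.Basis.ofVectorSpace K (F.fiber p.1)
  obtain ⟨B, hB⟩ := exists_basis E x b
  obtain ⟨C, hC⟩ := exists_basis F x c
  obtain ⟨D, hD⟩ := exists_basis (E.hadamard F) x fun p => (b p).tensorProduct (c p)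
  let e := (B.tensorProduct C).equiv D (Equiv.arrowProdEquivProdArrow _ _ _).symm
  have h : TensorProduct.lift (zipLinear E F x) = e.toLinearMap := by
    refine (B.tensorProduct C).ext fun ij => ?_
    obtain ⟨i, j⟩ := ij
    obtain ⟨s, hs⟩ := exists_extension E x fun p => b p (i p)
    obtain ⟨t, ht⟩ := exists_extension F x fun p => c p (j p)
    have h1 := hB i s (congrFun hs)
    have h2 := hC j t (congrFun ht)
    have h3 := hD (fun p => (i p, j p)) (fun p => s p ⊗ₜ[K] t p) fun p =>
      (congrArg₂ (· ⊗ₜ[K] ·) (congrFun hs p) (congrFun ht p)).trans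
        (Module.Basis.tensorProduct_apply (b p) (c p) (i p) (j p)).symm
    refine Eq.trans ?_ ((Module.Basis.equiv_apply _ _ _ _).symm)
    refine Eq.trans ?_ h3.symm
    rw [Module.Basis.tensorProduct_apply, TensorProduct.lift.tmul, h1, h2]
    exact zipLinear_boxProd E F x s t
  rw [h]
  exact e.bijective

/-- The isomorphism `⨂ E_p ⊗ ⨂ F_p ≅ ⨂ (E_p ⊗ F_p)`. -/
def zipEquiv (x : Finset M) :
    (E.cauchySym.hadamard F.cauchySym).fiber x ≃ₗ[K] (E.hadamard F).cauchySym.fiber x :=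
  LinearEquiv.ofBijective (TensorProduct.lift (zipLinear E F x)) (zip_bijective E F x)

theorem zipEquiv_tmul (x : Finset M) (a : SFiber E x) (b : SFiber F x) :
    zipEquiv E F x (a ⊗ₜ[K] b) = zipLinear E F x a b := TensorProduct.lift.tmul _ _

variable [T2Space M]

theorem zipEquiv_smooth (s : ∀ x, (E.cauchySym.hadamard F.cauchySym).fiber x) (x : Finset M)
    (hs : (E.cauchySym.hadamard F.cauchySym).SmoothAt s x) :
    (E.hadamard F).cauchySym.SmoothAt (fun y => zipEquiv E F y (s y)) x := by
  have hC : (E.hadamard F).cauchySym.Sheafy := cauchySym_sheafy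
  refine hadamard_isGenerated.smooth_map hC (fun y => (zipEquiv E F y).toLinearMap) ?_ s x hs
  rintro _ x ⟨s, t, hs, ht, rfl⟩
  obtain ⟨n, c, g, hcg, hs⟩ := (cauchySym_isGenerated _ _).1 hs
  obtain ⟨m, c', g', hcg', ht⟩ := (cauchySym_isGenerated _ _).1 ht
  refine hC.congr (hC.sum Finset.univ fun i _ => hC.sum Finset.univ fun j _ =>
    hC.smul (hcg i).1 (hC.smul (hcg' j).1 (s := fun y => zipLinear E F y (g i y) (g' j y)) ?_)) ?_
  · obtain ⟨a, ha, hg⟩ := (hcg i).2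
    obtain ⟨b, hb, hg'⟩ := (hcg' j).2
    rw [hg, hg']
    simp only [zipLinear_boxProd]
    exact smoothAt_boxProd fun p hp => smoothAt_tmul (manifold_regular K d M) (ha p hp) (hb p hp)
  · filter_upwards [hs, ht] with y h h'
    refine (zipEquiv_tmul E F y _ _).trans ?_
    rw [h, h']
    simp only [map_sum, LinearMap.sum_apply, map_smul, LinearMap.smul_apply]
    rw [Finset.sum_comm]
    refine Finset.sum_congr rfl fun i _ => ?_
    rw [Finset.smul_sum]
    exact Finset.sum_congr rfl fun j _ => smul_comm _ _ _

omit [T2Space M] in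
theorem zipEquiv_symm_boxProd (x : Finset M) (s : ∀ p, E.fiber p) (t : ∀ p, F.fiber p) :
    (zipEquiv E F x).symm (boxProd (E.hadamard F) x fun p => s p ⊗ₜ[K] t p) =
      boxProd E x s ⊗ₜ[K] boxProd F x t := by
  refine (LinearEquiv.symm_apply_eq _).2 ?_
  exact ((zipEquiv_tmul E F x _ _).trans (zipLinear_boxProd E F x s t)).symm

omit [T2Space M] in
theorem pick_tmul {ι : Type*} (N : ι → Set M) (s : ι → ∀ p, E.fiber p) (t : ι → ∀ p, F.fiber p)
    (p : M) : (pick N (F := (E.hadamard F).fiber) fun i p => s i p ⊗ₜ[K] t i p) p =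
      pick N s p ⊗ₜ[K] pick N t p := by
  unfold pick
  by_cases h : ∃ i, p ∈ N i
  · rw [dif_pos h, dif_pos h, dif_pos h]
  · rw [dif_neg h, dif_neg h, dif_neg h]
    exact (TensorProduct.zero_tmul _ _).symm

/-- Near each point a section of `E ⊗ F` is a combination of `a ⊗ b`. After expansion over disjoint
neighbourhoods the `a`'s and the `b`'s can be collected separately by `pick`. -/
theorem zipEquiv_symm_smooth (hE : E.Sheafy) (hF : F.Sheafy)
    (s : ∀ x, (E.hadamard F).cauchySym.fiber x) (x : Finset M)
    (hs : (E.hadamard F).cauchySym.SmoothAt s x) :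
    (E.cauchySym.hadamard F.cauchySym).SmoothAt (fun y => (zipEquiv E F y).symm (s y)) x := by
  classical
  have hC : (E.cauchySym.hadamard F.cauchySym).Sheafy := hadamard_sheafy
  have hX := manifold_regular K d M
  refine cauchySym_isGenerated.smooth_map hC (fun y => (zipEquiv E F y).symm.toLinearMap) ?_ s x hs
  rintro _ x ⟨s, hs, rfl⟩
  choose n c g hcg hev using fun p : x => (hadamard_isGenerated _ _).1 (hs p.1 p.2)
  choose a b ha hb hg using fun p i => (hcg p i).2
  obtain ⟨N, hN, hd, hmem, -⟩ := exists_separation x (fun _ => Set.univ) fun _ _ => univ_mem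
  have hexp := boxProd_expand (V := E.hadamard F) hN hd (Equiv.refl x) hmem
    (fun _ => Finset.univ) c g hev
  refine hC.congr (hC.sum (Fintype.piFinset fun _ => Finset.univ) fun i _ => hC.smul
    (c := fun y => ∏ q ∈ y, pick N (fun p => c p (i p)) q)
    (s := fun y => boxProd E y (pick N fun p => a p (i p)) ⊗ₜ[K]
      boxProd F y (pick N fun p => b p (i p)))
    (smoothAt_prod_mem fun q hq => smoothAt_pick_fun hN hd (hmem ⟨q, hq⟩) (hcg ⟨q, hq⟩ _).1)
    (smoothAt_tmul (uConf_regular K d M) (smoothAt_boxProd fun q hq => ?_)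
      (smoothAt_boxProd fun q hq => ?_))) (hexp.mono fun y hy => ?_)
  · exact smoothAt_pick hE hN hd (hmem ⟨q, hq⟩) (ha ⟨q, hq⟩ _)
  · exact smoothAt_pick hF hN hd (hmem ⟨q, hq⟩) (hb ⟨q, hq⟩ _)
  · refine (congrArg (zipEquiv E F y).symm hy).trans ?_
    rw [map_sum]
    refine Finset.sum_congr rfl fun i _ => ?_
    rw [map_smul]
    congr 1
    refine Eq.trans ?_ (zipEquiv_symm_boxProd E F y _ _)
    congr 2
    funext q
    simp only [hg]
    exact pick_tmul E F N _ _ q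

/-- The canonical isomorphism `S^⊠ (E ⊗ F) ≅ S^⊠ E ⊗ S^⊠ F`. -/
def unzipIso (hE : E.Sheafy) (hF : F.Sheafy) : Iso (E.hadamard F).cauchySym (E.cauchySym.hadamard F.cauchySym) where
  hom := ⟨fun x => (zipEquiv E F x).symm.toLinearMap, zipEquiv_symm_smooth E F hE hF⟩
  inv := ⟨fun x => (zipEquiv E F x).toLinearMap, zipEquiv_smooth E F⟩
  hom_inv x a := (zipEquiv E F x).apply_symm_apply a
  inv_hom x b := (zipEquiv E F x).symm_apply_apply b

theorem unzipIso_boxProd (hE : E.Sheafy) (hF : F.Sheafy) (x : Finset M) (s : ∀ p, E.fiber p) (t : ∀ p, F.fiber p) :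
    (unzipIso E F hE hF).hom.app x (boxProd (E.hadamard F) x fun p => s p ⊗ₜ[K] t p) =
      boxProd E x s ⊗ₜ[K] boxProd F x t :=
  zipEquiv_symm_boxProd E F x s t

omit [T2Space M] in
theorem zipLinear_boxdot {x y z : Finset M} (h : IsSplit x y z) (a : SFiber E x) (b : SFiber E y)
    (α : SFiber F x) (β : SFiber F y) :
    zipLinear E F z (boxdot E h a b) (boxdot F h α β) =
      boxdot (E.hadamard F) h (zipLinear E F x a α) (zipLinear E F y b β) := by
  induction a using sFiber_induction with
  | add a a' ha ha' => simp only [boxdot_add_left, map_add, LinearMap.add_apply, ha, ha']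
  | smul c s =>
    induction b using sFiber_induction with
    | add b b' hb hb' => simp only [boxdot_add_right, map_add, LinearMap.add_apply, hb, hb']
    | smul c' t =>
      induction α using sFiber_induction with
      | add α α' hα hα' => simp only [boxdot_add_left, map_add, hα, hα']
      | smul r σ =>
        induction β using sFiber_induction with
        | add β β' hβ hβ' => simp only [boxdot_add_right, map_add, hβ, hβ']
        | smul r' τ =>
          have key : zipLinear E F z (boxdot E h (boxProd E x s) (boxProd E y t))
              (boxdot F h (boxProd F x σ) (boxProd F y τ)) = boxdot (E.hadamard F) h
              (zipLinear E F x (boxProd E x s) (boxProd F x σ))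
              (zipLinear E F y (boxProd E y t) (boxProd F y τ)) := by
            rw [boxdot_glue E h, boxdot_glue F h, zipLinear_boxProd, zipLinear_boxProd,
              zipLinear_boxProd, boxdot_glue (E.hadamard F) h]
            refine boxProd_congr (E.hadamard F) fun p _ => ?_
            by_cases hp : p ∈ (x : Set M)
            · rw [glue_mem hp, glue_mem hp, glue_mem hp]
            · rw [glue_notMem hp, glue_notMem hp, glue_notMem hp]
          simp only [boxdot_smul_left, boxdot_smul_right, map_smul, LinearMap.smul_apply, key,
            smul_smul]
          congr 1
          ring

/-- It is easier to check that the inverse respects the products: pure tensors suffice there, and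
`zipLinear_boxdot` settles them. -/
theorem unzipIso_boxdot (hE : E.Sheafy) (hF : F.Sheafy) (P : PoissonCauchyAlgebra E.cauchySym) (C : CommCauchyAlgebra F.cauchySym)
    (hP : ∀ {x y z : Finset M} (h : IsSplit x y z) (a : SFiber E x) (b : SFiber E y),
      P.mul.on h a b = boxdot E h a b)
    (hC : ∀ {x y z : Finset M} (h : IsSplit x y z) (a : SFiber F x) (b : SFiber F y),
      C.mul.on h a b = boxdot F h a b) {x y z : Finset M} (h : IsSplit x y z)
    (a : SFiber (E.hadamard F) x) (b : SFiber (E.hadamard F) y) :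
    (unzipIso E F hE hF).hom.app z (boxdot (E.hadamard F) h a b) = (hadamardPoisson P C).mul.on h
      ((unzipIso E F hE hF).hom.app x a) ((unzipIso E F hE hF).hom.app y b) := by
  obtain ⟨a, rfl⟩ := (zipEquiv E F x).surjective a
  obtain ⟨b, rfl⟩ := (zipEquiv E F y).surjective b
  have e1 : (unzipIso E F hE hF).hom.app x (zipEquiv E F x a) = a := (zipEquiv E F x).symm_apply_apply a
  have e2 : (unzipIso E F hE hF).hom.app y (zipEquiv E F y b) = b := (zipEquiv E F y).symm_apply_apply b
  rw [e1, e2]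
  clear e1 e2
  refine (LinearEquiv.symm_apply_eq (zipEquiv E F z)).2 ?_
  induction a using hadamard_addGenerated.induction with
  | zero =>
    rw [Hom.on_zero_left, map_zero, map_zero]
    exact (boxdotLinear (E.hadamard F) h).map_zero₂ _
  | add a a' ha ha' =>
    rw [Hom.on_add_left, map_add, map_add, ← ha, ← ha']
    exact boxdot_add_left _ h _ _ _
  | mem a ha =>
    induction b using hadamard_addGenerated.induction with
    | zero =>
      rw [Hom.on_zero_right, map_zero, map_zero]
      exact (boxdotLinear (E.hadamard F) h _).map_zero
    | add b b' hb hb' =>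
      rw [Hom.on_add_right, map_add, map_add, ← hb, ← hb']
      exact boxdot_add_right _ h _ _ _
    | mem b hb =>
      obtain ⟨⟨a, α⟩, rfl⟩ := ha
      obtain ⟨⟨b, β⟩, rfl⟩ := hb
      have e3 : (hadamardPoisson P C).mul.on h (a ⊗ₜ[K] α) (b ⊗ₜ[K] β) =
          P.mul.on h a b ⊗ₜ[K] C.mul.on h α β := hadamardMul_on P C h a α b β
      have e4 := zipEquiv_tmul E F x a α
      have e5 := zipEquiv_tmul E F y b β
      have e6 := zipEquiv_tmul E F z (boxdot E h a b) (boxdot F h α β)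
      refine Eq.trans ?_ (congrArg (zipEquiv E F z) e3).symm
      rw [hP, hC]
      refine Eq.trans ?_ e6.symm
      rw [zipLinear_boxdot]
      exact congrArg₂ (boxdot (E.hadamard F) h) e4 e5

end Canonical

/-! ## The Poisson-Cauchy algebra bundle -/

section PoissonTensor

variable {K : Type} [RCLike K] {d : ℕ} {M : Type u} [TopologicalSpace M] [T2Space M]
  [ChartedSpace (EuclideanSpace ℝ (Fin d)) M] {V : BundleData.{u, v} (manifold K d M)}
  (k : Kernel V) (hk : k.IsAntisymm) (hV : V.IsVectorBundle)
  {W : BundleData.{u, w} (manifold K d M)} (hW : W.IsVectorBundle)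

theorem cauchySymAlgebra_mul_on {x y z : Finset M} (h : IsSplit x y z) (a : SFiber W x)
    (b : SFiber W y) : (cauchySymAlgebra hW).mul.on h a b = boxdot W h a b :=
  boxdotHom_on (hW.sheafy (manifold_regular K d M)) h a b

theorem Kernel.poissonAlgebra_mul_on {x y z : Finset M} (h : IsSplit x y z) (a : SFiber V.sym x)
    (b : SFiber V.sym y) : (k.poissonAlgebra hk hV).mul.on h a b = boxdot V.sym h a b :=
  cauchySymAlgebra_mul_on (sym_isVectorBundle (manifold_regular K d M) hV) h a b

include hW in
-- `Q` is the Hadamard product of the Poisson bundle `S^⊠ S^⊗ V` with the commutative bundle `S^⊠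
-- W`. `P` keeps the product `⊡` and receives its bracket by pullback along `Φ`.
theorem Kernel.exists_isPoissonTensor :
    ∃ (Φ : Iso (V.sym.hadamard W).cauchySym (V.sym.cauchySym.hadamard W.cauchySym))
      (P : PoissonCauchyAlgebra (V.sym.hadamard W).cauchySym)
      (Q : PoissonCauchyAlgebra (V.sym.cauchySym.hadamard W.cauchySym)),
      IsPoissonTensor V W (k.poissonAlgebra hk hV).bracket Φ P Q := by
  have hX := manifold_regular K d M
  have hX' := uConf_regular K d M
  have hVW := hadamard_isVectorBundle hX (sym_isVectorBundle hX hV) hW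
  have hS : V.sym.Sheafy := sym_isGenerated.sheafy hX
  have hW' := hW.sheafy hX
  let P₀ := k.poissonAlgebra hk hV
  let C := cauchySymAlgebra hW
  let Φ := unzipIso V.sym W hS hW'
  let Q := hadamardPoisson P₀ C
  have hmul : ∀ {x y z : Finset M} (h : IsSplit x y z) (a : SFiber (V.sym.hadamard W) x)
      (b : SFiber (V.sym.hadamard W) y), Φ.hom.app z (boxdot (V.sym.hadamard W) h a b) =
      Q.mul.on h (Φ.hom.app x a) (Φ.hom.app y b) := fun h a b =>
    unzipIso_boxdot V.sym W hS hW' P₀ C (k.poissonAlgebra_mul_on hk hV) (cauchySymAlgebra_mul_on hW) h a b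
  have hmul' : ∀ {x y z : Finset M} (h : IsSplit x y z) (a : SFiber (V.sym.hadamard W) x)
      (b : SFiber (V.sym.hadamard W) y), Φ.hom.app z ((cauchySymAlgebra hVW).mul.on h a b) =
      Q.mul.on h (Φ.hom.app x a) (Φ.hom.app y b) := fun h a b => by
    rw [cauchySymAlgebra_mul_on]
    exact hmul h a b
  refine ⟨Φ, pullbackPoisson Φ (cauchySymAlgebra hVW) Q hmul', Q, ?_⟩
  refine ⟨fun x a α => unzipIso_boxProd V.sym W hS hW' x a α,
    fun h a b => cauchySymAlgebra_mul_on hVW h a b, fun h a b α β => ?_, fun h a b α β => ?_,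
    fun c => ?_,
    fun h a b => ⟨hmul' h a b, hom_app_pullbackHom Φ Q.bracket (Q.isVectorBundle.sheafy hX')
      ((cauchySymAlgebra hVW).isVectorBundle.sheafy hX') h a b⟩⟩
  · refine (hadamardMul_on P₀ C h a α b β).trans ?_
    rw [cauchySymAlgebra_mul_on, Kernel.poissonAlgebra_mul_on]
  · refine (hadamardBracket_on P₀ C h a α b β).trans ?_
    rw [cauchySymAlgebra_mul_on]
  · have e1 : (boxUnit (V.sym.hadamard W)).app (∅ : Finset M) c =
        c ⟨(), rfl⟩ • boxProd (V.sym.hadamard W) ∅ 0 := boxUnit_app c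
    have e2 := hadamardUnit_app P₀ C c
    have e3 : P₀.unit.app (∅ : Finset M) (fun _ => 1) = boxProd V.sym ∅ 0 :=
      (boxUnit_app _).trans (one_smul _ _)
    have e4 : C.unit.app (∅ : Finset M) (fun _ => 1) = boxProd W ∅ 0 :=
      (boxUnit_app _).trans (one_smul _ _)
    rw [e3, e4] at e2
    refine (congrArg (Φ.hom.app (∅ : Finset M)) e1).trans (Eq.trans ?_ e2.symm)
    rw [map_smul]
    congr 1
    -- Over `∅` the class `boxProd` does not depend on the section, so the zero sections represent
    -- all three units.
    refine Eq.trans ?_ (unzipIso_boxProd V.sym W hS hW' ∅ 0 0)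
    exact congrArg _ (boxProd_congr _ (by simp))

end PoissonTensor

/-! ## The density bundle -/

section Densities

variable {K : Type} [RCLike K] {d : ℕ} {M : Type u} [TopologicalSpace M]
  [ChartedSpace (EuclideanSpace ℝ (Fin d)) M]

variable (K) in
/-- The density that takes the value `1` on the basis `B`. -/
def basisDensity {x : M} (B : Module.Basis (Fin d) ℝ (TangentSpace (𝓡 d) x)) :
    densitySpace K d M x :=
  ⟨fun v => ((|B.det v| : ℝ) : K), fun A v => by
    have h := B.det_comp A v
    change ((|B.det (A ∘ v)| : ℝ) : K) = _
    rw [h, abs_mul, RCLike.ofReal_mul]⟩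

theorem basisDensity_apply {x : M} (B : Module.Basis (Fin d) ℝ (TangentSpace (𝓡 d) x))
    (v : Fin d → TangentSpace (𝓡 d) x) : (basisDensity K B).1 v = ((|B.det v| : ℝ) : K) := rfl

/-- The linear map that takes the basis `B` to `v` has determinant `B.det v`, so the transformation
law determines `ν v` from `ν B`. -/
theorem density_eq_smul {x : M} (B : Module.Basis (Fin d) ℝ (TangentSpace (𝓡 d) x))
    (ν : densitySpace K d M x) : ν = ν.1 B • basisDensity K B := by
  refine Subtype.ext (funext fun v => ?_)
  have h := ν.2 (B.constr ℝ v) B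
  have hv : (fun i => B.constr ℝ v (B i)) = v := funext fun i => B.constr_basis ℝ v i
  have hdet : LinearMap.det (B.constr ℝ v) = B.det v := by
    have := B.det_comp (B.constr ℝ v) B
    rw [B.det_self, mul_one] at this
    rw [← this]
    congr 1
  rw [hv, hdet] at h
  rw [h, mul_comm]
  rfl

theorem contMDiffAt_det {N : Type*} [TopologicalSpace N] [ChartedSpace (EuclideanSpace ℝ (Fin d)) N]
    {m : N → Fin d → Fin d → ℝ} {x : N}
    (h : ∀ i j, ContMDiffAt (𝓡 d) 𝓘(ℝ, ℝ) ∞ (fun y => m y i j) x) :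
    ContMDiffAt (𝓡 d) 𝓘(ℝ, ℝ) ∞ (fun y => Matrix.det (Matrix.of (m y))) x := by
  have h1 : ContDiff ℝ ∞ fun a : Fin d → Fin d → ℝ => Matrix.det (Matrix.of a) := by
    simp only [Matrix.det_apply, Matrix.of_apply]
    fun_prop
  have h2 : ContMDiffAt (𝓡 d) 𝓘(ℝ, Fin d → Fin d → ℝ) ∞ m x :=
    contMDiffAt_pi_space.2 fun i => contMDiffAt_pi_space.2 fun j => h i j
  exact (h1.contMDiff.contMDiffAt (x := m x)).comp x h2

theorem contMDiffAt_ofReal_abs {N : Type*} [TopologicalSpace N]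
    [ChartedSpace (EuclideanSpace ℝ (Fin d)) N] {f : N → ℝ} {x : N} (hf : f x ≠ 0)
    (h : ContMDiffAt (𝓡 d) 𝓘(ℝ, ℝ) ∞ f x) :
    ContMDiffAt (𝓡 d) 𝓘(ℝ, K) ∞ (fun y => ((|f y| : ℝ) : K)) x := by
  have h1 : ContDiffAt ℝ ∞ (fun a : ℝ => ((|a| : ℝ) : K)) (f x) :=
    (RCLike.ofRealCLM (K := K)).contDiff.contDiffAt.comp _ (contDiffAt_abs hf)
  exact h1.contMDiffAt.comp x h

variable [IsManifold (𝓡 d) ∞ M]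

variable (K d M) in
-- The density `μ` with value `1` on a local tangent frame is a frame of rank one, and the
-- coefficient of a density is its value on that tangent frame.
theorem densities_isVectorBundle : (densities K d M).IsVectorBundle := by
  classical
  have hX := manifold_regular K d M
  have : IsManifold (𝓡 d) (∞ + 1) M := ‹IsManifold (𝓡 d) ∞ M›
  have : IsManifold (𝓡 d) (1 + 1) M := IsManifold.of_le (n := ∞) (by norm_cast)
  intro x₀
  let e := trivializationAt (EuclideanSpace ℝ (Fin d)) (TangentSpace (𝓡 d) (M := M)) x₀
  let b := (EuclideanSpace.basisFun (Fin d) ℝ).toBasis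
  have he : e.baseSet ∈ 𝓝 x₀ := e.open_baseSet.mem_nhds (FiberBundle.mem_baseSet_trivializationAt' x₀)
  let μ : ∀ x : M, densitySpace K d M x := fun x =>
    if hx : x ∈ e.baseSet then basisDensity K (e.basisAt b hx) else 0
  have hμ : ∀ {x : M} (hx : x ∈ e.baseSet), μ x = basisDensity K (e.basisAt b hx) := fun hx =>
    dif_pos hx
  have hframe : ∀ {x : M} (hx : x ∈ e.baseSet),
      (fun i => e.localFrame b i x) = e.basisAt b hx := fun hx =>
    funext fun i => e.localFrame_apply_of_mem_baseSet b hx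
  refine ⟨Unit, fun _ => μ, eventually_of_mem he fun y hy => ⟨?_, ?_, fun s => ⟨fun hs => ?_, ?_⟩⟩⟩
  · refine LinearIndependent.of_subsingleton () fun h => ?_
    replace h : μ y = 0 := h
    rw [hμ hy] at h
    have h1 := congrFun (congrArg Subtype.val h) (e.basisAt b hy)
    rw [basisDensity_apply, Module.Basis.det_self] at h1
    simp at h1
  · refine eq_top_iff.2 fun ν _ => ?_
    rw [density_eq_smul (e.basisAt b hy) ν, ← hμ hy]
    exact Submodule.smul_mem _ _ (Submodule.subset_span ⟨(), rfl⟩)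
  · refine ⟨{()}, fun _ z => (s z).1 fun i => e.localFrame b i z, fun _ _ => ?_, ?_⟩
    · refine hs (fun i => e.localFrame b i) (fun i => ?_) ?_
      · exact (e.open_baseSet.eventually_mem hy).mono fun z hz =>
          contMDiffAt_localFrame_of_mem ∞ e b i hz
      · rw [hframe hy]
        exact (e.basisAt b hy).linearIndependent
    · refine (e.open_baseSet.eventually_mem hy).mono fun z hz => ?_
      rw [Finset.sum_singleton]
      change s z = (s z).1 (fun i => e.localFrame b i z) • μ z
      rw [hframe hz, hμ hz]
      exact density_eq_smul _ _
  -- On another frame `X`, the density `μ` is the absolute value of the determinant of the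
  -- transition matrix. It is smooth because this determinant has no zero near `y`.
  · rintro ⟨J, c, hc, hs⟩ X hXs hXi
    have hdet : ∀ᶠ z in 𝓝 y, ContMDiffAt (𝓡 d) 𝓘(ℝ, ℝ) ∞ (fun z => Matrix.det (Matrix.of
        fun i j => e.localFrameCoeff (𝓡 d) b i z (X j z))) z := by
      filter_upwards [eventually_all.2 hXs, e.open_baseSet.eventually_mem hy] with z h1 h2
      exact contMDiffAt_det fun i j => contMDiffAt_localFrameCoeff b h2 (h1 j) i
    have heq : ∀ {z : M} (hz : z ∈ e.baseSet), (e.basisAt b hz).det (fun j => X j z) =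
        Matrix.det (Matrix.of fun i j => e.localFrameCoeff (𝓡 d) b i z (X j z)) := by
      intro z hz
      rw [Module.Basis.det_apply]
      congr 1
      ext i j
      exact (e.localFrameCoeff_apply_of_mem_baseSet b hz (X j) i).symm
    have hne : ∀ᶠ z in 𝓝 y, Matrix.det (Matrix.of
        fun i j => e.localFrameCoeff (𝓡 d) b i z (X j z)) ≠ 0 := by
      refine hdet.self_of_nhds.continuousAt.eventually_ne ?_
      rw [← heq hy]
      have : FiniteDimensional ℝ (TangentSpace (𝓡 d) y) := (e.basisAt b hy).finiteDimensional_of_finite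
      have hsp := hXi.span_eq_top_of_card_eq_finrank'
        (Module.finrank_eq_card_basis (e.basisAt b hy)).symm
      exact (((e.basisAt b hy).is_basis_iff_det).1 ⟨hXi, hsp⟩).ne_zero
    have hsm : (manifold K d M).SmoothAt (fun z => ((|Matrix.det (Matrix.of
        fun i j => e.localFrameCoeff (𝓡 d) b i z (X j z))| : ℝ) : K)) y := by
      filter_upwards [hdet, hne] with z h1 h2
      exact contMDiffAt_ofReal_abs h2 h1
    refine hX.congr (hX.sum J fun i hi => hX.mul (hc i hi) hsm) ?_
    filter_upwards [hs, e.open_baseSet.eventually_mem hy] with z h1 h2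
    rw [h1, ← heq h2, hμ h2, ← Finset.sum_smul, ← Finset.sum_mul]
    rfl

end Densities

end

end ConfBundle

/-! ### The theorem -/

theorem mainTheorem8 {K : Type} [RCLike K] {d : ℕ} {M : Type u} [TopologicalSpace M] [T2Space M]
    [ChartedSpace (EuclideanSpace ℝ (Fin d)) M] [IsManifold (𝓡 d) ∞ M]
    (V : ConfBundle.BundleData.{u, v} (ConfBundle.manifold K d M)) (hV : V.IsVectorBundle)
    (k : ConfBundle.Kernel V) (hk : k.IsAntisymm) :
    ∃ P₀ : ConfBundle.PoissonCauchyAlgebra V.sym.cauchySym,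
      (∀ (x y z : Finset M) (h : ConfBundle.IsSplit x y z) (a : ConfBundle.SFiber V.sym x)
        (b : ConfBundle.SFiber V.sym y),
        P₀.mul.on h a b = ConfBundle.boxdot V.sym h a b) ∧
      ConfBundle.IsKernelBracket k P₀.bracket ∧
      (∀ B, ConfBundle.IsKernelBracket k B → B = P₀.bracket) ∧
      (∀ W : ConfBundle.BundleData.{u, w} (ConfBundle.manifold K d M), W.IsVectorBundle →
        ∃ (Φ : ConfBundle.Iso (V.sym.hadamard W).cauchySym
            (V.sym.cauchySym.hadamard W.cauchySym))
          (P : ConfBundle.PoissonCauchyAlgebra (V.sym.hadamard W).cauchySym)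
          (Q : ConfBundle.PoissonCauchyAlgebra (V.sym.cauchySym.hadamard W.cauchySym)),
          ConfBundle.IsPoissonTensor V W P₀.bracket Φ P Q) ∧
      (ConfBundle.densities K d M).IsVectorBundle ∧
      ∃ (Φ : ConfBundle.Iso (V.sym.hadamard (ConfBundle.densities K d M)).cauchySym
          (V.sym.cauchySym.hadamard (ConfBundle.densities K d M).cauchySym))
        (P : ConfBundle.PoissonCauchyAlgebra
          (V.sym.hadamard (ConfBundle.densities K d M)).cauchySym)
        (Q : ConfBundle.PoissonCauchyAlgebra
          (V.sym.cauchySym.hadamard (ConfBundle.densities K d M).cauchySym)),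
        ConfBundle.IsPoissonTensor V (ConfBundle.densities K d M) P₀.bracket Φ P Q := by
  have hD := ConfBundle.densities_isVectorBundle K d M
  exact ⟨k.poissonAlgebra hk hV, fun _ _ _ => k.poissonAlgebra_mul_on hk hV, k.isKernelBracket,
    fun _ hB => hB.ext k.isKernelBracket, fun _ hW => k.exists_isPoissonTensor hk hV hW, hD,
    k.exists_isPoissonTensor hk hV hD⟩
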